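/- Let $d\ge 4$ and let $P\subset\mathbb R^d$ be a $d$-dimensional parallelohedron centred at the origin. Let $\mathcal T(P)=\{P+t : t\in\Lambda\}$ be its face-to-face tiling of $\mathbb R^d$ by translates, where $\Lambda=\Lambda(P)$ is the lattice of centres of the tiles, and write $\bar x\in\Lambda/2\Lambda$ for the class of $x\in\Lambda$. **Dual cells.** For a face $G$ of the tiling of dimension $d-k$, the dual $k$-cell $D(G)\subset\Lambda$ is the set of centres of the tiles that have $G$ as a face; its subcells are the sets $D(G')$ with $G'\supseteq G$ a face of the tiling, and these define the combinatorial type of $D(G)$. A $(d-2)$-face $E$ of $P$ is primitive if $|D(E)|=3$. **Venkov complex.** Let $$O(a,b,c,a',b',c')=\{\{a,b,c\},\{a',b',c'\},\{a',b,c\},\{a,b',c'\},\{a,b',c\},\{a',b,c'\},\{a,b,c'\},\{a',b',c\}\}.$$ To each dual 3-cell $D$ attach a set $X(D)$ of triples of elements of $\Lambda/2\Lambda$ as follows. * If $D=\{a,b,c,d\}$ is a combinatorial tetrahedron, $X(D)=O(\overline{a+b},\overline{a+c},\overline{a+d},\overline{c+d},\overline{b+d},\overline{b+c})$. * If $D=\{s,a,b,c,d\}$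 is a combinatorial quadrangular pyramid with apex $s$ and $a+c=b+d$, where $a,c$ and $b,d$ are opposite vertices of the base, $X(D)=O(\overline{s+a},\overline{s+b},\overline{a+d},\overline{s+c},\overline{s+d},\overline{a+b})$. * If $D=\{a,b,c,d,e,f\}$ is a combinatorial octahedron with opposite pairs $\{a,d\},\{b,e\},\{c,f\}$ and $a+d=b+e=c+f$, $X(D)=O(\overline{a+b},\overline{a+c},\overline{b+c},\overline{a+e},\overline{a+f},\overline{b+f})$. * If $D=\{a,b,c,a',b',c'\}$ is a combinatorial triangular prism with bases $abc$, $a'b'c'$ and $a-a'=b-b'=c-c'$, $X(D)=\{\{\overline{a+b},\overline{a+c},\overline{b+c}\}\}$. * If $D$ is a combinatorial cube, $X(D)=\varnothing$. The Venkov complex $Ven(P)$ is the simplicial complex whose faces are the nonempty subsets of the triples in $X=\bigcup_D X(D)$, where $D$ runs over all dual 3-cells of the tiling. **Cycles.** For a facet $F=P\cap(P+t)$ of $P$, $t\in\Lambda$, call $\bar t$ the label of the pair $\{F,-F\}$. * A half-belt cycle is a cycle $[x_1,x_2,x_3,x_1]$ of labels of facets $F_1,F_2,F_3$ of $P$ such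 that $F_1\cap F_2$, $F_2\cap F_3$ and $F_3\cap(-F_1)$ are primitive $(d-2)$-faces of $P$ and $F_1,F_2,F_3$ are all parallel to some primitive $(d-2)$-face of $P$. * A trivially contractible cycle is a cycle $[x_1,\dots,x_k,x_1]$ of labels of distinct facets $F_1,\dots,F_k$ of $P$ that share a common $(d-3)$-face of $P$, such that $F_1\cap F_2,\dots,F_{k-1}\cap F_k$ and $F_k\cap F_1$ are primitive $(d-2)$-faces of $P$. **Claim.** Suppose that every cochain $c\in C^1(Ven(P),\mathbb Q)$ that vanishes on all half-belt cycles and on all trivially contractible cycles is a coboundary. Then $H^1(Ven(P),\mathbb R)$ is trivial. -/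

import Mathlib

open scoped Pointwise

noncomputable section

namespace Venkov

/-! ## Parallelohedra and their tilings -/

/-- `F` is a nonempty face of the convex polytope `Q` (`Q` itself is allowed): the set of points of
`Q` at which some linear functional attains its maximum over `Q`. -/
def IsFace {d : ℕ} (Q F : Set (EuclideanSpace ℝ (Fin d))) : Prop :=
  F.Nonempty ∧ IsExposed ℝ Q F

/-- The dimension of the affine hull of a set. -/
def dim {d : ℕ} (F : Set (EuclideanSpace ℝ (Fin d))) : ℕ :=
  Module.finrank ℝ (vectorSpan ℝ F)

/-- A `d`-dimensional parallelohedron `P` centred at the origin, together with the lattice `Λ(P)`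
of the centres of the tiles of its face-to-face tiling `T(P) = {P + t | t ∈ Λ(P)}`. -/
structure Parallelohedron (d : ℕ) where
  /-- the polytope `P` -/
  body : Set (EuclideanSpace ℝ (Fin d))
  /-- the lattice `Λ(P)` -/
  lattice : AddSubgroup (EuclideanSpace ℝ (Fin d))
  /-- `P` is a convex polytope -/
  polytope : ∃ S : Finset (EuclideanSpace ℝ (Fin d)),
    body = convexHull ℝ (S : Set (EuclideanSpace ℝ (Fin d)))
  /-- `P` has dimension `d` -/
  interior_nonempty : (interior body).Nonempty
  /-- the origin is the centre of `P` -/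
  neg_body : -body = body
  /-- the tiles cover the space -/
  cover : ⋃ t : lattice, ((t : EuclideanSpace ℝ (Fin d)) +ᵥ body) = Set.univ
  /-- distinct tiles have disjoint interiors -/
  disjoint_interior : ∀ s t : lattice, s ≠ t →
    Disjoint (interior ((s : EuclideanSpace ℝ (Fin d)) +ᵥ body))
      (interior ((t : EuclideanSpace ℝ (Fin d)) +ᵥ body))
  /-- the tiling is face-to-face -/
  face_to_face : ∀ s t : lattice,
    (((s : EuclideanSpace ℝ (Fin d)) +ᵥ body) ∩
      ((t : EuclideanSpace ℝ (Fin d)) +ᵥ body)).Nonempty →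
    IsFace ((s : EuclideanSpace ℝ (Fin d)) +ᵥ body)
      (((s : EuclideanSpace ℝ (Fin d)) +ᵥ body) ∩ ((t : EuclideanSpace ℝ (Fin d)) +ᵥ body))

/-- The tile `P + t` of the tiling. -/
def tile {d : ℕ} (P : Parallelohedron d) (t : P.lattice) : Set (EuclideanSpace ℝ (Fin d)) :=
  (t : EuclideanSpace ℝ (Fin d)) +ᵥ P.body

/-- `G` is a face of the tiling, that is, a face of some tile. -/
def IsTilingFace {d : ℕ} (P : Parallelohedron d) (G : Set (EuclideanSpace ℝ (Fin d))) : Prop :=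
  ∃ t : P.lattice, IsFace (tile P t) G

/-- The dual cell `D(G)`: the centres of all tiles that have `G` as a face. -/
def dualCell {d : ℕ} (P : Parallelohedron d) (G : Set (EuclideanSpace ℝ (Fin d))) :
    Set P.lattice :=
  {t | IsFace (tile P t) G}

/-- The facets, i.e. the `(d-1)`-dimensional faces, of `P`. -/
def IsFacet {d : ℕ} (P : Parallelohedron d) (F : Set (EuclideanSpace ℝ (Fin d))) : Prop :=
  IsFace P.body F ∧ dim F + 1 = d

/-- The primitive `(d-2)`-faces of `P`: those that belong to exactly three tiles. -/
def IsPrimitive {d : ℕ} (P : Parallelohedron d) (E : Set (EuclideanSpace ℝ (Fin d))) : Prop :=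
  IsFace P.body E ∧ dim E + 2 = d ∧ (dualCell P E).ncard = 3

/-- The group `Λ(P) / 2Λ(P)` of parity classes. -/
abbrev Parity {d : ℕ} (P : Parallelohedron d) : Type :=
  P.lattice ⧸ (nsmulAddMonoidHom (α := P.lattice) 2).range

/-- The parity class of a lattice point. -/
def parity {d : ℕ} (P : Parallelohedron d) (x : P.lattice) : Parity P :=
  QuotientAddGroup.mk x

/-! ## Simplicial complexes and their first cohomology -/

/-- The simplicial complex `C(X)` whose maximal faces are the elements of `X` (for a set `X` of
finite sets of equal cardinality): its faces are the nonempty subsets of elements of `X`. -/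
def complexOf {A : Type*} (X : Set (Finset A)) : PreAbstractSimplicialComplex A where
  faces := {s | s.Nonempty ∧ ∃ S ∈ X, s ⊆ S}
  isRelLowerSet_faces := by
    rintro s ⟨hs, S, hS, hsS⟩
    exact ⟨hs, fun t hts ht => ⟨ht, S, hS, hts.trans hsS⟩⟩

/-- `x` is a vertex of `K`. -/
def IsVertex {A : Type*} (K : PreAbstractSimplicialComplex A) (x : A) : Prop :=
  {x} ∈ K.faces

open scoped Classical in
/-- `(x, y)` is an oriented edge of `K`. -/
def IsEdge {A : Type*} (K : PreAbstractSimplicialComplex A) (x y : A) : Prop :=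
  x ≠ y ∧ {x, y} ∈ K.faces

open scoped Classical in
/-- `(x, y, z)` is an ordered 2-dimensional face of `K`. -/
def IsTriangle {A : Type*} (K : PreAbstractSimplicialComplex A) (x y z : A) : Prop :=
  x ≠ y ∧ y ≠ z ∧ x ≠ z ∧ {x, y, z} ∈ K.faces

/-- The 0-cochains: functions on the vertices of `K`, extended by zero to all labels. -/
def C0 {A : Type*} (K : PreAbstractSimplicialComplex A) (R : Type*) [CommRing R] :
    Submodule R (A → R) where
  carrier := {u | ∀ x, ¬ IsVertex K x → u x = 0}
  zero_mem' := fun _ _ => rfl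
  add_mem' := fun {u v} hu hv x hx => by simp [hu x hx, hv x hx]
  smul_mem' := fun r u hu x hx => by simp [hu x hx]

/-- The 1-cochains: functions on the oriented edges of `K` that change sign when the orientation is
reversed, extended by zero to all pairs of labels. -/
def C1 {A : Type*} (K : PreAbstractSimplicialComplex A) (R : Type*) [CommRing R] :
    Submodule R (A → A → R) where
  carrier := {c | (∀ x y, c y x = -c x y) ∧ ∀ x y, ¬ IsEdge K x y → c x y = 0}
  zero_mem' := ⟨fun _ _ => by simp, fun _ _ _ => rfl⟩
  add_mem' := fun {b c} hb hc =>
    ⟨fun x y => by simp only [Pi.add_apply]; rw [hb.1 x y, hc.1 x y]; ring,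
      fun x y h => by simp [hb.2 x y h, hc.2 x y h]⟩
  smul_mem' := fun r c hc =>
    ⟨fun x y => by simp only [Pi.smul_apply, smul_eq_mul]; rw [hc.1 x y]; ring,
      fun x y h => by simp [hc.2 x y h]⟩

theorem IsEdge.symm {A : Type*} {K : PreAbstractSimplicialComplex A} {x y : A}
    (h : IsEdge K x y) : IsEdge K y x := by
  classical
  obtain ⟨hne, hf⟩ := h
  refine ⟨hne.symm, ?_⟩
  convert hf using 1
  ext z
  simp [or_comm]

open scoped Classical in
/-- The coboundary `C⁰ → C¹`: on an oriented edge `(x, y)` its value is `u y - u x`. -/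
def coboundary0 {A : Type*} (K : PreAbstractSimplicialComplex A) (R : Type*) [CommRing R] :
    C0 K R →ₗ[R] C1 K R where
  toFun u := ⟨fun x y => if IsEdge K x y then u.1 y - u.1 x else 0, by
    refine ⟨fun x y => ?_, fun x y h => by simp [h]⟩
    by_cases h : IsEdge K x y
    · simp [h, h.symm]
    · have h2 : ¬ IsEdge K y x := fun h' => h h'.symm
      simp [h, h2]⟩
  map_add' u v := by
    ext x y
    by_cases h : IsEdge K x y
    · simp [h]; ring
    · simp [h]
  map_smul' r u := by
    ext x y
    by_cases h : IsEdge K x y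
    · simp [h]; ring
    · simp [h]

/-- The coboundary of a 1-cochain, as a function on the ordered triangles `(x, y, z)`: the value of
the cochain on the boundary of the triangle. -/
def coboundary1 {A : Type*} (K : PreAbstractSimplicialComplex A) (R : Type*) [CommRing R] :
    C1 K R →ₗ[R] ({p : A × A × A // IsTriangle K p.1 p.2.1 p.2.2} → R) where
  toFun c p := c.1 p.1.1 p.1.2.1 + c.1 p.1.2.1 p.1.2.2 + c.1 p.1.2.2 p.1.1
  map_add' b c := by
    ext p
    simp only [Submodule.coe_add, Pi.add_apply]
    ring
  map_smul' r c := by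
    ext p
    simp only [Submodule.coe_smul, Pi.smul_apply, smul_eq_mul, RingHom.id_apply]
    ring

/-- The 1-cocycles. -/
def Z1 {A : Type*} (K : PreAbstractSimplicialComplex A) (R : Type*) [CommRing R] :
    Submodule R (C1 K R) :=
  LinearMap.ker (coboundary1 K R)

/-- The 1-coboundaries. -/
def B1 {A : Type*} (K : PreAbstractSimplicialComplex A) (R : Type*) [CommRing R] :
    Submodule R (C1 K R) :=
  LinearMap.range (coboundary0 K R)

/-- Coboundaries are cocycles. -/
theorem B1_le_Z1 {A : Type*} (K : PreAbstractSimplicialComplex A) (R : Type*) [CommRing R] :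
    B1 K R ≤ Z1 K R := by
  classical
  rintro _ ⟨u, rfl⟩
  refine LinearMap.mem_ker.2 ?_
  ext ⟨⟨x, y, z⟩, hxy, hyz, hxz, hf⟩
  simp only at hxy hyz hxz hf
  have edge : ∀ a b : A, a ≠ b → ({a, b} : Finset A) ⊆ {x, y, z} → IsEdge K a b := by
    intro a b hab hs
    exact ⟨hab, (K.isRelLowerSet_faces hf).2 hs (by simp)⟩
  have h1 : IsEdge K x y := edge x y hxy (by intro t; simp; tauto)
  have h2 : IsEdge K y z := edge y z hyz (by intro t; simp; tauto)
  have h3 : IsEdge K z x := edge z x hxz.symm (by intro t; simp; tauto)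
  simp [coboundary1, coboundary0, h1, h2, h3]

/-- The cohomology `ker g / im f` at the middle term of `N → M → L`. -/
abbrev middleCohomology {R N M L : Type*} [CommRing R] [AddCommGroup N] [AddCommGroup M]
    [AddCommGroup L] [Module R N] [Module R M] [Module R L] (f : N →ₗ[R] M) (g : M →ₗ[R] L) :
    Type _ :=
  LinearMap.ker g ⧸ (LinearMap.range f).submoduleOf (LinearMap.ker g)

/-- The first cohomology module `H¹(K, R)`: cocycles modulo coboundaries. -/
abbrev H1 {A : Type*} (K : PreAbstractSimplicialComplex A) (R : Type*) [CommRing R] : Type _ :=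
  middleCohomology (coboundary0 K R) (coboundary1 K R)

/-! ## The Venkov complex -/

open scoped Classical in
/-- The eight triangles of the surface of an octahedron with the pairs of opposite vertices
`a, a'`, `b, b'`, `c, c'`. -/
def octa {A : Type*} (a b c a' b' c' : A) : Set (Finset A) :=
  {{a, b, c}, {a', b', c'}, {a', b, c}, {a, b', c'}, {a, b', c}, {a', b, c'}, {a, b, c'},
    {a', b', c}}

/-- The 2-dimensional subcells of the dual cell `D(G)`, i.e. the dual cells of the
`(d-2)`-dimensional faces of the tiling that contain `G`. -/
def dualTwoCells {d : ℕ} (P : Parallelohedron d) (G : Set (EuclideanSpace ℝ (Fin d))) :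
    Set (Set P.lattice) :=
  {D | ∃ E, IsTilingFace P E ∧ dim E + 2 = d ∧ G ⊆ E ∧ D = dualCell P E}

/-- `D(G)` is a combinatorial tetrahedron with vertices `a, b, c, d'`. Here and below the
combinatorial type of a dual 3-cell is expressed by the vertex sets of its 2-dimensional faces. -/
def IsTetrahedron {d : ℕ} (P : Parallelohedron d) (G : Set (EuclideanSpace ℝ (Fin d)))
    (a b c d' : P.lattice) : Prop :=
  [a, b, c, d'].Nodup ∧ dualCell P G = {a, b, c, d'} ∧
  dualTwoCells P G = {{a, b, c}, {a, b, d'}, {a, c, d'}, {b, c, d'}}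

/-- `D(G)` is a combinatorial quadrangular pyramid with apex `s` and base `a, b, c, d'` in cyclic
order, and `a + c = b + d'`. -/
def IsPyramid {d : ℕ} (P : Parallelohedron d) (G : Set (EuclideanSpace ℝ (Fin d)))
    (s a b c d' : P.lattice) : Prop :=
  [s, a, b, c, d'].Nodup ∧ dualCell P G = {s, a, b, c, d'} ∧
  dualTwoCells P G = {{s, a, b}, {s, b, c}, {s, c, d'}, {s, d', a}, {a, b, c, d'}} ∧
  a + c = b + d'

/-- `D(G)` is a combinatorial octahedron with the pairs of opposite vertices `a, d'`, `b, e` and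
`c, f`, and `a + d' = b + e = c + f`. -/
def IsOctahedron {d : ℕ} (P : Parallelohedron d) (G : Set (EuclideanSpace ℝ (Fin d)))
    (a b c d' e f : P.lattice) : Prop :=
  [a, b, c, d', e, f].Nodup ∧ dualCell P G = {a, b, c, d', e, f} ∧
  dualTwoCells P G = {{a, b, c}, {a, b, f}, {a, e, c}, {a, e, f},
    {d', b, c}, {d', b, f}, {d', e, c}, {d', e, f}} ∧
  a + d' = b + e ∧ b + e = c + f

/-- `D(G)` is a combinatorial triangular prism with bases `a, b, c` and `a', b', c'` and lateral
edges `a a'`, `b b'`, `c c'`, and `a - a' = b - b' = c - c'`. -/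
def IsPrism {d : ℕ} (P : Parallelohedron d) (G : Set (EuclideanSpace ℝ (Fin d)))
    (a b c a' b' c' : P.lattice) : Prop :=
  [a, b, c, a', b', c'].Nodup ∧ dualCell P G = {a, b, c, a', b', c'} ∧
  dualTwoCells P G = {{a, b, c}, {a', b', c'}, {a, b, b', a'}, {b, c, c', b'}, {c, a, a', c'}} ∧
  a - a' = b - b' ∧ b - b' = c - c'

open scoped Classical in
/-- The set `X(D)` of triples of parity classes attached to the dual 3-cell `D = D(G)`. A
combinatorial cube contributes no triples. -/
def cellTriples {d : ℕ} (P : Parallelohedron d) (G : Set (EuclideanSpace ℝ (Fin d))) :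
    Set (Finset (Parity P)) :=
  {T | (∃ a b c d', IsTetrahedron P G a b c d' ∧
        T ∈ octa (parity P (a + b)) (parity P (a + c)) (parity P (a + d'))
          (parity P (c + d')) (parity P (b + d')) (parity P (b + c))) ∨
      (∃ s a b c d', IsPyramid P G s a b c d' ∧
        T ∈ octa (parity P (s + a)) (parity P (s + b)) (parity P (a + d'))
          (parity P (s + c)) (parity P (s + d')) (parity P (a + b))) ∨
      (∃ a b c d' e f, IsOctahedron P G a b c d' e f ∧
        T ∈ octa (parity P (a + b)) (parity P (a + c)) (parity P (b + c))
          (parity P (a + e)) (parity P (a + f)) (parity P (b + f))) ∨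
      (∃ a b c a' b' c', IsPrism P G a b c a' b' c' ∧
        T = {parity P (a + b), parity P (a + c), parity P (b + c)})}

/-- The set `X`: the union of the `X(D)` over all dual 3-cells `D` of the tiling. -/
def triples {d : ℕ} (P : Parallelohedron d) : Set (Finset (Parity P)) :=
  {T | ∃ G, IsTilingFace P G ∧ dim G + 3 = d ∧ T ∈ cellTriples P G}

/-- The Venkov complex `Ven(P)`. -/
def Ven {d : ℕ} (P : Parallelohedron d) : PreAbstractSimplicialComplex (Parity P) :=
  complexOf (triples P)

/-! ## Half-belt and trivially contractible cycles -/

/-- `x` is the label of the pair `{F, -F}` of opposite facets: `F = P ∩ (P + t)` for a lattice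
vector `t` of parity class `x`. -/
def HasLabel {d : ℕ} (P : Parallelohedron d) (F : Set (EuclideanSpace ℝ (Fin d)))
    (x : Parity P) : Prop :=
  IsFacet P F ∧ ∃ t : P.lattice, F = P.body ∩ tile P t ∧ x = parity P t

/-- The labels `x 0, x 1, x 2` form a half-belt cycle `[x 0, x 1, x 2, x 0]`: there are facets
`F₁, F₂, F₃` with these labels such that a path crossing primitive `(d-2)`-faces visits
`F₁, F₂, F₃, -F₁` in turn, and all three are parallel to one primitive `(d-2)`-face `G`. -/
def IsHalfBelt {d : ℕ} (P : Parallelohedron d) (x : Fin 3 → Parity P) : Prop :=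
  ∃ F₁ F₂ F₃ G : Set (EuclideanSpace ℝ (Fin d)),
    HasLabel P F₁ (x 0) ∧ HasLabel P F₂ (x 1) ∧ HasLabel P F₃ (x 2) ∧
    IsPrimitive P (F₁ ∩ F₂) ∧ IsPrimitive P (F₂ ∩ F₃) ∧ IsPrimitive P (F₃ ∩ -F₁) ∧
    IsPrimitive P G ∧
    vectorSpan ℝ G ≤ vectorSpan ℝ F₁ ∧ vectorSpan ℝ G ≤ vectorSpan ℝ F₂ ∧
    vectorSpan ℝ G ≤ vectorSpan ℝ F₃

/-- The labels `x 0, …, x k` form a trivially contractible cycle `[x 0, …, x k, x 0]`: there are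
distinct facets `F 0, …, F k` with these labels that share a `(d-3)`-face `G` of `P`, and a closed
path crossing primitive `(d-2)`-faces visits them in turn. The index `i + 1` is cyclic. -/
def IsTriviallyContractible {d : ℕ} (P : Parallelohedron d) {k : ℕ} (x : Fin (k + 1) → Parity P) :
    Prop :=
  ∃ (F : Fin (k + 1) → Set (EuclideanSpace ℝ (Fin d))) (G : Set (EuclideanSpace ℝ (Fin d))),
    (∀ i, HasLabel P (F i) (x i)) ∧ Function.Injective F ∧
    IsFace P.body G ∧ dim G + 3 = d ∧ (∀ i, G ⊆ F i) ∧
    ∀ i, IsPrimitive P (F i ∩ F (i + 1))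

/-- The value of a 1-cochain on the closed chain `[x 0, …, x k, x 0]`. -/
def evalCycle {A : Type*} {K : PreAbstractSimplicialComplex A} {R : Type*} [CommRing R]
    (c : C1 K R) {k : ℕ} (x : Fin (k + 1) → A) : R :=
  ∑ i, c.1 (x i) (x (i + 1))

/-- The cochain form of the GGM condition: every rational 1-cochain of `Ven(P)` that vanishes on
all half-belt cycles and on all trivially contractible cycles is a coboundary. -/
def GGMCochainCondition {d : ℕ} (P : Parallelohedron d) : Prop :=
  ∀ c : C1 (Ven P) ℚ,
    (∀ x : Fin 3 → Parity P, IsHalfBelt P x → evalCycle c x = 0) →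
    (∀ (k : ℕ) (x : Fin (k + 1) → Parity P), IsTriviallyContractible P x → evalCycle c x = 0) →
    c ∈ B1 (Ven P) ℚ

end Venkov

end

/-!
A real 1-cocycle `c` of `Ven P` has to be shown to be a coboundary, and the hypothesis only speaks
of rational cochains. For every `ℚ`-linear functional `φ : ℝ → ℚ` the composition `φ ∘ c` is a rational
cocycle. If rational cocycles are coboundaries, then `φ ∘ c` vanishes on all rational cycles for
every `φ`; hence so does `c`, as the functionals separate the points of `ℝ`, and `c` factors through
the boundary operator, which makes it a coboundary (`mem_B1_of_mapCochain_mem`). So it suffices that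
every cocycle, with any coefficients, vanishes on half-belt cycles and on trivially contractible
cycles.

Both facts come from one property of the Venkov complex, `exists_cone_point`. Let `G` be a face of
codimension three and `v` a vertex of the dual cell `D(G)`. The labels `v + t`, for the edges `v t`
of the triangles of `D(G)` at `v`, lie in a cone: one label `z` spans a face of `Ven P` with each pair
`v + t`, `v + t'` that comes from a triangle `v t t'`. Moreover `v + t`, `v + t'`, `t + t'` always
span a face. For a trivially contractible cycle one takes `v = 0`, the centre of `P`; near the
cycle, a cocycle is then the coboundary of its values on the edges from `z`. For a half-belt, the
lattice vectors of the three facets are `t₁`, `t₂`, `t₂ - t₁` (`eq_sub_of_halfBelt`, by the position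
of the three parallel faces in the facet `-F₁`, which has at most two facets of one direction), so
that the labels are those of the sides of the triangle `0 t₁ t₂`.

The cone is read off from the type of the dual 3-cell, and the definition of `Ven P` only attaches
triples to a cell whose type is known. So the classification of the dual 3-cells that contain a
triangle has to be proved (`dualThreeCell_cases`). The tiles around a face of codimension two form a
triangle or a parallelogram (`dualTwoCell_cases`). In codimension three the argument is linear
algebra modulo the direction of `G`: if two positive combinations of the directions from `G` to the
centres `s, s'` and `u, u'` coincide, and neither pair of tiles meets in `G` only, then the
combinations are multiples of the midpoints, `P_s ∩ P_s' = P_u ∩ P_u'` (`inter_eq_of_crossing`), and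
`s s'`, `u u'` are the diagonals of a dual parallelogram. If no two tiles meet in `G` only, a linear
form of the nonplanarity of `K₅` (`exists_balanced_dependency`) yields a dual parallelogram among
any five vertices, which leaves tetrahedra, pyramids and prisms. If two tiles meet in `G` only, the cell is
centrally symmetric, and a triangle with its opposite one exhausts the vertices (`mem_of_central`),
which leaves octahedra.
-/

/-! ### Faces of polytopes -/

namespace Venkov

section Polytopes

variable {d : ℕ} {Q F G H : Set (EuclideanSpace ℝ (Fin d))}

theorem isFace_iff : IsFace Q F ↔ F.Nonempty ∧ ∃ (l : EuclideanSpace ℝ (Fin d) →ₗ[ℝ] ℝ) (m : ℝ),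
    (∀ x ∈ Q, l x ≤ m) ∧ F = {x ∈ Q | l x = m} := by
  constructor
  · rintro ⟨hne, h⟩
    obtain ⟨l, hl⟩ := h hne
    obtain ⟨f, hf⟩ := hne
    have hf' := hf
    rw [hl] at hf'
    refine ⟨⟨f, hf⟩, l.toLinearMap, l f, fun x hx => hf'.2 x hx, ?_⟩
    rw [hl]
    ext x
    refine and_congr_right fun hx => ⟨fun h => le_antisymm (hf'.2 x hx) (h f hf'.1), fun h y hy => ?_⟩
    have : l x = l f := h
    rw [this]
    exact hf'.2 y hy
  · rintro ⟨⟨f, hf⟩, l, m, hle, rfl⟩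
    refine ⟨⟨f, hf⟩, fun _ => ⟨LinearMap.toContinuousLinearMap l, ?_⟩⟩
    ext x
    refine and_congr_right fun hx => ⟨fun h y hy => ?_, fun h => le_antisymm (hle x hx) ?_⟩
    · have : l x = m := h
      simpa [this] using hle y hy
    · have := h f hf.1
      have h2 : l f = m := hf.2
      simpa [h2] using this

theorem IsFace.nonempty (h : IsFace Q F) : F.Nonempty := h.1

theorem IsFace.subset (h : IsFace Q F) : F ⊆ Q := by
  obtain ⟨-, l, m, -, rfl⟩ := isFace_iff.1 h
  exact fun x hx => hx.1

/-- A face of `Q` that lies in `H ⊆ Q` is a face of `H`. -/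
theorem IsFace.of_subset (h : IsFace Q F) (hFH : F ⊆ H) (hHQ : H ⊆ Q) : IsFace H F := by
  obtain ⟨hne, l, m, hle, hF⟩ := isFace_iff.1 h
  refine isFace_iff.2 ⟨hne, l, m, fun x hx => hle x (hHQ hx), ?_⟩
  ext x
  constructor
  · intro hx
    refine ⟨hFH hx, ?_⟩
    rw [hF] at hx
    exact hx.2
  · rintro ⟨hx, hxm⟩
    rw [hF]
    exact ⟨hHQ hx, hxm⟩

theorem IsFace.inter (hF : IsFace Q F) (hG : IsFace Q G) (hne : (F ∩ G).Nonempty) :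
    IsFace Q (F ∩ G) :=
  ⟨hne, hF.2.inter hG.2⟩

theorem IsFace.convex (h : IsFace Q F) (hQ : Convex ℝ Q) : Convex ℝ F :=
  IsExposed.convex h.2 hQ

theorem sub_mem_vectorSpan {x y : EuclideanSpace ℝ (Fin d)} (hx : x ∈ F) (hy : y ∈ F) :
    x - y ∈ vectorSpan ℝ F :=
  vsub_mem_vectorSpan ℝ hx hy

/-- A linear functional that is constant on `F` vanishes on the direction space of `F`. -/
theorem vectorSpan_le_ker {l : EuclideanSpace ℝ (Fin d) →ₗ[ℝ] ℝ} {m : ℝ}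
    (h : ∀ x ∈ F, l x = m) : vectorSpan ℝ F ≤ LinearMap.ker l := by
  rw [vectorSpan, Submodule.span_le]
  rintro _ ⟨x, hx, y, hy, rfl⟩
  simp [h x hx, h y hy]

theorem IsFace.mem_of_sub_mem (h : IsFace Q F) {x f : EuclideanSpace ℝ (Fin d)} (hx : x ∈ Q)
    (hf : f ∈ F) (hxf : x - f ∈ vectorSpan ℝ F) : x ∈ F := by
  obtain ⟨-, l, m, hle, rfl⟩ := isFace_iff.1 h
  have h1 := vectorSpan_le_ker (l := l) (m := m) (fun y hy => hy.2) hxf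
  have h2 : l f = m := hf.2
  refine ⟨hx, ?_⟩
  simp only [LinearMap.mem_ker, map_sub] at h1
  linarith

theorem dim_mono (h : F ⊆ G) : dim F ≤ dim G :=
  Submodule.finrank_mono (vectorSpan_mono ℝ h)

/-- A face of `Q` is not contained in a larger subset of `Q` of the same dimension. -/
theorem IsFace.eq_of_dim_le (h : IsFace Q F) (hFH : F ⊆ H) (hHQ : H ⊆ Q) (hd : dim H ≤ dim F) :
    F = H := by
  refine hFH.antisymm fun x hx => ?_
  obtain ⟨f, hf⟩ := h.nonempty
  refine h.mem_of_sub_mem (hHQ hx) hf ?_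
  have := Submodule.eq_of_le_of_finrank_le (vectorSpan_mono ℝ hFH) hd
  rw [this]
  exact sub_mem_vectorSpan hx (hFH hf)

theorem IsFace.dim_lt (h : IsFace Q F) (hFH : F ⊆ H) (hHQ : H ⊆ Q) (hne : F ≠ H) :
    dim F < dim H := by
  by_contra hlt
  exact hne (h.eq_of_dim_le hFH hHQ (not_lt.1 hlt))

/-- `g` is a relative interior point of the convex set `F`, in algebraic form: every segment in `F`
that ends in `g` can be prolonged in `F` beyond `g`. -/
def IsRelInterior (F : Set (EuclideanSpace ℝ (Fin d))) (g : EuclideanSpace ℝ (Fin d)) : Prop :=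
  g ∈ F ∧ ∀ x ∈ F, ∃ ε : ℝ, 0 < ε ∧ g - ε • (x - g) ∈ F

theorem exists_isRelInterior (hF : Convex ℝ F) (hne : F.Nonempty) : ∃ g, IsRelInterior F g := by
  obtain ⟨g, hg⟩ := hne.intrinsicInterior hF
  obtain ⟨y, hy, rfl⟩ := mem_intrinsicInterior.1 hg
  have hyF : (y : EuclideanSpace ℝ (Fin d)) ∈ F :=
    interior_subset (s := ((↑) ⁻¹' F : Set (affineSpan ℝ F))) hy
  refine ⟨y, hyF, fun x hx => ?_⟩
  let z : ℝ → affineSpan ℝ F := fun t => ⟨AffineMap.lineMap (y : EuclideanSpace ℝ (Fin d)) x (-t),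
    AffineMap.lineMap_mem (-t) y.2 (subset_affineSpan ℝ F hx)⟩
  have hzval : ∀ t, (z t : EuclideanSpace ℝ (Fin d)) = y - t • (x - y) := by
    intro t
    simp only [z, AffineMap.lineMap_apply, vsub_eq_sub, vadd_eq_add, neg_smul]
    abel
  have hzc : Continuous z := by
    refine Continuous.subtype_mk (f := fun t => (z t : EuclideanSpace ℝ (Fin d))) ?_ (fun t => (z t).2)
    simp_rw [hzval]
    fun_prop
  have hz0 : z 0 = y := by
    apply Subtype.ext
    rw [hzval, zero_smul, sub_zero]
  have hmem : ∀ᶠ t in nhds (0 : ℝ), z t ∈ interior ((↑) ⁻¹' F : Set (affineSpan ℝ F)) :=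
    hzc.continuousAt.eventually_mem (by rw [hz0]; exact isOpen_interior.mem_nhds hy)
  obtain ⟨ε, hε, hball⟩ := Metric.eventually_nhds_iff.1 hmem
  refine ⟨ε / 2, by positivity, ?_⟩
  have := interior_subset (hball (y := ε / 2) (by
    rw [Real.dist_eq, sub_zero, abs_of_pos (by positivity)]; linarith))
  rw [Set.mem_preimage, hzval] at this
  exact this

/-- A linear functional that attains its maximum over `F` at a relative interior point is constant
on `F`. -/
theorem IsRelInterior.functional_eq {g : EuclideanSpace ℝ (Fin d)} (hg : IsRelInterior F g)
    {l : EuclideanSpace ℝ (Fin d) →ₗ[ℝ] ℝ} (hl : ∀ x ∈ F, l x ≤ l g) {x : EuclideanSpace ℝ (Fin d)}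
    (hx : x ∈ F) : l x = l g := by
  obtain ⟨ε, hε, hmem⟩ := hg.2 x hx
  have h1 := hl _ hmem
  simp only [map_sub, map_smul, smul_eq_mul] at h1
  have h2 := hl x hx
  nlinarith

theorem IsFace.subset_of_isRelInterior (h : IsFace Q F) (hHQ : H ⊆ Q)
    {g : EuclideanSpace ℝ (Fin d)} (hg : IsRelInterior H g) (hgF : g ∈ F) : H ⊆ F := by
  obtain ⟨-, l, m, hle, rfl⟩ := isFace_iff.1 h
  have hgm : l g = m := hgF.2
  intro x hx
  exact ⟨hHQ hx, (hg.functional_eq (fun y hy => (hle y (hHQ hy)).trans_eq hgm.symm) hx).trans hgm⟩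

/-- `Q` is a convex polytope: the convex hull of a finite set. -/
def IsPolytope (Q : Set (EuclideanSpace ℝ (Fin d))) : Prop :=
  ∃ S : Finset (EuclideanSpace ℝ (Fin d)), Q = convexHull ℝ (S : Set (EuclideanSpace ℝ (Fin d)))

theorem IsPolytope.convex (h : IsPolytope Q) : Convex ℝ Q := by
  obtain ⟨S, rfl⟩ := h
  exact convex_convexHull ℝ _

theorem IsPolytope.isCompact (h : IsPolytope Q) : IsCompact Q := by
  obtain ⟨S, rfl⟩ := h
  exact S.finite_toSet.isCompact_convexHull ℝ

theorem le_on_convexHull {S : Set (EuclideanSpace ℝ (Fin d))}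
    {l : EuclideanSpace ℝ (Fin d) →ₗ[ℝ] ℝ} {m : ℝ} (h : ∀ x ∈ S, l x ≤ m) :
    ∀ x ∈ convexHull ℝ S, l x ≤ m :=
  convexHull_min (t := {x | l x ≤ m}) h (convex_halfSpace_le l.isLinear m)

theorem IsFace.isPolytope (h : IsFace Q F) (hQ : IsPolytope Q) : IsPolytope F := by
  have hc : IsCompact F := IsExposed.isCompact h.2 hQ.isCompact
  have hconv : Convex ℝ F := h.convex hQ.convex
  obtain ⟨S, rfl⟩ := hQ
  have hsub : F.extremePoints ℝ ⊆ S :=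
    (IsExposed.isExtreme h.2).extremePoints_subset_extremePoints.trans extremePoints_convexHull_subset
  have hfin : (F.extremePoints ℝ).Finite := S.finite_toSet.subset hsub
  refine ⟨hfin.toFinset, ?_⟩
  rw [Set.Finite.coe_toFinset, ← (hfin.isCompact_convexHull ℝ).isClosed.closure_eq,
    closure_convexHull_extremePoints hc hconv]

/-- A face of a face of a polytope is a face: the exposing functional is a perturbation of the one
of the larger face. -/
theorem IsFace.trans (hQ : IsPolytope Q) (hF : IsFace Q F) (hG : IsFace F G) : IsFace Q G := by
  classical
  obtain ⟨S, rfl⟩ := hQ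
  obtain ⟨-, l₁, m₁, hle₁, rfl⟩ := isFace_iff.1 hF
  obtain ⟨hne, l₂, m₂, hle₂, rfl⟩ := isFace_iff.1 hG
  obtain ⟨K, hK⟩ : ∃ K : ℝ, ∀ v ∈ S, K * (m₁ - l₁ v) ≥ l₂ v - m₂ := by
    have hone : ∀ v ∈ S, ∃ K : ℝ, 0 ≤ K ∧ K * (m₁ - l₁ v) ≥ l₂ v - m₂ := by
      intro v hv
      have hv' : v ∈ convexHull ℝ (S : Set (EuclideanSpace ℝ (Fin d))) := subset_convexHull ℝ _ hv
      rcases (hle₁ v hv').lt_or_eq with hlt | heq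
      · refine ⟨|l₂ v - m₂| / (m₁ - l₁ v), ?_, ?_⟩
        · have : 0 < m₁ - l₁ v := by linarith
          positivity
        · rw [div_mul_cancel₀ _ (by linarith : m₁ - l₁ v ≠ 0)]
          exact le_abs_self _
      · refine ⟨0, le_rfl, ?_⟩
        have := hle₂ v ⟨hv', heq⟩
        linarith
    choose! k hk0 hk using hone
    refine ⟨∑ v ∈ S, k v, fun v hv => (hk v hv).le.trans ?_⟩
    have hv' : v ∈ convexHull ℝ (S : Set (EuclideanSpace ℝ (Fin d))) := subset_convexHull ℝ _ hv
    refine mul_le_mul_of_nonneg_right (Finset.single_le_sum hk0 hv) ?_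
    have := hle₁ v hv'
    linarith
  have hbase : ∀ x ∈ convexHull ℝ (S : Set (EuclideanSpace ℝ (Fin d))),
      (K • l₁ + l₂) x ≤ K * m₁ + m₂ := by
    refine le_on_convexHull fun v hv => ?_
    have := hK v hv
    simp only [LinearMap.add_apply, LinearMap.smul_apply, smul_eq_mul]
    linarith
  refine isFace_iff.2 ⟨hne, (K + 1) • l₁ + l₂, (K + 1) * m₁ + m₂, fun x hx => ?_, ?_⟩
  · have h1 := hbase x hx
    have h2 := hle₁ x hx
    simp only [LinearMap.add_apply, LinearMap.smul_apply, smul_eq_mul] at h1 ⊢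
    linarith
  · ext x
    constructor
    · rintro ⟨⟨hx, h1⟩, h2⟩
      refine ⟨hx, ?_⟩
      simp only [LinearMap.add_apply, LinearMap.smul_apply, smul_eq_mul, h1, h2]
    · rintro ⟨hx, h3⟩
      have h1 := hbase x hx
      have h2 := hle₁ x hx
      simp only [LinearMap.add_apply, LinearMap.smul_apply, smul_eq_mul] at h1 h3
      have h4 : l₁ x = m₁ := by linarith
      refine ⟨⟨hx, h4⟩, ?_⟩
      rw [h4] at h3
      linarith

/-- Tilting a supporting hyperplane of the polytope `F` along `G` in the direction `n`, until it
meets a further point of `F`. -/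
theorem exists_tilt (hF : IsPolytope F) {l n : EuclideanSpace ℝ (Fin d) →ₗ[ℝ] ℝ}
    {g y : EuclideanSpace ℝ (Fin d)} (hl : ∀ x ∈ F, l x ≤ l g)
    (hn : ∀ x ∈ F, l x = l g → n x = n g) (hy : y ∈ F) (hny : n g < n y) :
    ∃ τ : ℝ, 0 < τ ∧ (∀ x ∈ F, (l + τ • n) x ≤ (l + τ • n) g) ∧
      ∃ v ∈ F, l v ≠ l g ∧ (l + τ • n) v = (l + τ • n) g := by
  classical
  obtain ⟨S, rfl⟩ := hF
  set T := S.filter fun v => n g < n v with hT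
  have hTne : T.Nonempty := by
    by_contra hcon
    rw [Finset.not_nonempty_iff_eq_empty] at hcon
    have : ∀ x ∈ (S : Set (EuclideanSpace ℝ (Fin d))), n x ≤ n g := by
      intro x hx
      by_contra hlt
      have : x ∈ T := Finset.mem_filter.2 ⟨hx, not_le.1 hlt⟩
      simp [hcon] at this
    have := le_on_convexHull this y hy
    linarith
  obtain ⟨v, hvT, hmin⟩ := T.exists_min_image (fun v => (l g - l v) / (n v - n g)) hTne
  have hvS := (Finset.mem_filter.1 hvT).1
  have hvn := (Finset.mem_filter.1 hvT).2
  have hvF := subset_convexHull ℝ (S : Set (EuclideanSpace ℝ (Fin d))) hvS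
  have hvl : l v ≠ l g := fun h => by
    have := hn v hvF h
    linarith
  have hvl' : l v < l g := lt_of_le_of_ne (hl v hvF) hvl
  refine ⟨(l g - l v) / (n v - n g), div_pos (by linarith) (by linarith), ?_, v, hvF, hvl, ?_⟩
  · refine le_on_convexHull fun w hw => ?_
    have hwF := subset_convexHull ℝ (S : Set (EuclideanSpace ℝ (Fin d))) hw
    have hτ : 0 < (l g - l v) / (n v - n g) := div_pos (by linarith) (by linarith)
    simp only [LinearMap.add_apply, LinearMap.smul_apply, smul_eq_mul]
    rcases le_or_gt (n w) (n g) with hle | hlt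
    · have := hl w hwF
      nlinarith
    · have := hmin w (Finset.mem_filter.2 ⟨hw, hlt⟩)
      rw [le_div_iff₀ (by linarith)] at this
      linarith
  · simp only [LinearMap.add_apply, LinearMap.smul_apply, smul_eq_mul]
    have : n v - n g ≠ 0 := by linarith
    field_simp
    ring

/-- A proper face of codimension at least two lies in two larger proper faces that meet in it. -/
theorem exists_two_faces (hF : IsPolytope F) (hG : IsFace F G) (hdim : dim G + 2 ≤ dim F) :
    ∃ E₁ E₂, IsFace F E₁ ∧ IsFace F E₂ ∧ G ⊆ E₁ ∧ G ⊆ E₂ ∧ G ≠ E₁ ∧ G ≠ E₂ ∧ E₁ ≠ F ∧ E₂ ≠ F ∧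
      E₁ ∩ E₂ = G := by
  obtain ⟨⟨g, hg⟩, l, m, hle, hGeq⟩ := isFace_iff.1 hG
  have hgl : l g = m := by rw [hGeq] at hg; exact hg.2
  subst hgl
  obtain ⟨f, hf⟩ := exists_isRelInterior hF.convex ⟨g, hG.subset hg⟩
  have hfl : l f < l g := by
    refine lt_of_le_of_ne (hle f hf.1) fun h => ?_
    have hFG : F ⊆ G := by
      intro x hx
      rw [hGeq]
      exact ⟨hx, (hf.functional_eq (fun y hy => (hle y hy).trans_eq h.symm) hx).trans h⟩
    have := dim_mono hFG
    omega
  obtain ⟨n, hnG, hnf, x₀, hx₀, hnx₀⟩ : ∃ n : EuclideanSpace ℝ (Fin d) →ₗ[ℝ] ℝ,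
      (∀ x ∈ G, n x = n g) ∧ n f = n g ∧ ∃ x ∈ F, n x ≠ n g := by
    set W := vectorSpan ℝ G ⊔ Submodule.span ℝ {f - g}
    have hW : Module.finrank ℝ W ≤ dim G + 1 := by
      refine (Submodule.finrank_add_le_finrank_add_finrank _ _).trans ?_
      exact Nat.add_le_add_left ((finrank_span_le_card _).trans (by simp)) _
    obtain ⟨u, huF, huW⟩ : ∃ u ∈ vectorSpan ℝ F, u ∉ W := by
      by_contra hcon
      push Not at hcon
      have := Submodule.finrank_mono (R := ℝ) (s := vectorSpan ℝ F) (t := W) hcon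
      have h3 : dim F = Module.finrank ℝ (vectorSpan ℝ F) := rfl
      omega
    obtain ⟨n, hnu, hn⟩ := Submodule.exists_le_ker_of_notMem huW
    refine ⟨n, fun x hx => ?_, ?_, ?_⟩
    · have := hn (Submodule.mem_sup_left (sub_mem_vectorSpan hx hg))
      simpa [sub_eq_zero] using this
    · have := hn (Submodule.mem_sup_right (Submodule.mem_span_singleton_self (f - g)))
      simpa [sub_eq_zero] using this
    · by_contra hcon
      push Not at hcon
      exact hnu (vectorSpan_le_ker hcon huF)
  obtain ⟨ε, hε, hx₁⟩ := hf.2 x₀ hx₀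
  have key : ∀ k : EuclideanSpace ℝ (Fin d) →ₗ[ℝ] ℝ, (∀ x ∈ G, k x = k g) → k f = k g →
      (∃ y ∈ F, k g < k y) → ∃ τ : ℝ, 0 < τ ∧ ∃ E, IsFace F E ∧ G ⊆ E ∧ G ≠ E ∧ E ≠ F ∧
        E = {x ∈ F | (l + τ • k) x = (l + τ • k) g} := by
    rintro k hkG hkf ⟨y, hy, hky⟩
    obtain ⟨τ, hτ, h1, v, hv, hvl, hvτ⟩ := exists_tilt hF hle
      (fun x hx hxl => hkG x (by rw [hGeq]; exact ⟨hx, hxl⟩)) hy hky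
    have hGE : G ⊆ {x ∈ F | (l + τ • k) x = (l + τ • k) g} := by
      intro x hx
      refine ⟨hG.subset hx, ?_⟩
      have h2 := hkG x hx
      rw [hGeq] at hx
      have h3 : l x = l g := hx.2
      simp [h2, h3]
    refine ⟨τ, hτ, _, isFace_iff.2 ⟨⟨g, hGE hg⟩, _, _, h1, rfl⟩, hGE, ?_, ?_, rfl⟩
    · intro h
      have : v ∈ G := by rw [h]; exact ⟨hv, hvτ⟩
      rw [hGeq] at this
      exact hvl this.2
    · intro h
      have := hf.1
      rw [← h] at this
      have h2 := this.2
      simp only [LinearMap.add_apply, LinearMap.smul_apply, smul_eq_mul, hkf] at h2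
      linarith
  have hpm : (∃ y ∈ F, n g < n y) ∧ ∃ y ∈ F, n y < n g := by
    have h2 : n (f - ε • (x₀ - f)) = n g - ε * (n x₀ - n g) := by
      simp [hnf]
    rcases lt_or_gt_of_ne hnx₀ with h | h
    · refine ⟨⟨_, hx₁, ?_⟩, ⟨x₀, hx₀, h⟩⟩
      rw [h2]
      nlinarith
    · refine ⟨⟨x₀, hx₀, h⟩, ⟨_, hx₁, ?_⟩⟩
      rw [h2]
      nlinarith
  obtain ⟨τ₁, hτ₁, E₁, hE₁, hGE₁, hne₁, hneF₁, hE₁eq⟩ := key n hnG hnf hpm.1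
  obtain ⟨τ₂, hτ₂, E₂, hE₂, hGE₂, hne₂, hneF₂, hE₂eq⟩ := key (-n) (fun x hx => by simp [hnG x hx])
    (by simp [hnf]) (by
      obtain ⟨y, hy, h⟩ := hpm.2
      exact ⟨y, hy, by simpa using h⟩)
  refine ⟨E₁, E₂, hE₁, hE₂, hGE₁, hGE₂, hne₁, hne₂, hneF₁, hneF₂,
    Set.Subset.antisymm ?_ (Set.subset_inter hGE₁ hGE₂)⟩
  rintro x ⟨hx1, hx2⟩
  rw [hE₁eq] at hx1
  rw [hE₂eq] at hx2
  have h1 := hx1.2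
  have h2 := hx2.2
  simp only [LinearMap.add_apply, LinearMap.smul_apply, LinearMap.neg_apply, smul_eq_mul] at h1 h2
  have h3 : (τ₁ + τ₂) * (n x - n g) = 0 := by linarith
  have h4 : n x - n g = 0 := by
    rcases mul_eq_zero.1 h3 with h | h
    · linarith
    · exact h
  rw [hGeq]
  refine ⟨hx1.1, ?_⟩
  have : n x = n g := by linarith
  rw [this] at h1
  linarith

/-- A polytope of positive dimension has a face of codimension one. -/
theorem exists_facet (hF : IsPolytope F) (hne : F.Nonempty) (hdim : 1 ≤ dim F) :
    ∃ G, IsFace F G ∧ dim G + 1 = dim F := by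
  have hproper : ∃ n, ∃ G, IsFace F G ∧ dim G < dim F ∧ dim G = n := by
    obtain ⟨u, hu, hu0⟩ : ∃ u ∈ vectorSpan ℝ F, u ≠ 0 := by
      by_contra hcon
      push Not at hcon
      have : vectorSpan ℝ F = ⊥ := (Submodule.eq_bot_iff _).2 hcon
      simp [dim, this] at hdim
    obtain ⟨l, hl⟩ := Submodule.exists_le_ker_of_notMem
      (show u ∉ (⊥ : Submodule ℝ (EuclideanSpace ℝ (Fin d))) by simpa using hu0)
    obtain ⟨g, hg, hmax⟩ := hF.isCompact.exists_isMaxOn hne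
      (LinearMap.continuous_of_finiteDimensional l).continuousOn
    have hface : IsFace F {x ∈ F | l x = l g} :=
      isFace_iff.2 ⟨⟨g, hg, rfl⟩, l, l g, fun x hx => hmax hx, rfl⟩
    refine ⟨_, _, hface, hface.dim_lt hface.subset le_rfl fun h => ?_, rfl⟩
    have h2 : ∀ x ∈ F, l x = l g := fun x hx => by rw [← h] at hx; exact hx.2
    exact hl.1 (vectorSpan_le_ker h2 hu)
  have hbound : ∀ n, (∃ G, IsFace F G ∧ dim G < dim F ∧ dim G = n) → n ≤ dim F := by
    rintro n ⟨G, -, h, rfl⟩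
    exact h.le
  classical
  obtain ⟨G, hG, hlt, hGn⟩ := Nat.findGreatest_spec
    (P := fun n => ∃ G, IsFace F G ∧ dim G < dim F ∧ dim G = n) (hbound _ hproper.choose_spec) hproper.choose_spec
  refine ⟨G, hG, ?_⟩
  by_contra hcon
  obtain ⟨E₁, -, hE₁, -, hGE₁, -, hne₁, -, hEF, -, -⟩ := exists_two_faces hF hG (by omega)
  have h1 : dim G < dim E₁ := (hG.of_subset hGE₁ hE₁.subset).dim_lt hGE₁ le_rfl hne₁
  have h2 : dim E₁ < dim F := hE₁.dim_lt hE₁.subset le_rfl hEF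
  have := Nat.le_findGreatest (P := fun n => ∃ G, IsFace F G ∧ dim G < dim F ∧ dim G = n)
    h2.le ⟨E₁, hE₁, h2, rfl⟩
  omega

/-- Three linear functionals whose restrictions to `U` vanish on a subspace of codimension two are
linearly dependent on `U`. -/
theorem exists_dependency_on {l : Fin 3 → (EuclideanSpace ℝ (Fin d) →ₗ[ℝ] ℝ)}
    {L U : Submodule ℝ (EuclideanSpace ℝ (Fin d))} (hLU : L ≤ U)
    (hdim : Module.finrank ℝ L + 2 = Module.finrank ℝ U) (hl : ∀ i, L ≤ LinearMap.ker (l i)) :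
    ∃ c : Fin 3 → ℝ, c ≠ 0 ∧ ∀ x ∈ U, ∑ i, c i * l i x = 0 := by
  set L' : Submodule ℝ U := L.comap U.subtype
  have hL' : Module.finrank ℝ L' = Module.finrank ℝ L :=
    (Submodule.comapSubtypeEquivOfLe hLU).finrank_eq
  have hq : Module.finrank ℝ (U ⧸ L') = 2 := by
    have := Submodule.finrank_quotient_add_finrank L'
    omega
  set k : Fin 3 → Module.Dual ℝ (U ⧸ L') := fun i => L'.liftQ ((l i).comp U.subtype) (by
    intro x hx
    exact hl i hx)
  have hdep : ¬ LinearIndependent ℝ k := by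
    intro h
    have := h.fintype_card_le_finrank
    rw [Subspace.dual_finrank_eq, hq] at this
    simp at this
  obtain ⟨c, hc, i, hi⟩ := Fintype.not_linearIndependent_iff.1 hdep
  refine ⟨c, fun h => hi (by simp [h]), fun x hx => ?_⟩
  have := congrArg (fun φ : Module.Dual ℝ (U ⧸ L') => φ (Submodule.Quotient.mk ⟨x, hx⟩)) hc
  simp only [LinearMap.sum_apply, LinearMap.smul_apply, LinearMap.zero_apply, smul_eq_mul] at this
  exact this

/-- A face of codimension two lies in at most two facets. -/
theorem facets_eq_of_codim_two {E : Fin 3 → Set (EuclideanSpace ℝ (Fin d))}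
    (hE : ∀ i, IsFace F (E i)) (hGne : G.Nonempty) (hGE : ∀ i, G ⊆ E i)
    (hEdim : ∀ i, dim (E i) + 1 = dim F) (hdim : dim G + 2 = dim F) :
    E 0 = E 1 ∨ E 0 = E 2 ∨ E 1 = E 2 := by
  obtain ⟨g, hg⟩ := hGne
  have hEl : ∀ i, ∃ l : EuclideanSpace ℝ (Fin d) →ₗ[ℝ] ℝ, (∀ x ∈ F, l (x - g) ≤ 0) ∧
      ∀ x, x ∈ E i ↔ x ∈ F ∧ l (x - g) = 0 := by
    intro i
    obtain ⟨-, l, m, hle, heq⟩ := isFace_iff.1 (hE i)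
    have hgm := hGE i hg
    rw [heq] at hgm
    have hgm : l g = m := hgm.2
    refine ⟨l, fun x hx => ?_, fun x => ?_⟩
    · have := hle x hx
      rw [map_sub]; linarith
    · rw [heq, map_sub, hgm, sub_eq_zero]
      rfl
  choose l hle hmem using hEl
  have hgF : g ∈ F := (hE 0).subset (hGE 0 hg)
  obtain ⟨c, hc0, hc⟩ := exists_dependency_on (l := l) (L := vectorSpan ℝ G) (U := vectorSpan ℝ F)
    (vectorSpan_mono ℝ ((hGE 0).trans (hE 0).subset)) hdim (fun i => by
      refine vectorSpan_le_ker (m := l i g) fun x hx => ?_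
      have := ((hmem i x).1 (hGE i hx)).2
      simpa [sub_eq_zero] using this)
  have hrel : ∀ x ∈ F, c 0 * l 0 (x - g) + c 1 * l 1 (x - g) + c 2 * l 2 (x - g) = 0 := by
    intro x hx
    have := hc _ (sub_mem_vectorSpan hx hgF)
    simpa [Fin.sum_univ_three] using this
  have hsub : ∀ i j, E i ⊆ E j → E i = E j := fun i j h =>
    (hE i).eq_of_dim_le h (hE j).subset (by have := hEdim i; have := hEdim j; omega)
  have hnot : ∀ i, ∃ x ∈ F, l i (x - g) < 0 := by
    intro i
    by_contra hcon
    push Not at hcon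
    have : E i = F := Set.Subset.antisymm (hE i).subset fun x hx =>
      (hmem i x).2 ⟨hx, le_antisymm (hle i x hx) (hcon x hx)⟩
    have h2 := hEdim i
    rw [this] at h2
    omega
  -- all coefficients of one sign: impossible, since each functional is somewhere negative
  have hsame : ∀ i j k : Fin 3, ∀ a b e : ℝ, 0 < a → 0 ≤ b → 0 ≤ e →
      (∀ x ∈ F, a * l i (x - g) + b * l j (x - g) + e * l k (x - g) = 0) → False := by
    intro i j k a b e ha hb he h
    obtain ⟨x, hx, hneg⟩ := hnot i
    have h1 := h x hx
    have h2 := mul_nonpos_of_nonneg_of_nonpos hb (hle j x hx)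
    have h3 := mul_nonpos_of_nonneg_of_nonpos he (hle k x hx)
    have h4 := mul_neg_of_pos_of_neg ha hneg
    linarith
  -- one functional is a nonnegative combination of the other two
  have hcone : ∀ i j k : Fin 3, ∀ a b e : ℝ, 0 < a → 0 ≤ b → 0 ≤ e →
      (∀ x ∈ F, a * l i (x - g) = b * l j (x - g) + e * l k (x - g)) → E i = E j ∨ E i = E k := by
    intro i j k a b e ha hb he h
    rcases hb.eq_or_lt with hb0 | hb0
    · rcases he.eq_or_lt with he0 | he0
      · exfalso
        obtain ⟨x, hx, hneg⟩ := hnot i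
        have h1 := h x hx
        rw [← hb0, ← he0] at h1
        have h4 := mul_neg_of_pos_of_neg ha hneg
        linarith
      · right
        refine hsub i k fun x hx => ?_
        obtain ⟨hxF, hx0⟩ := (hmem i x).1 hx
        refine (hmem k x).2 ⟨hxF, ?_⟩
        have h1 := h x hxF
        rw [hx0, ← hb0] at h1
        have h2 : e * l k (x - g) = 0 := by linarith
        exact (mul_eq_zero.1 h2).resolve_left he0.ne'
    · left
      refine hsub i j fun x hx => ?_
      obtain ⟨hxF, hx0⟩ := (hmem i x).1 hx
      refine (hmem j x).2 ⟨hxF, ?_⟩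
      have h1 := h x hxF
      have h2 := mul_nonpos_of_nonneg_of_nonpos he (hle k x hxF)
      have h3 := mul_nonpos_of_nonneg_of_nonpos hb (hle j x hxF)
      rw [hx0] at h1
      have h4 : b * l j (x - g) = 0 := by linarith
      exact (mul_eq_zero.1 h4).resolve_left hb0.ne'
  have main : ∀ a b e : ℝ, (0 < a ∨ 0 < b ∨ 0 < e) →
      (∀ x ∈ F, a * l 0 (x - g) + b * l 1 (x - g) + e * l 2 (x - g) = 0) →
      E 0 = E 1 ∨ E 0 = E 2 ∨ E 1 = E 2 := by
    intro a b e hpos h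
    rcases lt_or_ge a 0 with ha | ha <;> rcases lt_or_ge b 0 with hb | hb <;>
      rcases lt_or_ge e 0 with he | he
    · exfalso
      rcases hpos with h | h | h <;> linarith
    · have := hcone 2 0 1 e (-a) (-b) (by rcases hpos with h | h | h <;> linarith) (by linarith)
        (by linarith) fun x hx => by have := h x hx; linarith
      rcases this with h | h
      · exact Or.inr (Or.inl h.symm)
      · exact Or.inr (Or.inr h.symm)
    · have := hcone 1 0 2 b (-a) (-e) (by rcases hpos with h | h | h <;> linarith) (by linarith)
        (by linarith) fun x hx => by have := h x hx; linarith
      rcases this with h | h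
      · exact Or.inl h.symm
      · exact Or.inr (Or.inr h)
    · have := hcone 0 1 2 (-a) b e (by linarith) hb he fun x hx => by have := h x hx; linarith
      tauto
    · have := hcone 0 1 2 a (-b) (-e) (by rcases hpos with h | h | h <;> linarith) (by linarith)
        (by linarith) fun x hx => by have := h x hx; linarith
      tauto
    · have := hcone 1 0 2 (-b) a e (by linarith) ha he fun x hx => by have := h x hx; linarith
      rcases this with h | h
      · exact Or.inl h.symm
      · exact Or.inr (Or.inr h)
    · have := hcone 2 0 1 (-e) a b (by linarith) ha hb fun x hx => by have := h x hx; linarith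
      rcases this with h | h
      · exact Or.inr (Or.inl h.symm)
      · exact Or.inr (Or.inr h.symm)
    · exfalso
      rcases hpos with hp | hp | hp
      · exact hsame 0 1 2 a b e hp hb he h
      · exact hsame 1 0 2 b a e hp ha he fun x hx => by have := h x hx; linarith
      · exact hsame 2 0 1 e a b hp ha hb fun x hx => by have := h x hx; linarith
  obtain ⟨i, hi⟩ := Function.ne_iff.1 hc0
  rcases lt_or_gt_of_ne hi with hlt | hgt
  · refine main (-c 0) (-c 1) (-c 2) ?_ fun x hx => by have := hrel x hx; linarith
    simp only [Pi.zero_apply] at hlt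
    fin_cases i
    · exact Or.inl (neg_pos.2 hlt)
    · exact Or.inr (Or.inl (neg_pos.2 hlt))
    · exact Or.inr (Or.inr (neg_pos.2 hlt))
  · refine main (c 0) (c 1) (c 2) ?_ hrel
    fin_cases i
    · exact Or.inl hgt
    · exact Or.inr (Or.inl hgt)
    · exact Or.inr (Or.inr hgt)

end Polytopes

end Venkov

/-! ### Tiles and their faces -/

namespace Venkov

section Tiling

variable {d : ℕ} {P : Parallelohedron d} {F G H : Set (EuclideanSpace ℝ (Fin d))}
  {g : EuclideanSpace ℝ (Fin d)} {s t u v : P.lattice}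

theorem mem_tile {x : EuclideanSpace ℝ (Fin d)} : x ∈ tile P t ↔ x - t ∈ P.body := by
  rw [tile, Set.mem_vadd_set_iff_neg_vadd_mem, vadd_eq_add, neg_add_eq_sub]

theorem isPolytope_tile (t : P.lattice) : IsPolytope (tile P t) := by
  classical
  obtain ⟨S, hS⟩ := P.polytope
  refine ⟨S.image fun x => (t : EuclideanSpace ℝ (Fin d)) + x, ?_⟩
  rw [tile, hS, ← convexHull_vadd]
  congr 1
  ext x
  simp only [Finset.coe_image]
  rfl

theorem convex_tile (t : P.lattice) : Convex ℝ (tile P t) := (isPolytope_tile t).convex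

theorem tile_zero : tile P 0 = P.body := by
  ext x
  simp [mem_tile]

theorem neg_mem_body {x : EuclideanSpace ℝ (Fin d)} : -x ∈ P.body ↔ x ∈ P.body := by
  conv_lhs => rw [← P.neg_body]
  simp

theorem center_mem_interior (t : P.lattice) :
    (t : EuclideanSpace ℝ (Fin d)) ∈ interior (tile P t) := by
  have hconv : Convex ℝ P.body := by
    have := convex_tile (P := P) 0
    rwa [tile_zero] at this
  have h0 : (0 : EuclideanSpace ℝ (Fin d)) ∈ interior P.body := by
    obtain ⟨x, hx⟩ := P.interior_nonempty
    have hx' : -x ∈ interior P.body := by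
      have := (Homeomorph.neg (EuclideanSpace ℝ (Fin d))).preimage_interior P.body
      have h2 : (Homeomorph.neg (EuclideanSpace ℝ (Fin d))) ⁻¹' P.body = P.body := P.neg_body
      rw [h2] at this
      rw [← this] at hx
      exact hx
    have := hconv.interior.midpoint_mem hx hx'
    simpa using this
  have : interior (tile P t) = (t : EuclideanSpace ℝ (Fin d)) +ᵥ interior P.body :=
    interior_vadd _ _
  rw [this]
  exact ⟨0, h0, by simp⟩

theorem center_mem_tile (t : P.lattice) : (t : EuclideanSpace ℝ (Fin d)) ∈ tile P t :=
  interior_subset (center_mem_interior t)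

/-- An interior point of a tile lies in no other tile. -/
theorem eq_of_mem_interior {x : EuclideanSpace ℝ (Fin d)} (hs : x ∈ interior (tile P s))
    (ht : x ∈ tile P t) : s = t := by
  by_contra hne
  have hcl : x ∈ closure (interior (tile P t)) := by
    rw [(convex_tile t).closure_interior_eq_closure_of_nonempty_interior ⟨_, center_mem_interior t⟩]
    exact subset_closure ht
  obtain ⟨y, hy1, hy2⟩ := mem_closure_iff.1 hcl _ isOpen_interior hs
  exact Set.disjoint_left.1 (P.disjoint_interior s t hne) hy1 hy2

theorem dim_tile (t : P.lattice) : dim (tile P t) = d := by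
  have h : affineSpan ℝ (tile P t) = ⊤ :=
    affineSpan_eq_top_of_nonempty_interior (by
      rw [(convex_tile t).convexHull_eq]; exact ⟨_, center_mem_interior t⟩)
  rw [dim, ← direction_affineSpan, h, AffineSubspace.direction_top, finrank_top]
  simp

theorem isFace_inter (h : (tile P s ∩ tile P t).Nonempty) :
    IsFace (tile P s) (tile P s ∩ tile P t) :=
  P.face_to_face s t h

/-- A face of the tiling is a face of every tile that contains one of its relative interior
points. -/
theorem IsFace.of_relInterior_mem (hG : IsFace (tile P s) G) (hg : IsRelInterior G g)
    (hgt : g ∈ tile P t) : IsFace (tile P t) G := by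
  have hne : (tile P s ∩ tile P t).Nonempty := ⟨g, hG.subset hg.1, hgt⟩
  have h1 := isFace_inter hne
  have hsub : G ⊆ tile P s ∩ tile P t :=
    h1.subset_of_isRelInterior hG.subset hg ⟨hG.subset hg.1, hgt⟩
  have h2 : IsFace (tile P s ∩ tile P t) G := hG.of_subset hsub Set.inter_subset_left
  have h3 : IsFace (tile P t) (tile P s ∩ tile P t) := by
    rw [Set.inter_comm] at hne ⊢
    exact isFace_inter hne
  exact IsFace.trans (isPolytope_tile t) h3 h2

theorem IsTilingFace.isPolytope (hG : IsTilingFace P G) : IsPolytope G := by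
  obtain ⟨t, ht⟩ := hG
  exact ht.isPolytope (isPolytope_tile t)

theorem IsTilingFace.exists_isRelInterior (hG : IsTilingFace P G) : ∃ g, IsRelInterior G g := by
  obtain ⟨t, ht⟩ := hG
  exact Venkov.exists_isRelInterior (ht.convex (convex_tile t)) ht.nonempty

theorem mem_dualCell : t ∈ dualCell P G ↔ IsFace (tile P t) G := Iff.rfl

/-- The subcells of a dual cell: passing to a larger face shrinks the dual cell. -/
theorem dualCell_mono (hG : IsTilingFace P G) (hGF : G ⊆ F) : dualCell P F ⊆ dualCell P G := by
  intro t ht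
  obtain ⟨g, hg⟩ := hG.exists_isRelInterior
  obtain ⟨s, hs⟩ := hG
  exact hs.of_relInterior_mem hg (ht.subset (hGF hg.1))

/-! ### Intersections of two tiles -/

theorem subset_inter_tile (hs : s ∈ dualCell P G) (ht : t ∈ dualCell P G) :
    G ⊆ tile P s ∩ tile P t :=
  Set.subset_inter hs.subset ht.subset

theorem inter_tile_nonempty (hs : s ∈ dualCell P G) (ht : t ∈ dualCell P G) :
    (tile P s ∩ tile P t).Nonempty :=
  hs.nonempty.mono (subset_inter_tile hs ht)

theorem dim_inter_lt (hne : s ≠ t) (h : (tile P s ∩ tile P t).Nonempty) :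
    dim (tile P s ∩ tile P t) < d := by
  have := (isFace_inter h).dim_lt Set.inter_subset_left le_rfl (fun heq => hne ?_)
  · rwa [dim_tile] at this
  · have : (s : EuclideanSpace ℝ (Fin d)) ∈ tile P s ∩ tile P t := by
      rw [heq]; exact center_mem_tile s
    exact eq_of_mem_interior (center_mem_interior s) this.2

theorem reflect_mem_tile (k : P.lattice) {x : EuclideanSpace ℝ (Fin d)} :
    (k : EuclideanSpace ℝ (Fin d)) - x ∈ tile P (k - t) ↔ x ∈ tile P t := by
  rw [mem_tile, mem_tile, ← neg_mem_body]
  have : -((k : EuclideanSpace ℝ (Fin d)) - x - ((k - t : P.lattice) : EuclideanSpace ℝ (Fin d)))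
      = x - t := by
    push_cast
    abel
  rw [this]

theorem reflect_mem_inter {x : EuclideanSpace ℝ (Fin d)} (hx : x ∈ tile P s ∩ tile P t) :
    ((s + t : P.lattice) : EuclideanSpace ℝ (Fin d)) - x ∈ tile P s ∩ tile P t := by
  refine ⟨?_, ?_⟩
  · have := (reflect_mem_tile (s + t)).2 hx.2
    rwa [add_sub_cancel_right] at this
  · have := (reflect_mem_tile (s + t)).2 hx.1
    rwa [add_sub_cancel_left] at this

/-- The midpoint of the segment that joins the centres of two tiles. -/
noncomputable def middle (s t : P.lattice) : EuclideanSpace ℝ (Fin d) :=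
  (1 / 2 : ℝ) • ((s : EuclideanSpace ℝ (Fin d)) + t)

theorem middle_mem (h : (tile P s ∩ tile P t).Nonempty) : middle s t ∈ tile P s ∩ tile P t := by
  obtain ⟨x, hx⟩ := h
  have hconv : Convex ℝ (tile P s ∩ tile P t) := (convex_tile s).inter (convex_tile t)
  have := hconv hx (reflect_mem_inter hx) (a := 1 / 2) (b := 1 / 2) (by norm_num) (by norm_num)
    (by norm_num)
  convert this using 1
  rw [middle, ← smul_add]
  push_cast
  congr 1
  abel

theorem isRelInterior_middle (h : (tile P s ∩ tile P t).Nonempty) :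
    IsRelInterior (tile P s ∩ tile P t) (middle s t) := by
  refine ⟨middle_mem h, fun x hx => ⟨1, one_pos, ?_⟩⟩
  convert reflect_mem_inter hx using 1
  rw [middle]
  push_cast
  module

/-- A bounded set has at most one centre of symmetry, so the intersection of two tiles determines
the sum of their centres. -/
theorem add_eq_of_inter_eq (h : tile P s ∩ tile P t = tile P u ∩ tile P v)
    (hne : (tile P s ∩ tile P t).Nonempty) : s + t = u + v := by
  have hc : IsCompact (tile P s ∩ tile P t) :=
    (isPolytope_tile s).isCompact.inter (isPolytope_tile t).isCompact
  set w : EuclideanSpace ℝ (Fin d) := ((s + t : P.lattice) : EuclideanSpace ℝ (Fin d)) -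
    ((u + v : P.lattice) : EuclideanSpace ℝ (Fin d)) with hw
  have hcont : Continuous fun x : EuclideanSpace ℝ (Fin d) => inner ℝ w x := by fun_prop
  obtain ⟨x, hx, hmax⟩ := hc.exists_isMaxOn hne hcont.continuousOn
  have hx2 : x + w ∈ tile P s ∩ tile P t := by
    have h1 : ((u + v : P.lattice) : EuclideanSpace ℝ (Fin d)) - x ∈ tile P s ∩ tile P t := by
      rw [h]
      exact reflect_mem_inter (by rw [← h]; exact hx)
    have := reflect_mem_inter h1
    convert this using 1
    rw [hw]
    abel
  have := hmax hx2
  simp only [Set.mem_ofPred_eq, inner_add_right, real_inner_self_eq_norm_sq] at this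
  have h0 : w = 0 := by
    have : ‖w‖ ^ 2 = 0 := le_antisymm (by linarith) (by positivity)
    simpa using this
  apply Subtype.ext
  rwa [hw, sub_eq_zero] at h0

theorem eq_of_inter_eq (h : tile P s ∩ tile P t = tile P s ∩ tile P u)
    (hne : (tile P s ∩ tile P t).Nonempty) : t = u :=
  add_left_cancel (add_eq_of_inter_eq h hne)

/-- Two tiles of the tiling are adjacent if they share a facet. -/
def Adjacent (P : Parallelohedron d) (s t : P.lattice) : Prop :=
  dim (tile P s ∩ tile P t) + 1 = d

theorem Adjacent.symm (h : Adjacent P s t) : Adjacent P t s := by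
  rw [Adjacent, Set.inter_comm]
  exact h

theorem inter_eq_of_facet (hs : s ∈ dualCell P F) (ht : t ∈ dualCell P F) (hne : s ≠ t)
    (hF : dim F + 1 = d) : F = tile P s ∩ tile P t := by
  have := dim_inter_lt hne (inter_tile_nonempty hs ht)
  exact hs.eq_of_dim_le (subset_inter_tile hs ht) Set.inter_subset_left (by omega)

theorem inter_eq_or_adjacent (hs : s ∈ dualCell P F) (ht : t ∈ dualCell P F) (hne : s ≠ t)
    (hF : dim F + 2 = d) : tile P s ∩ tile P t = F ∨ Adjacent P s t := by
  by_cases h : tile P s ∩ tile P t = F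
  · exact Or.inl h
  · have h1 := hs.dim_lt (subset_inter_tile hs ht) Set.inter_subset_left (Ne.symm h)
    have h2 := dim_inter_lt hne (inter_tile_nonempty hs ht)
    refine Or.inr ?_
    rw [Adjacent]
    omega

/-! ### Point reflections -/

/-- The image of `F` under the point reflection `x ↦ k - x`. -/
def reflect (k : P.lattice) (F : Set (EuclideanSpace ℝ (Fin d))) :
    Set (EuclideanSpace ℝ (Fin d)) :=
  {x | (k : EuclideanSpace ℝ (Fin d)) - x ∈ F}

theorem mem_reflect {k : P.lattice} {x : EuclideanSpace ℝ (Fin d)} :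
    x ∈ reflect k F ↔ (k : EuclideanSpace ℝ (Fin d)) - x ∈ F := Iff.rfl

theorem reflect_reflect (k : P.lattice) : reflect k (reflect k F) = F := by
  ext x
  simp [mem_reflect]

theorem isFace_reflect (k : P.lattice) (h : IsFace (tile P t) F) :
    IsFace (tile P (k - t)) (reflect k F) := by
  obtain ⟨⟨f, hf⟩, l, m, hle, hF⟩ := isFace_iff.1 h
  have hmem : ∀ x, x ∈ tile P (k - t) ↔ (k : EuclideanSpace ℝ (Fin d)) - x ∈ tile P t := by
    intro x
    rw [← reflect_mem_tile (P := P) k (t := t), sub_sub_cancel]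
  refine isFace_iff.2 ⟨⟨k - f, by rwa [mem_reflect, sub_sub_cancel]⟩, -l, m - l k,
    fun x hx => ?_, ?_⟩
  · have := hle _ ((hmem x).1 hx)
    rw [map_sub] at this
    rw [LinearMap.neg_apply]
    linarith
  · ext x
    rw [mem_reflect, hF, Set.mem_sep_iff, Set.mem_sep_iff, hmem x]
    refine and_congr_right fun _ => ?_
    rw [map_sub, LinearMap.neg_apply]
    constructor <;> intro h <;> linarith

theorem mem_dualCell_reflect (k : P.lattice) : t ∈ dualCell P (reflect k F) ↔
    k - t ∈ dualCell P F := by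
  constructor
  · intro h
    have := isFace_reflect k h
    rwa [reflect_reflect] at this
  · intro h
    have := isFace_reflect k h
    rwa [sub_sub_cancel] at this

theorem vectorSpan_reflect (k : P.lattice) : vectorSpan ℝ (reflect k F) = vectorSpan ℝ F := by
  have key : ∀ F : Set (EuclideanSpace ℝ (Fin d)),
      vectorSpan ℝ (reflect k F) ≤ vectorSpan ℝ F := by
    intro F
    rw [vectorSpan, Submodule.span_le]
    rintro _ ⟨x, hx, y, hy, rfl⟩
    have := sub_mem_vectorSpan (mem_reflect.1 hy) (mem_reflect.1 hx)
    simpa using this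
  refine le_antisymm (key F) ?_
  have := key (reflect k F)
  rwa [reflect_reflect] at this

/-- If two tiles of a dual cell `D(G)` meet in `G` only, then `D(G)` is centrally symmetric. -/
theorem reflect_mem_dualCell (h : tile P s ∩ tile P t = G) (hu : u ∈ dualCell P G) :
    s + t - u ∈ dualCell P G := by
  have : reflect (s + t) G = G := by
    subst h
    ext x
    rw [mem_reflect]
    refine ⟨fun hx => ?_, fun hx => reflect_mem_inter hx⟩
    have := reflect_mem_inter hx
    rwa [sub_sub_cancel] at this
  have h2 := isFace_reflect (s + t) hu
  rwa [this] at h2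

theorem inter_eq_of_middle_mem (hG : u ∈ dualCell P G) (hu : G ⊆ tile P s ∩ tile P u)
    (hm : middle s u ∈ G) : tile P s ∩ tile P u = G :=
  Set.Subset.antisymm (hG.subset_of_isRelInterior Set.inter_subset_right
    (isRelInterior_middle ⟨_, hu hm⟩) hm) hu

/-- If two tiles meet in `G` only, then so does every pair of opposite tiles around `G`, because all
these pairs have the same midpoint. -/
theorem inter_reflect_eq (h : tile P s ∩ tile P t = G) (hne : G.Nonempty)
    (hu : u ∈ dualCell P G) : tile P (s + t - u) ∩ tile P u = G := by
  have hsub := subset_inter_tile (reflect_mem_dualCell h hu) hu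
  refine inter_eq_of_middle_mem hu hsub ?_
  have : middle (s + t - u) u = middle s t := by
    simp only [middle]
    push_cast
    module
  rw [this, ← h]
  exact middle_mem (by rwa [h])

theorem reflect_ne (hF : F.Nonempty) (h : tile P s ∩ tile P t = F) (hne : s ≠ t)
    (hu : u ∈ dualCell P F) : s + t - u ≠ u := by
  intro heq
  have h1 := inter_reflect_eq h hF hu
  rw [heq, Set.inter_self] at h1
  have h2 : (u : EuclideanSpace ℝ (Fin d)) ∈ tile P s ∩ tile P t := by
    rw [h, ← h1]; exact center_mem_tile u
  exact hne ((eq_of_mem_interior (center_mem_interior u) h2.1).symm.trans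
    (eq_of_mem_interior (center_mem_interior u) h2.2))

/-! ### Directions into the tiles around a face -/

/-- The directions in which one can move inside `Q` from the point `g`. -/
def dirCone (Q : Set (EuclideanSpace ℝ (Fin d))) (g : EuclideanSpace ℝ (Fin d)) :
    Set (EuclideanSpace ℝ (Fin d)) :=
  {x | ∃ ε : ℝ, 0 < ε ∧ g + ε • x ∈ Q}

theorem dirCone_mono {Q Q' : Set (EuclideanSpace ℝ (Fin d))} (h : Q ⊆ Q') :
    dirCone Q g ⊆ dirCone Q' g := by
  rintro x ⟨ε, hε, hx⟩
  exact ⟨ε, hε, h hx⟩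

theorem smul_mem_dirCone {Q : Set (EuclideanSpace ℝ (Fin d))} {x : EuclideanSpace ℝ (Fin d)}
    (hx : x ∈ dirCone Q g) {c : ℝ} (hc : 0 < c) : c • x ∈ dirCone Q g := by
  obtain ⟨ε, hε, hx⟩ := hx
  refine ⟨ε / c, by positivity, ?_⟩
  rwa [smul_smul, div_mul_cancel₀ _ hc.ne']

theorem dirCone_small {Q : Set (EuclideanSpace ℝ (Fin d))} {x : EuclideanSpace ℝ (Fin d)}
    (hQ : Convex ℝ Q) (hg : g ∈ Q) {ε δ : ℝ} (hx : g + ε • x ∈ Q) (hδ : 0 < δ) (hδε : δ ≤ ε) :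
    g + δ • x ∈ Q := by
  have hε : 0 < ε := hδ.trans_le hδε
  have := hQ.add_smul_mem hg hx (t := δ / ε) ⟨by positivity, (div_le_one hε).2 hδε⟩
  rwa [smul_smul, div_mul_cancel₀ _ hε.ne'] at this

theorem add_mem_dirCone {Q : Set (EuclideanSpace ℝ (Fin d))} {x y : EuclideanSpace ℝ (Fin d)}
    (hQ : Convex ℝ Q) (hg : g ∈ Q) (hx : x ∈ dirCone Q g) (hy : y ∈ dirCone Q g) :
    x + y ∈ dirCone Q g := by
  obtain ⟨ε, hε, hx⟩ := hx
  obtain ⟨δ, hδ, hy⟩ := hy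
  have hm : 0 < min ε δ := lt_min hε hδ
  have h1 := dirCone_small hQ hg hx hm (min_le_left _ _)
  have h2 := dirCone_small hQ hg hy hm (min_le_right _ _)
  refine ⟨min ε δ / 2, by positivity, ?_⟩
  have := hQ h1 h2 (a := 1 / 2) (b := 1 / 2) (by norm_num) (by norm_num) (by norm_num)
  convert this using 1
  module

theorem add_mem_dirCone_interior {Q : Set (EuclideanSpace ℝ (Fin d))}
    {x y : EuclideanSpace ℝ (Fin d)} (hQ : Convex ℝ Q)
    (hx : x ∈ dirCone (interior Q) g) (hy : y ∈ dirCone Q g) : x + y ∈ dirCone (interior Q) g := by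
  obtain ⟨ε, hε, hx⟩ := hx
  obtain ⟨δ, hδ, hy⟩ := hy
  -- the weights are chosen such that `x` and `y` get the same coefficient
  refine ⟨ε * δ / (ε + δ), by positivity, ?_⟩
  have := hQ.combo_interior_self_mem_interior hx hy (a := δ / (ε + δ)) (b := ε / (ε + δ))
    (by positivity) (by positivity) (by field_simp; ring)
  convert this using 1
  have h1 : g = (δ / (ε + δ)) • g + (ε / (ε + δ)) • g := by
    rw [← add_smul, ← add_div, add_comm δ ε, div_self (by positivity), one_smul]
  rw [smul_add, smul_add, smul_add, smul_smul, smul_smul]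
  conv_lhs => rw [h1]
  have h2 : δ / (ε + δ) * ε = ε * δ / (ε + δ) := by ring
  have h3 : ε / (ε + δ) * δ = ε * δ / (ε + δ) := by ring
  rw [h2, h3]
  abel

theorem vectorSpan_subset_dirCone (hG : Convex ℝ G) (hg : IsRelInterior G g) :
    (vectorSpan ℝ G : Set (EuclideanSpace ℝ (Fin d))) ⊆ dirCone G g := by
  have hzero : (0 : EuclideanSpace ℝ (Fin d)) ∈ dirCone G g := ⟨1, one_pos, by simpa using hg.1⟩
  have hpos : ∀ x ∈ G, x - g ∈ dirCone G g := fun x hx => ⟨1, one_pos, by simpa using hx⟩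
  have hneg : ∀ x ∈ G, -(x - g) ∈ dirCone G g := by
    intro x hx
    obtain ⟨ε, hε, h⟩ := hg.2 x hx
    exact ⟨ε, hε, by rwa [smul_neg, ← sub_eq_add_neg]⟩
  suffices h : ∀ x ∈ vectorSpan ℝ G, x ∈ dirCone G g ∧ -x ∈ dirCone G g from fun x hx => (h x hx).1
  intro x hx
  rw [vectorSpan] at hx
  induction hx using Submodule.span_induction with
  | mem x hx =>
    obtain ⟨y, hy, z, hz, rfl⟩ := hx
    simp only [vsub_eq_sub]
    refine ⟨?_, ?_⟩
    · have := add_mem_dirCone hG hg.1 (hpos y hy) (hneg z hz)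
      convert this using 1
      abel
    · have := add_mem_dirCone hG hg.1 (hneg y hy) (hpos z hz)
      convert this using 1
      abel
  | zero => simpa using hzero
  | add x y _ _ hx hy =>
    refine ⟨add_mem_dirCone hG hg.1 hx.1 hy.1, ?_⟩
    rw [neg_add]
    exact add_mem_dirCone hG hg.1 hx.2 hy.2
  | smul c x _ hx =>
    rcases lt_trichotomy c 0 with hc | rfl | hc
    · have h1 := smul_mem_dirCone hx.2 (neg_pos.2 hc)
      have h2 := smul_mem_dirCone hx.1 (neg_pos.2 hc)
      rw [neg_smul, smul_neg, neg_neg] at h1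
      rw [neg_smul] at h2
      exact ⟨h1, h2⟩
    · simpa using hzero
    · refine ⟨smul_mem_dirCone hx.1 hc, ?_⟩
      rw [← smul_neg]
      exact smul_mem_dirCone hx.2 hc

/-- The tangent cones of distinct tiles at a common point have disjoint interiors. -/
theorem eq_of_mem_dirCone {x : EuclideanSpace ℝ (Fin d)} (hgs : g ∈ tile P s) (hgt : g ∈ tile P t)
    (hs : x ∈ dirCone (interior (tile P s)) g) (ht : x ∈ dirCone (tile P t) g) : s = t := by
  have h1 : x + x ∈ dirCone (interior (tile P s)) g :=
    add_mem_dirCone_interior (convex_tile s) hs (dirCone_mono interior_subset hs)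
  obtain ⟨ε, hε, hs⟩ := hs
  obtain ⟨δ, hδ, ht⟩ := ht
  have hm : 0 < min (ε / 2) δ := lt_min (by positivity) hδ
  have h2 : g + min (ε / 2) δ • x ∈ interior (tile P s) := by
    have hle : min (ε / 2) δ ≤ ε / 2 := min_le_left _ _
    have := (convex_tile s).combo_interior_self_mem_interior hs hgs (a := min (ε / 2) δ / ε)
      (b := 1 - min (ε / 2) δ / ε) (by positivity)
      (by rw [sub_nonneg, div_le_one hε]; linarith) (by ring)
    convert this using 1
    rw [smul_add, smul_smul, div_mul_cancel₀ _ hε.ne']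
    module
  exact eq_of_mem_interior h2 (dirCone_small (convex_tile t) hgt ht hm (min_le_right _ _))

/-- The tiling is locally finite: the lattice is discrete, because `0` is its only point in the
interior of `P`. -/
theorem finite_tiles_near (g : EuclideanSpace ℝ (Fin d)) :
    {t : P.lattice | (tile P t ∩ Metric.ball g 1).Nonempty}.Finite := by
  have hdisc : DiscreteTopology P.lattice := by
    have h0 := center_mem_interior (0 : P.lattice)
    rw [discreteTopology_iff_isOpen_singleton_zero]
    have : ({0} : Set P.lattice) = (↑) ⁻¹' interior (tile P 0) := by
      ext t
      constructor
      · rintro rfl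
        exact h0
      · intro ht
        exact (eq_of_mem_interior ht (center_mem_tile t)).symm
    rw [this]
    exact isOpen_interior.preimage continuous_subtype_val
  obtain ⟨R, hR⟩ := (isPolytope_tile (0 : P.lattice)).isCompact.isBounded.subset_closedBall 0
  have hfin : (Metric.closedBall g (R + 1) ∩ (P.lattice : Set (EuclideanSpace ℝ (Fin d)))).Finite :=
    Metric.finite_isBounded_inter_isClosed (isDiscrete_iff_discreteTopology.2 hdisc)
      Metric.isBounded_closedBall AddSubgroup.isClosed_of_discrete
  refine Set.Finite.subset (hfin.preimage Subtype.val_injective.injOn) ?_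
  rintro t ⟨x, hx, hxg⟩
  refine ⟨?_, t.2⟩
  have h1 : x - t ∈ Metric.closedBall (0 : EuclideanSpace ℝ (Fin d)) R :=
    hR (by rw [tile_zero]; exact mem_tile.1 hx)
  rw [mem_closedBall_zero_iff, ← dist_eq_norm] at h1
  rw [Metric.mem_ball] at hxg
  rw [Metric.mem_closedBall]
  have := dist_triangle (t : EuclideanSpace ℝ (Fin d)) x g
  rw [dist_comm] at h1
  linarith

/-- In every direction one can move from a relative interior point of `G` inside one of the tiles
around `G`. -/
theorem exists_mem_dirCone (hG : IsTilingFace P G) (hg : IsRelInterior G g)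
    (w : EuclideanSpace ℝ (Fin d)) : ∃ t ∈ dualCell P G, w ∈ dirCone (tile P t) g := by
  obtain ⟨s, hs⟩ := hG
  have htend : Filter.Tendsto (fun ε : ℝ => g + ε • w) (nhdsWithin 0 (Set.Ioi 0)) (nhds g) := by
    have : Filter.Tendsto (fun ε : ℝ => g + ε • w) (nhds 0) (nhds (g + (0 : ℝ) • w)) :=
      Continuous.tendsto (by fun_prop) 0
    rw [zero_smul, add_zero] at this
    exact this.mono_left nhdsWithin_le_nhds
  have h1 : ∀ᶠ ε : ℝ in nhdsWithin 0 (Set.Ioi 0), g + ε • w ∈ Metric.ball g 1 :=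
    htend.eventually_mem (Metric.ball_mem_nhds g one_pos)
  have h2 : ∀ᶠ ε : ℝ in nhdsWithin 0 (Set.Ioi 0),
      ∀ t ∈ {t : P.lattice | (tile P t ∩ Metric.ball g 1).Nonempty},
        g ∉ tile P t → g + ε • w ∉ tile P t := by
    refine (Filter.eventually_all_finite (finite_tiles_near g)).2 fun t _ => ?_
    by_cases hgt : g ∈ tile P t
    · exact Filter.Eventually.of_forall fun _ h => absurd hgt h
    · have := htend.eventually_mem
        ((isPolytope_tile t).isCompact.isClosed.isOpen_compl.mem_nhds hgt)
      exact this.mono fun _ h _ => h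
  obtain ⟨ε, ⟨h1, h2⟩, hε⟩ := ((h1.and h2).and self_mem_nhdsWithin).exists
  have hcov : g + ε • w ∈ ⋃ t : P.lattice, ((t : EuclideanSpace ℝ (Fin d)) +ᵥ P.body) := by
    rw [P.cover]; trivial
  obtain ⟨t, ht⟩ := Set.mem_iUnion.1 hcov
  have hgt : g ∈ tile P t := by
    by_contra hgt
    exact h2 t ⟨_, ht, h1⟩ hgt ht
  exact ⟨t, hs.of_relInterior_mem hg hgt, ε, hε, ht⟩

/-! ### Dual 2-cells -/

/-- At least three tiles meet in a face of codimension two: the tangent cones of two tiles do not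
cover the space, even modulo the direction of the face. -/
theorem exists_third_tile (hF : dim F + 2 = d) (hs : s ∈ dualCell P F) (ht : t ∈ dualCell P F) :
    ∃ u ∈ dualCell P F, u ≠ s ∧ u ≠ t := by
  have hTF : IsTilingFace P F := ⟨s, hs⟩
  obtain ⟨g, hg⟩ := hTF.exists_isRelInterior
  have hface : ∀ r ∈ dualCell P F, ∃ l : EuclideanSpace ℝ (Fin d) →ₗ[ℝ] ℝ,
      ∀ w, 0 ≤ l w → w ∈ dirCone (tile P r) g → w ∈ vectorSpan ℝ F := by
    intro r hr
    obtain ⟨-, l, m, hle, hFeq⟩ := isFace_iff.1 hr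
    have hgm : l g = m := by
      have := hg.1
      rw [hFeq] at this
      exact this.2
    refine ⟨l, fun w hw ⟨ε, hε, hmem⟩ => ?_⟩
    have h1 : g + ε • w ∈ F := by
      rw [hFeq]
      refine ⟨hmem, le_antisymm (hle _ hmem) ?_⟩
      rw [map_add, map_smul, smul_eq_mul, hgm]
      have := mul_nonneg hε.le hw
      linarith
    have h2 := sub_mem_vectorSpan h1 hg.1
    rw [add_sub_cancel_left] at h2
    exact (Submodule.smul_mem_iff _ hε.ne').1 h2
  obtain ⟨l₁, hl₁⟩ := hface s hs
  obtain ⟨l₂, hl₂⟩ := hface t ht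
  obtain ⟨w, hwF, hw₁, hw₂⟩ : ∃ w, w ∉ vectorSpan ℝ F ∧ 0 ≤ l₁ w ∧ 0 ≤ l₂ w := by
    obtain ⟨w, hw, hwF⟩ : ∃ w ∈ LinearMap.ker l₁, w ∉ vectorSpan ℝ F := by
      by_contra hcon
      push Not at hcon
      have h1 := Submodule.finrank_mono (R := ℝ) (s := LinearMap.ker l₁) (t := vectorSpan ℝ F) hcon
      have h2 := LinearMap.finrank_range_add_finrank_ker l₁
      have h3 : Module.finrank ℝ (LinearMap.range l₁) ≤ 1 := by
        simpa using Submodule.finrank_le (LinearMap.range l₁)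
      rw [finrank_euclideanSpace_fin] at h2
      have h4 : dim F = Module.finrank ℝ (vectorSpan ℝ F) := rfl
      omega
    have hw0 : l₁ w = 0 := hw
    rcases le_total 0 (l₂ w) with h | h
    · exact ⟨w, hwF, hw0.ge, h⟩
    · exact ⟨-w, by rwa [Submodule.neg_mem_iff], by simp [hw0], by simpa using h⟩
  obtain ⟨u, hu, huw⟩ := exists_mem_dirCone hTF hg w
  refine ⟨u, hu, ?_, ?_⟩
  · rintro rfl
    exact hwF (hl₁ w hw₁ huw)
  · rintro rfl
    exact hwF (hl₂ w hw₂ huw)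

/-- A tile has at most two adjacent tiles around a face of codimension two. -/
theorem adjacent_at_most_two (hF : dim F + 2 = d) {b : Fin 3 → P.lattice}
    (hs : s ∈ dualCell P F) (hb : ∀ i, b i ∈ dualCell P F) (hadj : ∀ i, Adjacent P s (b i)) :
    b 0 = b 1 ∨ b 0 = b 2 ∨ b 1 = b 2 := by
  have hne : ∀ i, (tile P s ∩ tile P (b i)).Nonempty := fun i => inter_tile_nonempty hs (hb i)
  have := facets_eq_of_codim_two (F := tile P s) (G := F) (E := fun i => tile P s ∩ tile P (b i))
    (fun i => isFace_inter (hne i)) hs.nonempty (fun i => subset_inter_tile hs (hb i))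
    (fun i => by rw [dim_tile]; exact hadj i) (by rw [dim_tile]; exact hF)
  rcases this with h | h | h
  · exact Or.inl (eq_of_inter_eq h (hne 0))
  · exact Or.inr (Or.inl (eq_of_inter_eq h (hne 0)))
  · exact Or.inr (Or.inr (eq_of_inter_eq h (hne 1)))

/-- A dual 2-cell is a triangle or a parallelogram. If two tiles meet in `F` only, the cell is
centrally symmetric and every tile has two neighbours around `F`; otherwise all tiles around `F` are
pairwise adjacent. -/
theorem dualTwoCell_cases (hTF : IsTilingFace P F) (hF : dim F + 2 = d) :
    (∃ a b c, [a, b, c].Nodup ∧ dualCell P F = {a, b, c} ∧ Adjacent P a b ∧ Adjacent P b c ∧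
      Adjacent P a c) ∨
    (∃ a b c e, [a, b, c, e].Nodup ∧ dualCell P F = {a, b, c, e} ∧ a + c = b + e ∧
      Adjacent P a b ∧ Adjacent P b c ∧ Adjacent P c e ∧ Adjacent P e a ∧
      tile P a ∩ tile P c = F ∧ tile P b ∩ tile P e = F) := by
  by_cases hdiag : ∃ a ∈ dualCell P F, ∃ c ∈ dualCell P F, a ≠ c ∧ tile P a ∩ tile P c = F
  · right
    obtain ⟨a, ha, c, hc, hac, hF'⟩ := hdiag
    have hFne := ha.nonempty
    obtain ⟨b, hb, hba, hbc⟩ := exists_third_tile hF ha hc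
    have he := reflect_mem_dualCell hF' hb
    have hbe := inter_reflect_eq hF' hFne hb
    have heb := reflect_ne hFne hF' hac hb
    obtain ⟨e, hedef⟩ : ∃ e, e = a + c - b := ⟨_, rfl⟩
    rw [← hedef] at he hbe heb
    rw [Set.inter_comm] at hbe
    have hsum : a + c = b + e := by rw [hedef]; abel
    have hea : e ≠ a := by
      rintro rfl
      exact hbc (by rw [add_comm] at hsum; exact (add_right_cancel hsum).symm)
    have hec : e ≠ c := by
      rintro rfl
      exact hba (add_right_cancel hsum).symm
    -- the tile opposite to `s` is the only one that meets it in `F`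
    have huniq : ∀ {s t u : P.lattice}, s ∈ dualCell P F → t ∈ dualCell P F → s ≠ t → t ≠ u →
        tile P s ∩ tile P u = F → Adjacent P s t := by
      intro s t u hs ht hst htu h
      refine (inter_eq_or_adjacent hs ht hst hF).resolve_left fun h' => htu ?_
      exact eq_of_inter_eq (h'.trans h.symm) (by rwa [h'])
    have hab : Adjacent P a b := huniq ha hb hba.symm hbc hF'
    have hae : Adjacent P a e := huniq ha he hea.symm hec hF'
    have hcb : Adjacent P c b := huniq hc hb hbc.symm hba (by rwa [Set.inter_comm])
    have hce : Adjacent P c e := huniq hc he hec.symm hea (by rwa [Set.inter_comm])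
    refine ⟨a, b, c, e, ?_, ?_, hsum, hab, hcb.symm, hce, hae.symm, hF', hbe⟩
    · simp only [List.nodup_cons, List.mem_cons, List.not_mem_nil, or_false, not_or,
        not_false_eq_true, List.nodup_nil, and_true]
      exact ⟨⟨hba.symm, hac, hea.symm⟩, ⟨hbc, heb.symm⟩, hec.symm⟩
    · refine Set.Subset.antisymm (fun u hu => ?_) ?_
      · by_contra hcon
        simp only [Set.mem_insert_iff, Set.mem_singleton_iff, not_or] at hcon
        obtain ⟨hua, hub, huc, hue⟩ := hcon
        have hau : Adjacent P a u := huniq ha hu (Ne.symm hua) huc hF'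
        have := adjacent_at_most_two hF (b := ![b, e, u]) ha
          (fun i => by fin_cases i <;> assumption) (fun i => by fin_cases i <;> assumption)
        rcases this with h | h | h
        · exact heb h.symm
        · exact hub h.symm
        · exact hue h.symm
      · rintro u (rfl | rfl | rfl | rfl) <;> assumption
  · left
    push Not at hdiag
    have hadj : ∀ {s t}, s ∈ dualCell P F → t ∈ dualCell P F → s ≠ t → Adjacent P s t :=
      fun hs ht hst => (inter_eq_or_adjacent hs ht hst hF).resolve_left (hdiag _ hs _ ht hst)
    obtain ⟨a, ha⟩ := hTF
    obtain ⟨b, hb, hba, -⟩ := exists_third_tile hF ha ha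
    obtain ⟨c, hc, hca, hcb⟩ := exists_third_tile hF ha hb
    refine ⟨a, b, c, ?_, ?_, hadj ha hb hba.symm, hadj hb hc hcb.symm, hadj ha hc hca.symm⟩
    · simp only [List.nodup_cons, List.mem_cons, List.not_mem_nil, or_false, not_or,
        not_false_eq_true, List.nodup_nil, and_true]
      exact ⟨⟨hba.symm, hca.symm⟩, hcb.symm⟩
    · refine Set.Subset.antisymm (fun u hu => ?_) ?_
      · by_contra hcon
        simp only [Set.mem_insert_iff, Set.mem_singleton_iff, not_or] at hcon
        obtain ⟨hua, hub, huc⟩ := hcon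
        have := adjacent_at_most_two hF (b := ![b, c, u]) ha
          (fun i => by fin_cases i <;> assumption)
          (fun i => by
            fin_cases i
            · exact hadj ha hb hba.symm
            · exact hadj ha hc hca.symm
            · exact hadj ha hu (Ne.symm hua))
        rcases this with h | h | h
        · exact hcb h.symm
        · exact hub h.symm
        · exact huc h.symm
      · rintro u (rfl | rfl | rfl) <;> assumption

end Tiling

end Venkov

/-! ### Crossing diagonals -/

namespace Venkov

section Crossing

variable {d : ℕ} {P : Parallelohedron d} {F G H : Set (EuclideanSpace ℝ (Fin d))}
  {g : EuclideanSpace ℝ (Fin d)} {s t u v : P.lattice}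

theorem center_sub_mem_dirCone : (s : EuclideanSpace ℝ (Fin d)) - g ∈ dirCone (interior (tile P s)) g :=
  ⟨1, one_pos, by simpa using center_mem_interior s⟩

theorem middle_sub_mem_dirCone (h : (tile P s ∩ tile P t).Nonempty) :
    middle s t - g ∈ dirCone (tile P s ∩ tile P t) g :=
  ⟨1, one_pos, by simpa using middle_mem h⟩

/-- A nonnegative combination of the directions to two centres `s`, `t` points into the interior
of the tile with the larger coefficient. -/
theorem combination_mem_dirCone {α β : ℝ} (hβ : 0 ≤ β) (hs : g ∈ tile P s) (ht : g ∈ tile P t)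
    (h : β < α) : α • ((s : EuclideanSpace ℝ (Fin d)) - g) + β • ((t : EuclideanSpace ℝ (Fin d)) - g) ∈
      dirCone (interior (tile P s)) g := by
  have h1 : (α - β) • ((s : EuclideanSpace ℝ (Fin d)) - g) ∈ dirCone (interior (tile P s)) g :=
    smul_mem_dirCone center_sub_mem_dirCone (sub_pos.2 h)
  rcases hβ.eq_or_lt with rfl | hβ
  · simpa using h1
  have h2 := smul_mem_dirCone (dirCone_mono Set.inter_subset_left
    (middle_sub_mem_dirCone (g := g) ⟨g, hs, ht⟩)) (c := 2 * β) (by positivity)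
  have := add_mem_dirCone_interior (convex_tile s) h1 h2
  convert this using 1
  rw [middle]
  module

theorem combination_mem_dirCone_of_le {α β : ℝ} (hβ : 0 ≤ β) (hs : g ∈ tile P s) (ht : g ∈ tile P t)
    (h : β ≤ α) : α • ((s : EuclideanSpace ℝ (Fin d)) - g) + β • ((t : EuclideanSpace ℝ (Fin d)) - g) ∈
      dirCone (tile P s) g := by
  rcases h.eq_or_lt with rfl | h
  · rcases hβ.eq_or_lt with rfl | hβ
    · exact ⟨1, one_pos, by simpa using hs⟩
    · have h2 := smul_mem_dirCone (dirCone_mono Set.inter_subset_left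
        (middle_sub_mem_dirCone (g := g) ⟨g, hs, ht⟩)) (c := 2 * β) (by positivity)
      convert h2 using 1
      rw [middle]
      module
  · exact dirCone_mono interior_subset (combination_mem_dirCone hβ hs ht h)

theorem add_vectorSpan_mem_dirCone (hG : s ∈ dualCell P G) (hg : IsRelInterior G g)
    {x y : EuclideanSpace ℝ (Fin d)} (hx : x ∈ dirCone (tile P s) g) (hy : y ∈ vectorSpan ℝ G) :
    x + y ∈ dirCone (tile P s) g :=
  add_mem_dirCone (convex_tile s) (hG.subset hg.1) hx
    (dirCone_mono hG.subset (vectorSpan_subset_dirCone (hG.convex (convex_tile s)) hg hy))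

/-- Two segments that join the centres of four tiles around `G` can only cross, modulo the
direction of `G`, in their midpoints: the coefficients within each pair agree. -/
theorem crossing_coeff_le (hg : IsRelInterior G g) {s s' u u' : P.lattice}
    (hs : s ∈ dualCell P G) (hs' : s' ∈ dualCell P G) (hu : u ∈ dualCell P G)
    (hu' : u' ∈ dualCell P G) (hsu : s ≠ u) (hsu' : s ≠ u')
    {α β γ δ : ℝ} (hβ : 0 ≤ β) (hγ : 0 ≤ γ) (hδ : 0 ≤ δ)
    (h : (α • ((s : EuclideanSpace ℝ (Fin d)) - g) + β • ((s' : EuclideanSpace ℝ (Fin d)) - g)) -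
      (γ • ((u : EuclideanSpace ℝ (Fin d)) - g) + δ • ((u' : EuclideanSpace ℝ (Fin d)) - g)) ∈
        vectorSpan ℝ G) : α ≤ β := by
  by_contra hlt
  have hgm : ∀ {r : P.lattice}, r ∈ dualCell P G → g ∈ tile P r := fun hr => hr.subset hg.1
  have h1 := combination_mem_dirCone hβ (hgm hs) (hgm hs') (not_le.1 hlt)
  rcases le_total δ γ with hle | hle
  · have h2 := combination_mem_dirCone_of_le hδ (hgm hu) (hgm hu') hle
    have h3 := add_vectorSpan_mem_dirCone hu hg h2 h
    rw [add_sub_cancel] at h3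
    exact hsu (eq_of_mem_dirCone (hgm hs) (hgm hu) h1 h3)
  · have h2 := combination_mem_dirCone_of_le hγ (hgm hu') (hgm hu) hle
    rw [add_comm] at h2
    have h3 := add_vectorSpan_mem_dirCone hu' hg h2 h
    rw [add_sub_cancel] at h3
    exact hsu' (eq_of_mem_dirCone (hgm hs) (hgm hu') h1 h3)

theorem inter_eq_of_middle_sub_mem (hs : s ∈ dualCell P G) (ht : t ∈ dualCell P G)
    (hg : g ∈ G) (h : middle s t - g ∈ vectorSpan ℝ G) : tile P s ∩ tile P t = G := by
  have hsub := subset_inter_tile hs ht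
  have hm := middle_mem (inter_tile_nonempty hs ht)
  exact inter_eq_of_middle_mem ht hsub (ht.mem_of_sub_mem hm.2 hg h)

/-- The ray from `g` through the midpoint of `u u'` leads into both tiles `u` and `u'`. If the ray
through the midpoint of `s s'` agrees with it modulo the direction of `G`, then a relative interior
point of `P_s ∩ P_s'` lies in these tiles, hence all of `P_s ∩ P_s'` does. -/
theorem crossing_subset (hg : IsRelInterior G g) {s s' u u' : P.lattice}
    (hs : s ∈ dualCell P G) (hs' : s' ∈ dualCell P G) (hu : u ∈ dualCell P G)
    (hu' : u' ∈ dualCell P G) {α γ : ℝ} (hα : 0 < α) (hγ : 0 < γ)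
    (h : α • (middle s s' - g) - γ • (middle u u' - g) ∈ vectorSpan ℝ G) :
    tile P s ∩ tile P s' ⊆ tile P u ∩ tile P u' := by
  have hgm : ∀ {r : P.lattice}, r ∈ dualCell P G → g ∈ tile P r := fun hr => hr.subset hg.1
  have hmid := middle_sub_mem_dirCone (g := g) (inter_tile_nonempty hu hu')
  have hne := inter_tile_nonempty hs hs'
  have hconv : Convex ℝ (tile P s ∩ tile P s') := (convex_tile s).inter (convex_tile s')
  -- a point of the segment from `g` to the centre of `P_s ∩ P_s'` lies in the tile `r`
  have key : ∀ r ∈ dualCell P G, middle u u' - g ∈ dirCone (tile P r) g →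
      tile P s ∩ tile P s' ⊆ tile P r := by
    intro r hr hmr
    have h1 := add_vectorSpan_mem_dirCone hr hg (smul_mem_dirCone hmr hγ) h
    rw [add_sub_cancel] at h1
    have h2 := smul_mem_dirCone h1 (inv_pos.2 hα)
    rw [smul_smul, inv_mul_cancel₀ hα.ne', one_smul] at h2
    obtain ⟨ε, hε, hmem⟩ := h2
    have hm : 0 < min ε 1 := lt_min hε one_pos
    have h3 := dirCone_small (convex_tile r) (hgm hr) hmem hm (min_le_left _ _)
    have hrel : IsRelInterior (tile P s ∩ tile P s') (g + min ε 1 • (middle s s' - g)) := by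
      have hgH : g ∈ tile P s ∩ tile P s' := ⟨hgm hs, hgm hs'⟩
      refine ⟨hconv.add_smul_sub_mem hgH (middle_mem hne) ⟨hm.le, min_le_right _ _⟩,
        fun x hx => ?_⟩
      -- prolong beyond the point by combining the prolongation at the centre with `g`
      set τ := min ε 1 with hτ
      have hτ1 : τ ≤ 1 := min_le_right _ _
      have hb := middle_mem hne
      have hrefl := reflect_mem_inter hx
      have hrefl' : (2 : ℝ) • middle s s' - x ∈ tile P s ∩ tile P s' := by
        convert hrefl using 2
        rw [middle]
        push_cast
        module
      refine ⟨τ / (2 - τ), div_pos hm (by linarith), ?_⟩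
      have h4 : (0 : ℝ) < 2 - τ := by linarith
      have := hconv hgH hrefl' (a := 1 - τ / (2 - τ)) (b := τ / (2 - τ))
        (by rw [sub_nonneg, div_le_one h4]; linarith) (by positivity) (by ring)
      convert this using 1
      have h5 : τ = 2 * (τ / (2 - τ)) - τ * (τ / (2 - τ)) := by field_simp
      generalize τ / (2 - τ) = κ at h5 ⊢
      have h6 : τ + κ * τ = 2 * κ := by linarith
      match_scalars <;> linarith
    have hr' : IsFace (tile P r) (tile P s ∩ tile P s') :=
      (isFace_inter hne).of_relInterior_mem hrel h3
    exact hr'.subset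
  exact Set.subset_inter (key u hu (dirCone_mono Set.inter_subset_left hmid))
    (key u' hu' (dirCone_mono Set.inter_subset_right hmid))

/-- If the segments `s s'` and `u u'` between centres of four tiles around `G`, seen modulo the
direction of `G` from a point of `G`, span crossing cones, then the two pairs of tiles have the same
intersection. -/
theorem inter_eq_of_crossing (hg : IsRelInterior G g) {s s' u u' : P.lattice}
    (hs : s ∈ dualCell P G) (hs' : s' ∈ dualCell P G) (hu : u ∈ dualCell P G)
    (hu' : u' ∈ dualCell P G) (hsu : s ≠ u) (hsu' : s ≠ u') (hs'u : s' ≠ u) (hs'u' : s' ≠ u')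
    (hss : tile P s ∩ tile P s' ≠ G) (huu : tile P u ∩ tile P u' ≠ G)
    {α β γ δ : ℝ} (hα : 0 ≤ α) (hβ : 0 ≤ β) (hγ : 0 ≤ γ) (hδ : 0 ≤ δ)
    (hpos : 0 < α + β + γ + δ)
    (h : (α • ((s : EuclideanSpace ℝ (Fin d)) - g) + β • ((s' : EuclideanSpace ℝ (Fin d)) - g)) -
      (γ • ((u : EuclideanSpace ℝ (Fin d)) - g) + δ • ((u' : EuclideanSpace ℝ (Fin d)) - g)) ∈
        vectorSpan ℝ G) : tile P s ∩ tile P s' = tile P u ∩ tile P u' := by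
  have hneg := Submodule.neg_mem _ h
  rw [neg_sub] at hneg
  have hαβ : α = β := by
    refine le_antisymm (crossing_coeff_le hg hs hs' hu hu' hsu hsu' hβ hγ hδ h) ?_
    exact crossing_coeff_le hg hs' hs hu hu' hs'u hs'u' hα hγ hδ (by rwa [add_comm (β • _)])
  have hγδ : γ = δ := by
    refine le_antisymm (crossing_coeff_le hg hu hu' hs hs' hsu.symm hs'u.symm hδ hα hβ hneg) ?_
    exact crossing_coeff_le hg hu' hu hs hs' hsu'.symm hs'u'.symm hγ hα hβ
      (by rwa [add_comm (δ • _)])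
  subst hαβ hγδ
  have h' : (2 * α) • (middle s s' - g) - (2 * γ) • (middle u u' - g) ∈ vectorSpan ℝ G := by
    convert h using 1
    simp only [middle]
    module
  have hα0 : 0 < α := by
    refine lt_of_le_of_ne hα fun h0 => huu ?_
    subst h0
    refine inter_eq_of_middle_sub_mem hu hu' hg.1 ?_
    rw [mul_zero, zero_smul, zero_sub, Submodule.neg_mem_iff] at h'
    exact (Submodule.smul_mem_iff _ (by linarith)).1 h'
  have hγ0 : 0 < γ := by
    refine lt_of_le_of_ne hγ fun h0 => hss ?_
    subst h0
    refine inter_eq_of_middle_sub_mem hs hs' hg.1 ?_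
    rw [mul_zero, zero_smul, sub_zero] at h'
    exact (Submodule.smul_mem_iff _ (by linarith)).1 h'
  refine Set.Subset.antisymm
    (crossing_subset hg hs hs' hu hu' (by positivity) (by positivity) h') ?_
  refine crossing_subset hg hu hu' hs hs' (α := 2 * γ) (γ := 2 * α) (by positivity)
    (by positivity) ?_
  rw [← neg_sub]
  exact Submodule.neg_mem _ h'

/-- Modulo the direction of a face of codimension three, any four vectors are linearly
dependent. -/
theorem exists_dependency_mod {ι : Type*} [Fintype ι] (hG : dim G + 3 = d)
    (w : ι → EuclideanSpace ℝ (Fin d)) (hι : 3 < Fintype.card ι) :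
    ∃ c : ι → ℝ, c ≠ 0 ∧ ∑ i, c i • w i ∈ vectorSpan ℝ G := by
  have hq : Module.finrank ℝ (EuclideanSpace ℝ (Fin d) ⧸ vectorSpan ℝ G) = 3 := by
    have := Submodule.finrank_quotient_add_finrank (vectorSpan ℝ G)
    rw [finrank_euclideanSpace_fin] at this
    have h4 : dim G = Module.finrank ℝ (vectorSpan ℝ G) := rfl
    omega
  have hdep : ¬ LinearIndependent ℝ fun i => (vectorSpan ℝ G).mkQ (w i) := by
    intro h
    have := h.fintype_card_le_finrank
    omega
  obtain ⟨c, hc, i, hi⟩ := Fintype.not_linearIndependent_iff.1 hdep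
  refine ⟨c, fun h => hi (by simp [h]), ?_⟩
  rw [← Submodule.Quotient.mk_eq_zero, ← Submodule.mkQ_apply, map_sum]
  simpa using hc

/-- Among the linear dependencies of five vectors in space there is one with at most two
positive and at most two negative coefficients. This is the linear form of the fact that the
complete graph on five vertices is not planar. -/
theorem exists_balanced_dependency (hG : dim G + 3 = d) (w : Fin 5 → EuclideanSpace ℝ (Fin d)) :
    ∃ c : Fin 5 → ℝ, c ≠ 0 ∧ ∑ i, c i • w i ∈ vectorSpan ℝ G ∧
      (Finset.univ.filter fun i => 0 < c i).card ≤ 2 ∧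
      (Finset.univ.filter fun i => c i < 0).card ≤ 2 := by
  -- there are two independent dependencies `c₁`, `c₂`; on the circle of their combinations, the
  -- antipodal sets with three positive and with three negative coefficients are open and disjoint,
  -- so they do not cover the circle
  -- the second dependency: drop a vector with nonzero coefficient in the first one
  obtain ⟨c₁, hc₁, hw₁⟩ := exists_dependency_mod hG w (by simp)
  obtain ⟨j, hj⟩ := Function.ne_iff.1 hc₁
  obtain ⟨c₂, hc₂, hw₂, hj₂⟩ : ∃ c : Fin 5 → ℝ, c ≠ 0 ∧ ∑ i, c i • w i ∈ vectorSpan ℝ G ∧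
      c j = 0 := by
    obtain ⟨c, hc, hw⟩ := exists_dependency_mod hG (fun i => w (j.succAbove i)) (by simp)
    refine ⟨j.insertNth 0 c, fun h => hc ?_, ?_, by simp⟩
    · ext i
      have := congrFun h (j.succAbove i)
      simpa using this
    · rw [Fin.sum_univ_succAbove _ j]
      simpa using hw
  set γ : ℝ → Fin 5 → ℝ := fun θ i => Real.cos θ * c₁ i + Real.sin θ * c₂ i with hγ
  have hγ0 : ∀ θ, γ θ ≠ 0 := by
    intro θ h
    have h1 : Real.cos θ * c₁ j + Real.sin θ * c₂ j = 0 := congrFun h j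
    rw [hj₂, mul_zero, add_zero] at h1
    have hcos : Real.cos θ = 0 := (mul_eq_zero.1 h1).resolve_right hj
    obtain ⟨i, hi⟩ := Function.ne_iff.1 hc₂
    have h2 : Real.cos θ * c₁ i + Real.sin θ * c₂ i = 0 := congrFun h i
    rw [hcos, zero_mul, zero_add] at h2
    have hsin : Real.sin θ = 0 := (mul_eq_zero.1 h2).resolve_right hi
    have := Real.sin_sq_add_cos_sq θ
    rw [hcos, hsin] at this
    norm_num at this
  have hγw : ∀ θ, ∑ i, γ θ i • w i ∈ vectorSpan ℝ G := by
    intro θ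
    have := Submodule.add_mem _ (Submodule.smul_mem _ (Real.cos θ) hw₁)
      (Submodule.smul_mem _ (Real.sin θ) hw₂)
    convert this using 1
    simp only [hγ, add_smul, mul_smul, Finset.sum_add_distrib, Finset.smul_sum]
  have hγc : ∀ i, Continuous fun θ => γ θ i := by
    intro i
    simp only [hγ]
    fun_prop
  have hopen : ∀ (p : ℝ → Prop) [DecidablePred p], IsOpen {x | p x} → IsOpen {θ | 3 ≤
      (Finset.univ.filter fun i => p (γ θ i)).card} := by
    intro p _ hp
    have : {θ | 3 ≤ (Finset.univ.filter fun i => p (γ θ i)).card} =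
        ⋃ T ∈ {T : Finset (Fin 5) | 3 ≤ T.card}, ⋂ i ∈ T, {θ | p (γ θ i)} := by
      ext θ
      simp only [Set.mem_ofPred_eq, Set.mem_iUnion, Set.mem_iInter, exists_prop]
      constructor
      · intro h
        exact ⟨_, h, fun i hi => (Finset.mem_filter.1 hi).2⟩
      · rintro ⟨T, hT, h⟩
        exact hT.trans (Finset.card_le_card fun i hi => Finset.mem_filter.2 ⟨Finset.mem_univ _, h i hi⟩)
    rw [this]
    refine isOpen_biUnion fun T _ => isOpen_biInter_finset fun i _ => hp.preimage (hγc i)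
  set A := {θ | 3 ≤ (Finset.univ.filter fun i => 0 < γ θ i).card}
  set B := {θ | 3 ≤ (Finset.univ.filter fun i => γ θ i < 0).card}
  have hA : IsOpen A := hopen (fun x => 0 < x) isOpen_Ioi
  have hB : IsOpen B := hopen (fun x => x < 0) isOpen_Iio
  have hAB : ∀ θ, θ ∈ A ↔ θ + Real.pi ∈ B := by
    intro θ
    simp only [A, B, hγ, Set.mem_ofPred_eq, Real.cos_add_pi, Real.sin_add_pi]
    have : ∀ i, -Real.cos θ * c₁ i + -Real.sin θ * c₂ i = -(Real.cos θ * c₁ i + Real.sin θ * c₂ i) :=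
      fun i => by ring
    simp only [this, neg_lt_zero]
  have hBA : ∀ θ, θ ∈ B ↔ θ + Real.pi ∈ A := by
    intro θ
    simp only [A, B, hγ, Set.mem_ofPred_eq, Real.cos_add_pi, Real.sin_add_pi]
    have : ∀ i, -Real.cos θ * c₁ i + -Real.sin θ * c₂ i = -(Real.cos θ * c₁ i + Real.sin θ * c₂ i) :=
      fun i => by ring
    simp only [this, neg_pos]
  by_contra hcon
  push Not at hcon
  have hcover : ∀ θ, θ ∈ A ∨ θ ∈ B := by
    intro θ
    by_contra h
    push Not at h
    have h1 : ¬ 3 ≤ (Finset.univ.filter fun i => 0 < γ θ i).card := h.1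
    have h2 : ¬ 3 ≤ (Finset.univ.filter fun i => γ θ i < 0).card := h.2
    have := hcon (γ θ) (hγ0 θ) (hγw θ) (by omega)
    omega
  have hAne : A.Nonempty := by
    rcases hcover 0 with h | h
    · exact ⟨_, h⟩
    · exact ⟨_, (hBA 0).1 h⟩
  have hBne : B.Nonempty := by
    rcases hcover 0 with h | h
    · exact ⟨_, (hAB 0).1 h⟩
    · exact ⟨_, h⟩
  obtain ⟨θ, -, h1, h2⟩ := isPreconnected_univ (α := ℝ) A B hA hB (fun θ _ => hcover θ)
    (by simpa using hAne) (by simpa using hBne)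
  have h1 : 3 ≤ (Finset.univ.filter fun i => 0 < γ θ i).card := h1
  have h2 : 3 ≤ (Finset.univ.filter fun i => γ θ i < 0).card := h2
  have h3 : Disjoint (Finset.univ.filter fun i => 0 < γ θ i)
      (Finset.univ.filter fun i => γ θ i < 0) :=
    Finset.disjoint_filter.2 fun i _ h h' => lt_asymm h h'
  have h4 := Finset.card_le_univ ((Finset.univ.filter fun i => 0 < γ θ i) ∪
      (Finset.univ.filter fun i => γ θ i < 0))
  rw [Finset.card_union_of_disjoint h3] at h4
  simp at h4
  omega

end Crossing

end Venkov

/-! ### Dual 2-cells in a dual 3-cell -/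

namespace Venkov

section ThreeCells

variable {d : ℕ} {P : Parallelohedron d} {E E' F G H : Set (EuclideanSpace ℝ (Fin d))}
  {g : EuclideanSpace ℝ (Fin d)} {s t u v : P.lattice}

/-- Two pairs of tiles around `G` that meet in the same face, larger than `G`, are the diagonals of
a dual parallelogram. -/
theorem parallelogram_of_inter_eq (hdim : dim G + 3 = d) {s s' u u' : P.lattice}
    (hs : s ∈ dualCell P G) (hs' : s' ∈ dualCell P G) (hu : u ∈ dualCell P G)
    (hu' : u' ∈ dualCell P G) (hnd : [s, s', u, u'].Nodup)
    (h : tile P s ∩ tile P s' = tile P u ∩ tile P u') (hne : tile P s ∩ tile P s' ≠ G) :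
    {s, s', u, u'} ∈ dualTwoCells P G ∧ s + s' = u + u' ∧ ¬ Adjacent P s s' ∧
      ¬ Adjacent P u u' := by
  simp only [List.nodup_cons, List.mem_cons, List.not_mem_nil, or_false, not_or,
    not_false_eq_true, List.nodup_nil, and_true] at hnd
  obtain ⟨⟨hss', hsu, hsu'⟩, ⟨hs'u, hs'u'⟩, huu'⟩ := hnd
  obtain ⟨F, hF⟩ : ∃ F, F = tile P s ∩ tile P s' := ⟨_, rfl⟩
  have hGF : G ⊆ F := by rw [hF]; exact subset_inter_tile hs hs'
  have hFne : (tile P s ∩ tile P s').Nonempty := inter_tile_nonempty hs hs'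
  have hsF : s ∈ dualCell P F := by rw [hF]; exact isFace_inter hFne
  have hs'F : s' ∈ dualCell P F := by
    rw [hF, Set.inter_comm]; rw [Set.inter_comm] at hFne; exact isFace_inter hFne
  have hFne' : (tile P u ∩ tile P u').Nonempty := inter_tile_nonempty hu hu'
  have huF : u ∈ dualCell P F := by rw [hF, h]; exact isFace_inter hFne'
  have hu'F : u' ∈ dualCell P F := by
    rw [hF, h, Set.inter_comm]; rw [Set.inter_comm] at hFne'; exact isFace_inter hFne'
  have hnadj : ¬ dim F + 1 = d := fun hfac => hs'u (eq_of_inter_eq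
    (hF.symm.trans (inter_eq_of_facet hsF huF hsu hfac)) hFne)
  have hFdim : dim F + 2 = d := by
    have h1 := dim_inter_lt hss' hFne
    have h2 := hs.dim_lt hGF hsF.subset (by rw [hF]; exact hne.symm)
    rw [← hF] at h1
    omega
  refine ⟨⟨F, ⟨s, hsF⟩, hFdim, hGF, ?_⟩, add_eq_of_inter_eq h hFne, by rwa [Adjacent, ← hF],
    by rwa [Adjacent, ← h, ← hF]⟩
  have hsub : ({s, s', u, u'} : Set P.lattice) ⊆ dualCell P F := by
    rintro x (rfl | rfl | rfl | rfl) <;> assumption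
  refine hsub.antisymm ?_
  classical
  have hcard : ({s, s', u, u'} : Finset P.lattice).card = 4 := by
    rw [Finset.card_insert_of_notMem, Finset.card_insert_of_notMem, Finset.card_insert_of_notMem,
      Finset.card_singleton] <;> simp [*]
  have hle : ∀ T : Finset P.lattice, dualCell P F = T → T.card ≤ 4 →
      dualCell P F ⊆ {s, s', u, u'} := by
    intro T hT hT4
    have h1 : ({s, s', u, u'} : Finset P.lattice) ⊆ T := by
      rw [← Finset.coe_subset, ← hT]
      simpa using hsub
    have h2 := Finset.eq_of_subset_of_card_le h1 (by omega)
    rw [hT, ← h2]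
    simp
  rcases dualTwoCell_cases ⟨s, hsF⟩ hFdim with ⟨a, b, c, -, hD, -⟩ | ⟨a, b, c, e, -, hD, -⟩
  · exact hle {a, b, c} (by simpa using hD) ((Finset.card_le_three).trans (by norm_num))
  · exact hle {a, b, c, e} (by simpa using hD) Finset.card_le_four

/-- Two faces of codimension two with three common tiles coincide. -/
theorem eq_of_three_tiles (hE : dim E + 2 = d) (hE' : dim E' + 2 = d) {a b c : P.lattice}
    (hab : a ≠ b) (hac : a ≠ c) (hbc : b ≠ c) (ha : a ∈ dualCell P E) (hb : b ∈ dualCell P E)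
    (hc : c ∈ dualCell P E) (ha' : a ∈ dualCell P E') (hb' : b ∈ dualCell P E')
    (hc' : c ∈ dualCell P E') : E = E' := by
  have hadj : ∀ {x y}, x ∈ dualCell P E → y ∈ dualCell P E → x ∈ dualCell P E' →
      y ∈ dualCell P E' → x ≠ y → E = E' ∨ Adjacent P x y := by
    intro x y hx hy hx' hy' hxy
    rcases inter_eq_or_adjacent hx hy hxy hE with h | h
    · rcases inter_eq_or_adjacent hx' hy' hxy hE' with h' | h'
      · exact Or.inl (h.symm.trans h')
      · exact Or.inr h'
    · exact Or.inr h
  rcases hadj ha hb ha' hb' hab with h | hAb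
  · exact h
  rcases hadj ha hc ha' hc' hac with h | hAc
  · exact h
  have hneb := inter_tile_nonempty ha hb
  have hnec := inter_tile_nonempty ha hc
  have hsub : ∀ {X}, a ∈ dualCell P X → b ∈ dualCell P X → c ∈ dualCell P X →
      X ⊆ (tile P a ∩ tile P b) ∩ (tile P a ∩ tile P c) := fun h1 h2 h3 =>
    Set.subset_inter (subset_inter_tile h1 h2) (subset_inter_tile h1 h3)
  have hK : IsFace (tile P a) ((tile P a ∩ tile P b) ∩ (tile P a ∩ tile P c)) :=
    (isFace_inter hneb).inter (isFace_inter hnec) (ha.nonempty.mono (hsub ha hb hc))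
  have hKdim : dim ((tile P a ∩ tile P b) ∩ (tile P a ∩ tile P c)) + 2 ≤ d := by
    have h1 := hK.dim_lt Set.inter_subset_left Set.inter_subset_left (fun h => hbc ?_)
    · rw [Adjacent] at hAb
      omega
    · have h2 : tile P a ∩ tile P b ⊆ tile P a ∩ tile P c := by
        rw [← h]; exact Set.inter_subset_right
      refine eq_of_inter_eq ((isFace_inter hneb).eq_of_dim_le h2 Set.inter_subset_left ?_) hneb
      rw [Adjacent] at hAb hAc
      omega
  have h1 := ha.eq_of_dim_le (hsub ha hb hc) hK.subset (by omega)
  have h2 := ha'.eq_of_dim_le (hsub ha' hb' hc') hK.subset (by omega)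
  exact h1.trans h2.symm

/-- Two faces of codimension two with two common tiles that are not adjacent coincide. -/
theorem eq_of_not_adjacent (hE : dim E + 2 = d) (hE' : dim E' + 2 = d) {a b : P.lattice}
    (hab : a ≠ b) (ha : a ∈ dualCell P E) (hb : b ∈ dualCell P E) (ha' : a ∈ dualCell P E')
    (hb' : b ∈ dualCell P E') (h : ¬ Adjacent P a b) : E = E' :=
  ((inter_eq_or_adjacent ha hb hab hE).resolve_right h).symm.trans
    ((inter_eq_or_adjacent ha' hb' hab hE').resolve_right h)

/-- Every edge of a dual 3-cell lies in two dual 2-cells. -/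
theorem exists_two_dualTwoCells (hG : dim G + 3 = d) (hs : s ∈ dualCell P G)
    (ht : t ∈ dualCell P G) (hadj : Adjacent P s t) :
    ∃ X ∈ dualTwoCells P G, ∃ Y ∈ dualTwoCells P G, X ≠ Y ∧ s ∈ X ∧ t ∈ X ∧ s ∈ Y ∧ t ∈ Y := by
  have hne := inter_tile_nonempty hs ht
  have hst : s ≠ t := by
    rintro rfl
    rw [Adjacent, Set.inter_self, dim_tile] at hadj
    omega
  have hF : IsFace (tile P s) (tile P s ∩ tile P t) := isFace_inter hne
  have hF' : IsFace (tile P t) (tile P s ∩ tile P t) := by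
    rw [Set.inter_comm] at hne ⊢; exact isFace_inter hne
  have hsub := subset_inter_tile hs ht
  rw [Adjacent] at hadj
  obtain ⟨E₁, E₂, hE₁, hE₂, hG₁, hG₂, hne₁, hne₂, hlt₁, hlt₂, hinter⟩ :=
    exists_two_faces (hF.isPolytope (isPolytope_tile s)) (hs.of_subset hsub Set.inter_subset_left)
      (by omega)
  have hdim : ∀ E, IsFace (tile P s ∩ tile P t) E → G ⊆ E → G ≠ E → E ≠ tile P s ∩ tile P t →
      dim E + 2 = d := by
    intro E hE hGE hne hlt
    have h1 := hs.dim_lt hGE (hE.subset.trans Set.inter_subset_left) hne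
    have h2 := hE.dim_lt hE.subset le_rfl hlt
    omega
  have hd₁ := hdim E₁ hE₁ hG₁ hne₁ hlt₁
  have hd₂ := hdim E₂ hE₂ hG₂ hne₂ hlt₂
  have hs₁ : s ∈ dualCell P E₁ := IsFace.trans (isPolytope_tile s) hF hE₁
  have ht₁ : t ∈ dualCell P E₁ := IsFace.trans (isPolytope_tile t) hF' hE₁
  have hs₂ : s ∈ dualCell P E₂ := IsFace.trans (isPolytope_tile s) hF hE₂
  have ht₂ : t ∈ dualCell P E₂ := IsFace.trans (isPolytope_tile t) hF' hE₂
  refine ⟨dualCell P E₁, ⟨E₁, ⟨s, hs₁⟩, hd₁, hG₁, rfl⟩, dualCell P E₂,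
    ⟨E₂, ⟨s, hs₂⟩, hd₂, hG₂, rfl⟩, fun heq => ?_, hs₁, ht₁, hs₂, ht₂⟩
  obtain ⟨u, hu, hus, hut⟩ := exists_third_tile hd₁ hs₁ ht₁
  have hE := eq_of_three_tiles hd₁ hd₂ hst hus.symm hut.symm hs₁ ht₁ hu hs₂ ht₂ (by rwa [← heq])
  apply hne₁
  rw [← hinter, ← hE, Set.inter_self]

/-- Among five tiles around `G`, no two of which meet in `G` only, there are four that form a dual
parallelogram. -/
theorem exists_parallelogram (hdim : dim G + 3 = d) {b : Fin 5 → P.lattice}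
    (hinj : Function.Injective b) (hb : ∀ i, b i ∈ dualCell P G)
    (hne : ∀ i j, i ≠ j → tile P (b i) ∩ tile P (b j) ≠ G) :
    ∃ i j k l, [i, j, k, l].Nodup ∧ {b i, b j, b k, b l} ∈ dualTwoCells P G ∧
      b i + b j = b k + b l ∧ ¬ Adjacent P (b i) (b j) ∧ ¬ Adjacent P (b k) (b l) := by
  obtain ⟨g, hg⟩ := IsTilingFace.exists_isRelInterior ⟨b 0, hb 0⟩
  obtain ⟨c, hc, hcw, hpos, hneg⟩ := exists_balanced_dependency hdim
    (fun i => (b i : EuclideanSpace ℝ (Fin d)) - g)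
  set p := Finset.univ.filter fun i => 0 < c i with hp
  set n := Finset.univ.filter fun i => c i < 0 with hn
  have hpn : Disjoint p n := Finset.disjoint_filter.2 fun i _ h h' => lt_asymm h h'
  obtain ⟨T₁, hpT, hT₁, hT₁c⟩ := Finset.exists_subsuperset_card_eq (s := p) (t := nᶜ) (n := 2)
    (fun i hi => Finset.mem_compl.2 (Finset.disjoint_left.1 hpn hi)) hpos (by
      rw [Finset.card_compl, Fintype.card_fin]; omega)
  obtain ⟨T₂, hnT, hT₂, hT₂c⟩ := Finset.exists_subsuperset_card_eq (s := n) (t := T₁ᶜ) (n := 2)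
    (fun i hi => Finset.mem_compl.2 fun h => Finset.mem_compl.1 (hT₁ h) hi) hneg (by
      rw [Finset.card_compl, Fintype.card_fin]; omega)
  obtain ⟨i, j, hij, hT₁e⟩ := Finset.card_eq_two.1 hT₁c
  obtain ⟨k, l, hkl, hT₂e⟩ := Finset.card_eq_two.1 hT₂c
  have hdisj : ∀ x ∈ T₁, ∀ y ∈ T₂, x ≠ y := by
    rintro x hx y hy rfl
    exact Finset.mem_compl.1 (hT₂ hy) hx
  have hnonneg : ∀ x ∈ T₁, 0 ≤ c x := fun x hx => by
    have := Finset.mem_compl.1 (hT₁ hx)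
    simpa [hn] using this
  have hnonpos : ∀ x ∈ T₂, c x ≤ 0 := fun x hx => by
    have h1 : x ∉ p := fun h => Finset.mem_compl.1 (hT₂ hx) (hpT h)
    simpa [hp] using h1
  have hzero : ∀ x, x ∉ T₁ ∪ T₂ → c x = 0 := by
    intro x hx
    rw [Finset.mem_union, not_or] at hx
    have h1 : x ∉ p := fun h => hx.1 (hpT h)
    have h2 : x ∉ n := fun h => hx.2 (hnT h)
    simp only [hp, hn, Finset.mem_filter, Finset.mem_univ, true_and, not_lt] at h1 h2
    exact le_antisymm h1 h2
  have hiT : i ∈ T₁ := by rw [hT₁e]; simp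
  have hjT : j ∈ T₁ := by rw [hT₁e]; simp
  have hkT : k ∈ T₂ := by rw [hT₂e]; simp
  have hlT : l ∈ T₂ := by rw [hT₂e]; simp
  have hsum : ∑ x, c x • ((b x : EuclideanSpace ℝ (Fin d)) - g) =
      (c i • ((b i : EuclideanSpace ℝ (Fin d)) - g) + c j • ((b j : EuclideanSpace ℝ (Fin d)) - g)) -
        ((-c k) • ((b k : EuclideanSpace ℝ (Fin d)) - g) +
          (-c l) • ((b l : EuclideanSpace ℝ (Fin d)) - g)) := by
    rw [← Finset.sum_subset (Finset.subset_univ (T₁ ∪ T₂))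
      (fun x _ hx => by rw [hzero x hx, zero_smul]),
      Finset.sum_union (Finset.disjoint_left.2 fun x hx hx' => hdisj x hx x hx' rfl), hT₁e, hT₂e,
      Finset.sum_pair hij, Finset.sum_pair hkl]
    module
  have hpos' : 0 < c i + c j + -c k + -c l := by
    have h1 := hnonneg i hiT
    have h2 := hnonneg j hjT
    have h3 := hnonpos k hkT
    have h4 := hnonpos l hlT
    by_contra hcon
    apply hc
    ext x
    by_cases hx : x ∈ T₁ ∪ T₂
    · rw [hT₁e, hT₂e] at hx
      simp only [Finset.mem_union, Finset.mem_insert, Finset.mem_singleton] at hx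
      rcases hx with (rfl | rfl) | (rfl | rfl) <;> simp only [Pi.zero_apply] <;> linarith
    · exact hzero x hx
  have hik := hdisj i hiT k hkT
  have hil := hdisj i hiT l hlT
  have hjk := hdisj j hjT k hkT
  have hjl := hdisj j hjT l hlT
  rw [hsum] at hcw
  have heq := inter_eq_of_crossing hg (hb i) (hb j) (hb k) (hb l) (hinj.ne hik) (hinj.ne hil)
    (hinj.ne hjk) (hinj.ne hjl) (hne i j hij) (hne k l hkl) (hnonneg i hiT) (hnonneg j hjT)
    (neg_nonneg.2 (hnonpos k hkT)) (neg_nonneg.2 (hnonpos l hlT)) hpos' hcw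
  refine ⟨i, j, k, l, by simp [hij, hik, hil, hjk, hjl, hkl], ?_⟩
  exact parallelogram_of_inter_eq hdim (hb i) (hb j) (hb k) (hb l)
    (by simp [hinj.eq_iff, hij, hik, hil, hjk, hjl, hkl]) heq (hne i j hij)

/-- A centrally symmetric dual 3-cell with a triangle has no vertices besides those of the triangle
and the opposite ones: the direction of any other vertex would lie, up to sign, in a cone over two
vertices of the triangle and, modulo the third one, give a parallelogram that has an edge of the
triangle as a diagonal. -/
theorem mem_of_central (hdim : dim G + 3 = d) {s t : P.lattice}
    (hst : tile P s ∩ tile P t = G) {a b c e : P.lattice}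
    (ha : a ∈ dualCell P G) (hb : b ∈ dualCell P G) (hc : c ∈ dualCell P G)
    (he : e ∈ dualCell P G) (hab : Adjacent P a b) (hbc : Adjacent P b c) (hac : Adjacent P a c) :
    e = a ∨ e = b ∨ e = c ∨ e = s + t - a ∨ e = s + t - b ∨ e = s + t - c := by
  by_contra hcon
  simp only [not_or] at hcon
  obtain ⟨hea, heb, hec, hea', heb', hec'⟩ := hcon
  have hGne := ha.nonempty
  obtain ⟨g, hg⟩ := IsTilingFace.exists_isRelInterior ⟨a, ha⟩
  have hanti : ∀ {x y}, x ∈ dualCell P G → y ≠ s + t - x → tile P x ∩ tile P y ≠ G := by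
    intro x y hx hy h
    have h1 := inter_reflect_eq hst hGne hx
    rw [Set.inter_comm] at h1
    exact hy (eq_of_inter_eq (h.trans h1.symm) (by rwa [h]))
  have hadj_ne : ∀ {x y}, Adjacent P x y → tile P x ∩ tile P y ≠ G := by
    intro x y h h'
    rw [Adjacent, h'] at h
    omega
  have hopp : ∀ {x y}, x ∈ dualCell P G → Adjacent P x y → y ≠ s + t - x := by
    rintro x y hx h rfl
    have h1 := inter_reflect_eq hst hGne hx
    rw [Set.inter_comm] at h1
    exact hadj_ne h h1
  have hadj_irrefl : ∀ {x y}, Adjacent P x y → x ≠ y := by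
    rintro x y h rfl
    rw [Adjacent, Set.inter_self, dim_tile] at h
    omega
  have hrefl_vec : ∀ {x}, x ∈ dualCell P G →
      (((s + t - x : P.lattice) : EuclideanSpace ℝ (Fin d)) - g) +
        ((x : EuclideanSpace ℝ (Fin d)) - g) ∈ vectorSpan ℝ G := by
    intro x hx
    have h1 := inter_reflect_eq hst hGne hx
    have h2 : middle (s + t - x) x ∈ G := by
      rw [← h1]; exact middle_mem (by rwa [h1])
    have h3 := Submodule.smul_mem _ (2 : ℝ) (sub_mem_vectorSpan h2 hg.1)
    convert h3 using 1
    rw [middle]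
    module
  -- for either sign of the coefficient of `x`, a nonnegative multiple of `x` or its opposite
  have hsign : ∀ x ∈ dualCell P G, ∀ r : ℝ, ∃ y ∈ dualCell P G, (y = x ∨ y = s + t - x) ∧
      r • ((x : EuclideanSpace ℝ (Fin d)) - g) + |r| • ((y : EuclideanSpace ℝ (Fin d)) - g) ∈
        vectorSpan ℝ G := by
    intro x hx r
    rcases le_total 0 r with hr | hr
    · refine ⟨_, reflect_mem_dualCell hst hx, Or.inr rfl, ?_⟩
      rw [abs_of_nonneg hr, ← smul_add, add_comm]
      exact Submodule.smul_mem _ _ (hrefl_vec hx)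
    · refine ⟨x, hx, Or.inl rfl, ?_⟩
      rw [abs_of_nonpos hr, ← add_smul, add_neg_cancel, zero_smul]
      exact Submodule.zero_mem _
  -- two vertices of the triangle whose coefficients have the same sign span a crossing diagonal
  have hcross : ∀ {x y z : P.lattice}, x ∈ dualCell P G → y ∈ dualCell P G → z ∈ dualCell P G →
      Adjacent P x y → Adjacent P x z → Adjacent P y z → e ≠ x → e ≠ y → e ≠ z →
      e ≠ s + t - x → e ≠ s + t - y → e ≠ s + t - z →
      ∀ p q r o : ℝ, 0 ≤ p → 0 ≤ q → 0 < |p| + |q| + |r| + |o| →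
      p • ((x : EuclideanSpace ℝ (Fin d)) - g) + q • ((y : EuclideanSpace ℝ (Fin d)) - g) +
        r • ((z : EuclideanSpace ℝ (Fin d)) - g) + o • ((e : EuclideanSpace ℝ (Fin d)) - g) ∈
          vectorSpan ℝ G → False := by
    intro x y z hx hy hz hxy hxz hyz hex hey hez hex' hey' hez' p q r o hp hq hpos hmem
    obtain ⟨z', hz', hzz', hr⟩ := hsign z hz r
    obtain ⟨e', he', hee', ho⟩ := hsign e he o
    rw [abs_of_nonneg hp, abs_of_nonneg hq] at hpos
    have hswap : ∀ {v w : P.lattice}, v = s + t - w → w = s + t - v := by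
      rintro v w rfl; abel
    have hxz' : x ≠ z' := by
      rcases hzz' with rfl | rfl
      · exact hadj_irrefl hxz
      · exact hopp hz hxz.symm
    have hyz' : y ≠ z' := by
      rcases hzz' with rfl | rfl
      · exact hadj_irrefl hyz
      · exact hopp hz hyz.symm
    have hxe' : x ≠ e' := by
      rcases hee' with rfl | rfl
      · exact hex.symm
      · exact fun h => hex' (hswap h)
    have hye' : y ≠ e' := by
      rcases hee' with rfl | rfl
      · exact hey.symm
      · exact fun h => hey' (hswap h)
    have hze' : z' ≠ e' ∧ e' ≠ s + t - z' := by
      rcases hzz' with rfl | rfl <;> rcases hee' with rfl | rfl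
      · exact ⟨hez.symm, hez'⟩
      · exact ⟨fun h => hez' (hswap h), fun h => hez (sub_right_injective h)⟩
      · exact ⟨hez'.symm, by rwa [sub_sub_cancel]⟩
      · exact ⟨fun h => hez (sub_right_injective h).symm,
          fun h => hez' (sub_right_injective h)⟩
    have heq := inter_eq_of_crossing hg hx hy hz' he' hxz' hxe' hyz' hye' (hadj_ne hxy)
      (hanti hz' hze'.2) hp hq (abs_nonneg r) (abs_nonneg o) hpos (by
        have := Submodule.sub_mem _ (Submodule.sub_mem _ hmem hr) ho
        convert this using 1
        abel)
    have := parallelogram_of_inter_eq hdim hx hy hz' he'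
      (by simp [hadj_irrefl hxy, hxz', hxe', hyz', hye', hze'.1]) heq (hadj_ne hxy)
    exact this.2.2.1 hxy
  obtain ⟨r, hr, hrw⟩ := exists_dependency_mod hdim
    ![(a : EuclideanSpace ℝ (Fin d)) - g, (b : EuclideanSpace ℝ (Fin d)) - g,
      (c : EuclideanSpace ℝ (Fin d)) - g, (e : EuclideanSpace ℝ (Fin d)) - g] (by simp)
  simp only [Fin.sum_univ_four, Matrix.cons_val] at hrw
  have hrpos : 0 < |r 0| + |r 1| + |r 2| + |r 3| := by
    obtain ⟨i, hi⟩ := Function.ne_iff.1 hr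
    have hi' : 0 < |r i| := abs_pos.2 hi
    have h0 := abs_nonneg (r 0)
    have h1 := abs_nonneg (r 1)
    have h2 := abs_nonneg (r 2)
    have h3 := abs_nonneg (r 3)
    fin_cases i <;> simp only [Fin.zero_eta, Fin.mk_one, Fin.reduceFinMk] at hi' <;> linarith
  have hrn := Submodule.neg_mem _ hrw
  have hcase : (0 ≤ r 0 ∧ 0 ≤ r 1) ∨ (0 ≤ r 0 ∧ 0 ≤ r 2) ∨ (0 ≤ r 1 ∧ 0 ≤ r 2) ∨
      (r 0 ≤ 0 ∧ r 1 ≤ 0) ∨ (r 0 ≤ 0 ∧ r 2 ≤ 0) ∨ (r 1 ≤ 0 ∧ r 2 ≤ 0) := by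
    rcases le_total 0 (r 0) with h0 | h0 <;> rcases le_total 0 (r 1) with h1 | h1 <;>
      rcases le_total 0 (r 2) with h2 | h2 <;> tauto
  rcases hcase with ⟨h, h'⟩ | ⟨h, h'⟩ | ⟨h, h'⟩ | ⟨h, h'⟩ | ⟨h, h'⟩ | ⟨h, h'⟩
  · exact hcross ha hb hc hab hac hbc hea heb hec hea' heb' hec' _ _ (r 2) (r 3) h h' hrpos hrw
  · exact hcross ha hc hb hac hab hbc.symm hea hec heb hea' hec' heb' _ _ (r 1) (r 3) h h'
      (by linarith) (by convert hrw using 1; abel)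
  · exact hcross hb hc ha hbc hab.symm hac.symm heb hec hea heb' hec' hea' _ _ (r 0) (r 3) h h'
      (by linarith) (by convert hrw using 1; abel)
  · exact hcross ha hb hc hab hac hbc hea heb hec hea' heb' hec' (-r 0) (-r 1) (-r 2) (-r 3)
      (by linarith) (by linarith) (by simpa only [abs_neg] using hrpos)
      (by convert hrn using 1; module)
  · exact hcross ha hc hb hac hab hbc.symm hea hec heb hea' hec' heb' (-r 0) (-r 2) (-r 1) (-r 3)
      (by linarith) (by linarith) (by simp only [abs_neg]; linarith)
      (by convert hrn using 1; module)
  · exact hcross hb hc ha hbc hab.symm hac.symm heb hec hea heb' hec' hea' (-r 1) (-r 2) (-r 0)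
      (-r 3) (by linarith) (by linarith) (by simp only [abs_neg]; linarith)
      (by convert hrn using 1; module)

end ThreeCells

end Venkov

/-! ### Combinatorial types of dual 3-cells -/

namespace Venkov

section Combinatorics

variable {α : Type*} [AddCommGroup α]

/-- The combinatorial properties of a dual 3-cell that the classification uses: `D` is the set of
vertices, `T` the set of 2-cells, and `A` the adjacency relation. -/
structure IsThreeCell (D : Set α) (T : Set (Set α)) (A : α → α → Prop) : Prop where
  symm : ∀ {a b}, A a b → A b a
  double_ne : ∀ {a : α}, a + a = 0 → a = 0
  subset : ∀ {X}, X ∈ T → X ⊆ D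
  cases : ∀ {X}, X ∈ T →
    (∃ a b c, [a, b, c].Nodup ∧ X = {a, b, c} ∧ A a b ∧ A b c ∧ A a c) ∨
    (∃ a b c e, [a, b, c, e].Nodup ∧ X = {a, b, c, e} ∧ a + c = b + e ∧
      A a b ∧ A b c ∧ A c e ∧ A e a ∧ ¬ A a c ∧ ¬ A b e)
  two_cells : ∀ {a b}, a ∈ D → b ∈ D → A a b →
    ∃ X ∈ T, ∃ Y ∈ T, X ≠ Y ∧ a ∈ X ∧ b ∈ X ∧ a ∈ Y ∧ b ∈ Y
  eq_of_three : ∀ {X Y}, X ∈ T → Y ∈ T → ∀ {a b c}, a ≠ b → a ≠ c → b ≠ c → a ∈ X → b ∈ X →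
    c ∈ X → a ∈ Y → b ∈ Y → c ∈ Y → X = Y
  eq_of_not_adj : ∀ {X Y}, X ∈ T → Y ∈ T → ∀ {a b}, a ≠ b → a ∈ X → b ∈ X → a ∈ Y → b ∈ Y →
    ¬ A a b → X = Y

/-- `s, s'` and `u, u'` are the diagonals of a dual parallelogram. -/
def IsParallelogram (T : Set (Set α)) (A : α → α → Prop) (s s' u u' : α) : Prop :=
  [s, s', u, u'].Nodup ∧ {s, s', u, u'} ∈ T ∧ s + s' = u + u' ∧ ¬ A s s' ∧ ¬ A u u'

variable {D : Set α} {T : Set (Set α)} {A : α → α → Prop}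

theorem IsParallelogram.swap (hA : ∀ {a b}, A a b → A b a) {s s' u u' : α}
    (h : IsParallelogram T A s s' u u') : IsParallelogram T A s' s u u' := by
  obtain ⟨h1, h2, h3, h4, h5⟩ := h
  refine ⟨?_, ?_, by rw [add_comm, h3], fun h => h4 (hA h), h5⟩
  · simp at h1 ⊢
    grind
  · convert h2 using 1
    ext; simp; tauto

theorem IsParallelogram.exchange {s s' u u' : α}
    (h : IsParallelogram T A s s' u u') : IsParallelogram T A u u' s s' := by
  obtain ⟨h1, h2, h3, h4, h5⟩ := h
  refine ⟨?_, ?_, h3.symm, h5, h4⟩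
  · simp at h1 ⊢
    grind
  · convert h2 using 1
    ext; simp; tauto

theorem IsParallelogram.exists_eq (hA : ∀ {a b}, A a b → A b a) {s s' u u' v : α}
    (h : IsParallelogram T A s s' u u') (hv : v ∈ ({s, s', u, u'} : Set α)) :
    ∃ c b e, IsParallelogram T A v c b e ∧ ({s, s', u, u'} : Set α) = {v, c, b, e} := by
  rcases hv with rfl | rfl | rfl | rfl
  · exact ⟨_, _, _, h, rfl⟩
  · exact ⟨_, _, _, h.swap hA, by ext; simp; tauto⟩
  · exact ⟨_, _, _, h.exchange, by ext; simp; tauto⟩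
  · exact ⟨_, _, _, h.exchange.swap hA, by ext; simp; tauto⟩

/-- In a parallelogram with side `a b` and further vertices `x`, `y`, the diagonals are `a y`, `b x`
or `a x`, `b y`. -/
theorem IsParallelogram.of_side (hA : ∀ {a b}, A a b → A b a) {s s' u u' a b x y : α}
    (h : IsParallelogram T A s s' u u') (hset : ({s, s', u, u'} : Set α) = {a, b, x, y})
    (hnd : [a, b, x, y].Nodup) (hab : A a b) :
    IsParallelogram T A a y b x ∨ IsParallelogram T A a x b y := by
  obtain ⟨c, p, q, hP, hset'⟩ := h.exists_eq hA (v := a) (by rw [hset]; simp)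
  have hset2 : ({a, c, p, q} : Set α) = {a, b, x, y} := hset'.symm.trans hset
  simp only [List.nodup_cons, List.mem_cons, List.not_mem_nil, or_false, not_or,
    not_false_eq_true, List.nodup_nil, and_true] at hnd
  obtain ⟨⟨hab', hax, hay⟩, ⟨hbx, hby⟩, hxy⟩ := hnd
  have hbc : b ≠ c := fun h => hP.2.2.2.1 (h ▸ hab)
  have hm : ∀ z ∈ ({a, b, x, y} : Set α), z = a ∨ z = c ∨ z = p ∨ z = q := fun z hz => by
    rw [← hset2] at hz; exact hz
  have hb := hm b (by simp)
  have hx := hm x (by simp)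
  have hy := hm y (by simp)
  have hP' := (hP.exchange.swap hA).exchange
  rcases hb with h | h | rfl | rfl
  · exact absurd h.symm hab'
  · exact absurd h hbc
  · rcases hx with h | rfl | h | rfl
    · exact absurd h.symm hax
    · rcases hy with h | h | h | rfl
      · exact absurd h.symm hay
      · exact absurd h.symm hxy
      · exact absurd h.symm hby
      · exact Or.inr hP
    · exact absurd h.symm hbx
    · rcases hy with h | rfl | h | h
      · exact absurd h.symm hay
      · exact Or.inl hP
      · exact absurd h.symm hby
      · exact absurd h.symm hxy
  · rcases hx with h | rfl | rfl | h
    · exact absurd h.symm hax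
    · rcases hy with h | h | rfl | h
      · exact absurd h.symm hay
      · exact absurd h.symm hxy
      · exact Or.inr hP'
      · exact absurd h.symm hby
    · rcases hy with h | rfl | h | h
      · exact absurd h.symm hay
      · exact Or.inl hP'
      · exact absurd h.symm hxy
      · exact absurd h.symm hby
    · exact absurd h.symm hbx

namespace IsThreeCell

theorem exists_three (h : IsThreeCell D T A) {X : Set α} (hX : X ∈ T) :
    ∃ a b c, a ≠ b ∧ a ≠ c ∧ b ≠ c ∧ a ∈ X ∧ b ∈ X ∧ c ∈ X := by
  rcases h.cases hX with ⟨a, b, c, hnd, rfl, -⟩ | ⟨a, b, c, e, hnd, rfl, -⟩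
  · simp only [List.nodup_cons, List.mem_cons, List.not_mem_nil, or_false, not_or,
      not_false_eq_true, List.nodup_nil, and_true] at hnd
    exact ⟨a, b, c, hnd.1.1, hnd.1.2, hnd.2, by simp, by simp, by simp⟩
  · simp only [List.nodup_cons, List.mem_cons, List.not_mem_nil, or_false, not_or,
      not_false_eq_true, List.nodup_nil, and_true] at hnd
    exact ⟨a, b, c, hnd.1.1, hnd.1.2.1, hnd.2.1.1, by simp, by simp, by simp⟩

/-- Across the edge `a b` of the 2-cell `X` lies another 2-cell, with a vertex outside `X`. -/
theorem exists_next (h : IsThreeCell D T A) {X : Set α} (hX : X ∈ T) {a b : α} (ha : a ∈ X)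
    (hb : b ∈ X) (hab : A a b) :
    ∃ Y ∈ T, Y ≠ X ∧ a ∈ Y ∧ b ∈ Y ∧ ∃ c ∈ Y, c ∉ X := by
  have key : ∀ Y ∈ T, Y ≠ X → a ∈ Y → b ∈ Y → ∃ c ∈ Y, c ∉ X := by
    intro Y hY hYX haY hbY
    by_contra hcon
    push Not at hcon
    obtain ⟨p, q, r, hpq, hpr, hqr, hp, hq, hr⟩ := h.exists_three hY
    exact hYX (h.eq_of_three hY hX hpq hpr hqr hp hq hr (hcon p hp) (hcon q hq) (hcon r hr))
  obtain ⟨Y, hY, Z, hZ, hYZ, haY, hbY, haZ, hbZ⟩ := 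
    h.two_cells (h.subset hX ha) (h.subset hX hb) hab
  by_cases hYX : Y = X
  · have hZX : Z ≠ X := fun hZX => hYZ (hYX.trans hZX.symm)
    exact ⟨Z, hZ, hZX, haZ, hbZ, key Z hZ hZX haZ hbZ⟩
  · exact ⟨Y, hY, hYX, haY, hbY, key Y hY hYX haY hbY⟩

theorem adj_of_parallelogram (h : IsThreeCell D T A) {s s' u u' : α}
    (hP : IsParallelogram T A s s' u u') : A s u := by
  obtain ⟨hnd, hX, -, h1, h2⟩ := hP
  simp only [List.nodup_cons, List.mem_cons, List.not_mem_nil, or_false, not_or,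
    not_false_eq_true, List.nodup_nil, and_true] at hnd
  obtain ⟨⟨hss', hsu, hsu'⟩, ⟨hs'u, hs'u'⟩, huu'⟩ := hnd
  rcases h.cases hX with ⟨a, b, c, hnd', hset, hab, hbc, hac⟩ |
    ⟨a, b, c, e, hnd', hset, -, hab, hbc, hce, hea, hac, hbe⟩
  · have hs : s ∈ ({a, b, c} : Set α) := by rw [← hset]; simp
    have hs' : s' ∈ ({a, b, c} : Set α) := by rw [← hset]; simp
    have := h.symm hab
    have := h.symm hbc
    have := h.symm hac
    rcases hs with rfl | rfl | rfl <;> rcases hs' with rfl | rfl | rfl <;> contradiction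
  · have hs : s ∈ ({a, b, c, e} : Set α) := by rw [← hset]; simp
    have hs' : s' ∈ ({a, b, c, e} : Set α) := by rw [← hset]; simp
    have hu : u ∈ ({a, b, c, e} : Set α) := by rw [← hset]; simp
    have := h.symm hab
    have := h.symm hbc
    have := h.symm hce
    have := h.symm hea
    rcases hs with rfl | rfl | rfl | rfl <;> rcases hs' with rfl | rfl | rfl | rfl <;>
      first
        | contradiction
        | (rcases hu with rfl | rfl | rfl | rfl <;> first | contradiction | assumption)

/-- Every five vertices contain a parallelogram. This is the case for the dual 3-cells that are not
centrally symmetric. -/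
def HasParallelograms (D : Set α) (T : Set (Set α)) (A : α → α → Prop) : Prop :=
  ∀ b : Fin 5 → α, Function.Injective b → (∀ i, b i ∈ D) →
    ∃ i j k l, [i, j, k, l].Nodup ∧ IsParallelogram T A (b i) (b j) (b k) (b l)

theorem exists_parallelogram_of_five (hK : HasParallelograms D T A) {p q r x y : α}
    (hnd : [p, q, r, x, y].Nodup) (hp : p ∈ D) (hq : q ∈ D) (hr : r ∈ D) (hx : x ∈ D)
    (hy : y ∈ D) :
    ∃ s s' u u', IsParallelogram T A s s' u u' ∧
      ({s, s', u, u'} : Set α) ⊆ {p, q, r, x, y} ∧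
      ∀ m ∈ ({p, q, r, x, y} : Set α), ∀ n ∈ ({p, q, r, x, y} : Set α), m ≠ n →
        m ∈ ({s, s', u, u'} : Set α) ∨ n ∈ ({s, s', u, u'} : Set α) := by
  classical
  have hnd' := hnd
  simp only [List.nodup_cons, List.mem_cons, List.not_mem_nil, or_false, not_or,
    not_false_eq_true, List.nodup_nil, and_true] at hnd'
  set b : Fin 5 → α := ![p, q, r, x, y]
  have hrange : ∀ m, m ∈ ({p, q, r, x, y} : Set α) ↔ ∃ i, b i = m := by
    intro m
    simp only [Set.mem_insert_iff, Set.mem_singleton_iff, b]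
    constructor
    · rintro (rfl | rfl | rfl | rfl | rfl)
      exacts [⟨0, rfl⟩, ⟨1, rfl⟩, ⟨2, rfl⟩, ⟨3, rfl⟩, ⟨4, rfl⟩]
    · rintro ⟨i, rfl⟩
      fin_cases i <;> simp
  have hinj : Function.Injective b := List.nodup_ofFn.1 (by simpa [b, List.ofFn_succ] using hnd)
  obtain ⟨i, j, k, l, hijkl, hP⟩ := hK b hinj (fun i => by fin_cases i <;> assumption)
  refine ⟨_, _, _, _, hP, ?_, ?_⟩
  · rintro m (rfl | rfl | rfl | rfl) <;> exact (hrange _).2 ⟨_, rfl⟩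
  · intro m hm n hn hmn
    obtain ⟨m, rfl⟩ := (hrange m).1 hm
    obtain ⟨n, rfl⟩ := (hrange n).1 hn
    have hmn' : m ≠ n := fun h => hmn (by rw [h])
    simp only [Set.mem_insert_iff, Set.mem_singleton_iff, hinj.eq_iff]
    have hcard : ({i, j, k, l} : Finset (Fin 5)).card = 4 := by
      have := List.toFinset_card_of_nodup hijkl
      simpa using this
    by_contra hcon
    have hsub : ({i, j, k, l} : Finset (Fin 5)) ⊆ {m, n}ᶜ := by
      intro z hz
      simp only [Finset.mem_insert, Finset.mem_singleton, Finset.mem_compl] at hz ⊢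
      rintro (rfl | rfl) <;> tauto
    have := Finset.card_le_card hsub
    rw [Finset.card_compl, Finset.card_pair hmn', hcard] at this
    simp at this

/-- A 2-cell is not properly contained in another one. -/
theorem eq_of_subset (h : IsThreeCell D T A) {X Y : Set α} (hX : X ∈ T) (hY : Y ∈ T)
    (hXY : X ⊆ Y) : X = Y := by
  obtain ⟨p, q, r, hpq, hpr, hqr, hp, hq, hr⟩ := h.exists_three hX
  exact h.eq_of_three hX hY hpq hpr hqr hp hq hr (hXY hp) (hXY hq) (hXY hr)

/-- A 2-cell inside a set of three elements is that set. -/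
theorem eq_triple (h : IsThreeCell D T A) {X : Set α} (hX : X ∈ T) {a b c : α}
    (hsub : X ⊆ {a, b, c}) : X = {a, b, c} := by
  obtain ⟨p, q, r, hpq, hpr, hqr, hp, hq, hr⟩ := h.exists_three hX
  refine hsub.antisymm ?_
  have hp' := hsub hp
  have hq' := hsub hq
  have hr' := hsub hr
  simp only [Set.mem_insert_iff, Set.mem_singleton_iff] at hp' hq' hr'
  rintro x (rfl | rfl | rfl) <;> grind

/-- Tetrahedron with vertices `a, b, c, e`. -/
def Tetra (D : Set α) (T : Set (Set α)) (a b c e : α) : Prop :=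
  [a, b, c, e].Nodup ∧ D = {a, b, c, e} ∧ T = {{a, b, c}, {a, b, e}, {a, c, e}, {b, c, e}}

/-- Pyramid with apex `s` and base `a, b, c, e`. -/
def Pyramid (D : Set α) (T : Set (Set α)) (s a b c e : α) : Prop :=
  [s, a, b, c, e].Nodup ∧ D = {s, a, b, c, e} ∧
  T = {{s, a, b}, {s, b, c}, {s, c, e}, {s, e, a}, {a, b, c, e}} ∧ a + c = b + e

/-- Octahedron with opposite vertices `a, a'`, `b, b'` and `c, c'`. -/
def Octahedron (D : Set α) (T : Set (Set α)) (a b c a' b' c' : α) : Prop :=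
  [a, b, c, a', b', c'].Nodup ∧ D = {a, b, c, a', b', c'} ∧
  T = {{a, b, c}, {a, b, c'}, {a, b', c}, {a, b', c'},
    {a', b, c}, {a', b, c'}, {a', b', c}, {a', b', c'}} ∧
  a + a' = b + b' ∧ b + b' = c + c'

/-- Prism with bases `a, b, c` and `a', b', c'`. -/
def Prism (D : Set α) (T : Set (Set α)) (a b c a' b' c' : α) : Prop :=
  [a, b, c, a', b', c'].Nodup ∧ D = {a, b, c, a', b', c'} ∧
  T = {{a, b, c}, {a', b', c'}, {a, b, b', a'}, {b, c, c', b'}, {c, a, a', c'}} ∧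
  a - a' = b - b' ∧ b - b' = c - c'

/-- A dual 3-cell without parallelograms and without central symmetry is a tetrahedron: it has at
most four vertices, since five would contain a parallelogram. -/
theorem tetra_of_triangle (h : IsThreeCell D T A) (hK : HasParallelograms D T A)
    (hno : ∀ s s' u u', ¬ IsParallelogram T A s s' u u') {a b c : α} (hnd : [a, b, c].Nodup)
    (hX : {a, b, c} ∈ T) (hab : A a b) (hac : A a c) (hbc : A b c) :
    ∃ e, Tetra D T a b c e := by
  simp only [List.nodup_cons, List.mem_cons, List.not_mem_nil, or_false, not_or,
    not_false_eq_true, List.nodup_nil, and_true] at hnd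
  obtain ⟨⟨hab', hac'⟩, hbc'⟩ := hnd
  have haD := h.subset hX (show a ∈ _ by simp)
  have hbD := h.subset hX (show b ∈ _ by simp)
  have hcD := h.subset hX (show c ∈ _ by simp)
  obtain ⟨Y, hY, hYX, haY, hbY, e, heY, heX⟩ := h.exists_next hX (by simp) (by simp) hab
  have heD := h.subset hY heY
  simp only [Set.mem_insert_iff, Set.mem_singleton_iff, not_or] at heX
  obtain ⟨hea, heb, hec⟩ := heX
  have hD : D = {a, b, c, e} := by
    refine Set.Subset.antisymm (fun x hx => ?_) ?_
    · by_contra hcon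
      simp only [Set.mem_insert_iff, Set.mem_singleton_iff, not_or] at hcon
      obtain ⟨s, s', u, u', hP, -⟩ := exists_parallelogram_of_five hK (p := a) (q := b) (r := c)
        (x := e) (y := x) (by simp; grind) haD hbD hcD heD hx
      exact hno _ _ _ _ hP
    · rintro x (rfl | rfl | rfl | rfl) <;> assumption
  have hall : ∀ Z ∈ T, ¬ (a ∈ Z ∧ b ∈ Z ∧ c ∈ Z ∧ e ∈ Z) := by
    rintro Z hZ ⟨ha, hb, hc, he⟩
    rcases h.cases hZ with ⟨a', b', c', -, rfl, -⟩ | ⟨a', b', c', e', hnd, rfl, hs, -, -, -, -, h1, h2⟩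
    · simp only [Set.mem_insert_iff, Set.mem_singleton_iff] at ha hb hc he
      grind
    · refine hno a' c' b' e' ⟨?_, ?_, hs, h1, h2⟩
      · simp at hnd ⊢
        grind
      · convert hZ using 1
        ext; simp; tauto
  have htri : ∀ Z ∈ T, ∀ {p q r m}, ({p, q, r, m} : Set α) = {a, b, c, e} → m ∉ Z →
      Z = {p, q, r} := by
    intro Z hZ p q r m hset hm
    have hZD := h.subset hZ
    rw [hD, ← hset] at hZD
    refine h.eq_triple hZ fun x hx => ?_
    have := hZD hx
    simp only [Set.mem_insert_iff, Set.mem_singleton_iff] at this ⊢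
    rcases this with rfl | rfl | rfl | rfl <;> tauto
  have hset₁ : ({a, b, e, c} : Set α) = {a, b, c, e} := by ext; simp; tauto
  have hset₂ : ({a, c, e, b} : Set α) = {a, b, c, e} := by ext; simp; tauto
  have hset₃ : ({b, c, e, a} : Set α) = {a, b, c, e} := by ext; simp; tauto
  have hX₂ : ({a, c, b} : Set α) ∈ T := by convert hX using 1; ext; simp; tauto
  have hX₃ : ({b, c, a} : Set α) ∈ T := by convert hX using 1; ext; simp; tauto
  have hnext : ∀ {p q r : α}, ({p, q, e, r} : Set α) = {a, b, c, e} → {p, q, r} ∈ T → A p q →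
      ({p, q, e} : Set α) ∈ T := by
    intro p q r hset hpqr hpq
    obtain ⟨Z, hZ, -, hpZ, hqZ, x, hxZ, hx⟩ := h.exists_next hpqr (by simp) (by simp) hpq
    have hxD := h.subset hZ hxZ
    rw [hD, ← hset] at hxD
    simp only [Set.mem_insert_iff, Set.mem_singleton_iff, not_or] at hx hxD
    have hxe : x = e := by tauto
    subst hxe
    rw [← htri Z hZ hset]
    · exact hZ
    · intro hr
      have hsub : ∀ y ∈ ({p, q, x, r} : Set α), y ∈ Z := by
        rintro y (rfl | rfl | rfl | rfl) <;> assumption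
      rw [hset] at hsub
      exact hall Z hZ ⟨hsub _ (by simp), hsub _ (by simp), hsub _ (by simp), hsub _ (by simp)⟩
  refine ⟨e, by simp; grind, hD, Set.Subset.antisymm (fun Z hZ => ?_) ?_⟩
  · simp only [Set.mem_insert_iff, Set.mem_singleton_iff]
    by_cases he : e ∈ Z
    · by_cases hc : c ∈ Z
      · by_cases hb : b ∈ Z
        · have ha : a ∉ Z := fun ha => hall Z hZ ⟨ha, hb, hc, he⟩
          exact Or.inr (Or.inr (Or.inr (htri Z hZ hset₃ ha)))
        · exact Or.inr (Or.inr (Or.inl (htri Z hZ hset₂ hb)))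
      · exact Or.inr (Or.inl (htri Z hZ hset₁ hc))
    · exact Or.inl (htri Z hZ rfl he)
  · rintro Z (rfl | rfl | rfl | rfl)
    · exact hX
    · exact hnext hset₁ hX hab
    · exact hnext hset₂ hX₂ hac
    · exact hnext hset₃ hX₃ hbc

/-- A dual 3-cell with a parallelogram and only one further vertex is a pyramid. -/
theorem pyramid_of_parallelogram (h : IsThreeCell D T A) {a b c e s : α}
    (hP : IsParallelogram T A a c b e) (hsQ : s ∉ ({a, c, b, e} : Set α))
    (hD : D ⊆ insert s {a, c, b, e}) (hsD : s ∈ D) : Pyramid D T s a b c e := by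
  have hab := h.adj_of_parallelogram hP
  have hea := h.symm (h.adj_of_parallelogram (hP.exchange.swap h.symm).exchange)
  have hbc := h.symm (h.adj_of_parallelogram (hP.swap h.symm))
  have hce := h.adj_of_parallelogram ((hP.swap h.symm).exchange.swap h.symm).exchange
  obtain ⟨hnd, hQ, hsum, hac, hbe⟩ := hP
  simp only [List.nodup_cons, List.mem_cons, List.not_mem_nil, or_false, not_or,
    not_false_eq_true, List.nodup_nil, and_true] at hnd
  obtain ⟨⟨hac', hab', hae'⟩, ⟨hcb', hce'⟩, hbe'⟩ := hnd
  have hs : ∀ Z ∈ T, Z ≠ {a, c, b, e} → s ∈ Z := by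
    intro Z hZ hne
    by_contra hsZ
    refine hne (h.eq_of_subset hZ hQ fun x hx => ?_)
    rcases hD (h.subset hZ hx) with rfl | hx'
    · contradiction
    · exact hx'
  have hyz : ∀ Z ∈ T, Z ≠ {a, c, b, e} → ∀ {y z}, y ∈ ({a, c, b, e} : Set α) →
      z ∈ ({a, c, b, e} : Set α) → y ≠ z → y ∈ Z → z ∈ Z → Z = {s, y, z} ∧ A y z := by
    intro Z hZ hne y z hyQ hzQ hyz hyZ hzZ
    refine ⟨h.eq_triple hZ fun x hx => ?_, ?_⟩
    · by_contra hcon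
      simp only [Set.mem_insert_iff, Set.mem_singleton_iff, not_or] at hcon
      rcases hD (h.subset hZ hx) with hxs | hxQ
      · exact hcon.1 hxs
      · exact hne (h.eq_of_three hZ hQ hyz (Ne.symm hcon.2.1) (Ne.symm hcon.2.2) hyZ hzZ hx
          hyQ hzQ hxQ)
    · by_contra hcon
      exact hne (h.eq_of_not_adj hZ hQ hyz hyZ hzZ hyQ hzQ hcon)
  have hin : ∀ {y z}, y ∈ ({a, c, b, e} : Set α) → z ∈ ({a, c, b, e} : Set α) → y ≠ z → A y z →
      ({s, y, z} : Set α) ∈ T := by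
    intro y z hyQ hzQ hyz' hA
    obtain ⟨Y, hY, hYQ, hyY, hzY, -⟩ := h.exists_next hQ hyQ hzQ hA
    rw [← (hyz Y hY hYQ hyQ hzQ hyz' hyY hzY).1]
    exact hY
  have hQ' : ({a, b, c, e} : Set α) = {a, c, b, e} := by ext; simp; tauto
  refine ⟨?_, Set.Subset.antisymm ?_ ?_, Set.Subset.antisymm (fun Z hZ => ?_) ?_, hsum⟩
  · simp only [Set.mem_insert_iff, Set.mem_singleton_iff, not_or] at hsQ
    simp; grind
  · rw [hQ']; exact hD
  · rw [hQ']
    exact Set.insert_subset hsD (h.subset hQ)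
  · by_cases hZQ : Z = {a, c, b, e}
    · rw [hQ', hZQ]; simp
    obtain ⟨y, z, hyz', hyZ, hzZ, hys, hzs⟩ : ∃ y z, y ≠ z ∧ y ∈ Z ∧ z ∈ Z ∧ y ≠ s ∧ z ≠ s := by
      obtain ⟨p, q, r, hpq, hpr, hqr, hp, hq, hr⟩ := h.exists_three hZ
      by_cases hps : p = s
      · exact ⟨q, r, hqr, hq, hr, fun h => hpq (hps.trans h.symm), fun h => hpr (hps.trans h.symm)⟩
      · by_cases hqs : q = s
        · exact ⟨p, r, hpr, hp, hr, hps, fun h => hqr (hqs.trans h.symm)⟩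
        · exact ⟨p, q, hpq, hp, hq, hps, hqs⟩
    have hyQ := (hD (h.subset hZ hyZ)).resolve_left hys
    have hzQ := (hD (h.subset hZ hzZ)).resolve_left hzs
    obtain ⟨hZe, hA⟩ := hyz Z hZ hZQ hyQ hzQ hyz' hyZ hzZ
    have hca : ¬ A c a := fun h' => hac (h.symm h')
    have heb : ¬ A e b := fun h' => hbe (h.symm h')
    have hcomm : ∀ y z : α, ({s, y, z} : Set α) = {s, z, y} := fun y z => by
      rw [Set.pair_comm]
    rw [hZe]
    rcases hyQ with rfl | rfl | rfl | rfl <;> rcases hzQ with rfl | rfl | rfl | rfl <;>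
      first
        | contradiction
        | (simp; done)
        | (rw [hcomm y z]; simp)
  · rintro Z (rfl | rfl | rfl | rfl | rfl)
    · exact hin (by simp) (by simp) hab' hab
    · exact hin (by simp) (by simp) (Ne.symm hcb') hbc
    · exact hin (by simp) (by simp) hce' hce
    · exact hin (by simp) (by simp) (Ne.symm hae') hea
    · rw [hQ']; exact hQ

/-- Two vertices `x, y` outside a parallelogram with diagonal `p q` and a third vertex `z` lie on
another parallelogram, whose fourth vertex is `p` or `q`. -/
theorem exists_parallelogram_through (h : IsThreeCell D T A) (hK : HasParallelograms D T A)
    {p q r m x y z : α} (hP : IsParallelogram T A p q r m) (hx : x ∈ D) (hy : y ∈ D) (hz : z ∈ D)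
    (hxy : x ≠ y) (hxQ : x ∉ ({p, q, r, m} : Set α)) (hyQ : y ∉ ({p, q, r, m} : Set α))
    (hzp : z ≠ p) (hzq : z ≠ q) (hzx : z ≠ x) (hzy : z ≠ y) :
    ∃ s s' u u', IsParallelogram T A s s' u u' ∧ (({s, s', u, u'} : Set α) = {p, x, y, z} ∨
      ({s, s', u, u'} : Set α) = {q, x, y, z}) := by
  obtain ⟨hnd, hQ, -, hpq, -⟩ := hP
  simp only [List.nodup_cons, List.mem_cons, List.not_mem_nil, or_false, not_or,
    not_false_eq_true, List.nodup_nil, and_true] at hnd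
  have hmx := hxQ
  have hmy := hyQ
  simp only [Set.mem_insert_iff, Set.mem_singleton_iff, not_or] at hmx hmy
  obtain ⟨s, s', u, u', hW, hsub, hmiss⟩ := exists_parallelogram_of_five hK (p := p) (q := q)
    (r := x) (x := y) (y := z) (by simp; grind) (h.subset hQ (by simp)) (h.subset hQ (by simp))
    hx hy hz
  refine ⟨s, s', u, u', hW, ?_⟩
  have hWT := hW.2.1
  generalize ({s, s', u, u'} : Set α) = W at hsub hmiss hWT
  -- a diagonal determines its parallelogram
  have hnot : ¬ (p ∈ W ∧ q ∈ W) := by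
    rintro ⟨hp, hq⟩
    have hWQ := h.eq_of_not_adj hWT hQ hnd.1.1 hp hq (by simp) (by simp) hpq
    rcases hmiss x (by simp) y (by simp) hxy with hm | hm
    · rw [hWQ] at hm; exact hxQ hm
    · rw [hWQ] at hm; exact hyQ hm
  have hmem : ∀ w ∈ ({x, y, z} : Set α), w ∈ W := by
    intro w hw
    by_contra hwW
    have hwm : w ∈ ({p, q, x, y, z} : Set α) := by
      rcases hw with rfl | rfl | rfl <;> simp
    have hwp : w ≠ p := by rcases hw with rfl | rfl | rfl <;> tauto
    have hwq : w ≠ q := by rcases hw with rfl | rfl | rfl <;> tauto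
    exact hnot ⟨(hmiss w hwm p (by simp) hwp).resolve_left hwW,
      (hmiss w hwm q (by simp) hwq).resolve_left hwW⟩
  have hx' := hmem x (by simp)
  have hy' := hmem y (by simp)
  have hz' := hmem z (by simp)
  rcases hmiss p (by simp) q (by simp) hnd.1.1 with hp | hq
  · refine Or.inl (Set.Subset.antisymm (fun w hw => ?_) ?_)
    · rcases hsub hw with rfl | rfl | rfl | rfl | rfl
      · simp
      · exact absurd ⟨hp, hw⟩ hnot
      all_goals simp
    · rintro w (rfl | rfl | rfl | rfl) <;> assumption
  · refine Or.inr (Set.Subset.antisymm (fun w hw => ?_) ?_)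
    · rcases hsub hw with rfl | rfl | rfl | rfl | rfl
      · exact absurd ⟨hw, hq⟩ hnot
      all_goals simp
    · rintro w (rfl | rfl | rfl | rfl) <;> assumption

/-- A dual 3-cell without central symmetry has at most two vertices outside a parallelogram: three
such vertices would lie on two parallelograms, which contain an end of one diagonal and an end of
the other. -/
theorem eq_or_eq_of_parallelogram (h : IsThreeCell D T A) (hK : HasParallelograms D T A)
    {a b c e x y z : α} (hP : IsParallelogram T A a c b e) (hx : x ∈ D) (hy : y ∈ D) (hz : z ∈ D)
    (hxy : x ≠ y) (hxQ : x ∉ ({a, c, b, e} : Set α)) (hyQ : y ∉ ({a, c, b, e} : Set α))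
    (hzQ : z ∉ ({a, c, b, e} : Set α)) : z = x ∨ z = y := by
  by_contra hcon
  rw [not_or] at hcon
  obtain ⟨hzx, hzy⟩ := hcon
  have hset : ({a, c, b, e} : Set α) = {b, e, a, c} := by ext; simp; tauto
  have hnd := hP.1
  have hxQ' := hxQ
  have hyQ' := hyQ
  have hzQ' := hzQ
  simp only [Set.mem_insert_iff, Set.mem_singleton_iff, not_or] at hxQ' hyQ' hzQ'
  simp only [List.nodup_cons, List.mem_cons, List.not_mem_nil, or_false, not_or,
    not_false_eq_true, List.nodup_nil, and_true] at hnd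
  obtain ⟨s, s', u, u', hW, hWs⟩ := h.exists_parallelogram_through hK hP hx hy hz hxy hxQ hyQ
    hzQ'.1 hzQ'.2.1 hzx hzy
  rw [hset] at hxQ hyQ
  obtain ⟨r, r', v, v', hV, hVs⟩ := h.exists_parallelogram_through hK hP.exchange hx hy hz hxy hxQ
    hyQ hzQ'.2.2.1 hzQ'.2.2.2 hzx hzy
  have hWV := fun h1 h2 h3 h4 h5 h6 => h.eq_of_three hW.2.1 hV.2.1 hxy (Ne.symm hzx) (Ne.symm hzy)
    h1 h2 h3 h4 h5 h6
  have hkey : ∀ p q : α, p ≠ q → x ≠ p → y ≠ p → z ≠ p →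
      ({p, x, y, z} : Set α) ≠ {q, x, y, z} := by
    intro p q hpq hxp hyp hzp heq
    have hp : p ∈ ({q, x, y, z} : Set α) := by rw [← heq]; simp
    rcases hp with h | h | h | h
    · exact hpq h
    · exact hxp h.symm
    · exact hyp h.symm
    · exact hzp h.symm
  rcases hWs with hWs | hWs <;> rcases hVs with hVs | hVs <;> rw [hWs, hVs] at hWV <;>
    refine hkey _ _ ?_ ?_ ?_ ?_ (hWV (by simp) (by simp) (by simp) (by simp) (by simp) (by simp)) <;>
    tauto

/-- Three parallelograms that pairwise share a side bound a prism. -/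
theorem prism_of_three (h : IsThreeCell D T A) {a b c e x y : α}
    (hQ : IsParallelogram T A a c b e) (hW : IsParallelogram T A a y b x)
    (hV : IsParallelogram T A c x e y) (hnd : [a, e, x, b, c, y].Nodup)
    (hD : D ⊆ {a, e, x, b, c, y}) : Prism D T a e x b c y := by
  have hae := h.adj_of_parallelogram (hQ.exchange.swap h.symm).exchange
  have hbc := h.symm (h.adj_of_parallelogram (hQ.swap h.symm))
  obtain ⟨-, hQT, hQs, hac, hbe⟩ := hQ
  obtain ⟨-, hWT, hWs, hay, hbx⟩ := hW
  obtain ⟨-, hVT, hVs, hcx, hey⟩ := hV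
  have hnd' := hnd
  simp only [List.nodup_cons, List.mem_cons, List.not_mem_nil, or_false, not_or,
    not_false_eq_true, List.nodup_nil, and_true] at hnd'
  obtain ⟨⟨hae', hax', hab', hac', hay'⟩, ⟨hex', heb', hec', hey'⟩, ⟨hxb', hxc', hxy'⟩,
    ⟨hbc', hby'⟩, hcy'⟩ := hnd'
  -- a 2-cell with the end of a diagonal `p q` of the parallelogram `X` avoids the other end
  have hdiag : ∀ Z ∈ T, ∀ X ∈ T, Z ≠ X → ∀ {p q}, p ≠ q → ¬ A p q → p ∈ X → q ∈ X → p ∈ Z →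
      q ∉ Z := fun Z hZ X hX hne p q hpq hA hpX hqX hpZ hqZ =>
    hne (h.eq_of_not_adj hZ hX hpq hpZ hqZ hpX hqX hA)
  have hthree : ∀ Z ∈ T, ∀ X ∈ T, Z ≠ X → ∀ {p q r}, p ≠ q → p ≠ r → q ≠ r → p ∈ X → q ∈ X →
      r ∈ X → p ∈ Z → q ∈ Z → r ∉ Z := fun Z hZ X hX hne p q r hpq hpr hqr hpX hqX hrX hpZ hqZ hrZ =>
    hne (h.eq_of_three hZ hX hpq hpr hqr hpZ hqZ hrZ hpX hqX hrX)
  have hcl : ∀ Z ∈ T, Z ≠ {a, c, b, e} → Z ≠ {a, y, b, x} → Z ≠ {c, x, e, y} →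
      Z = {a, e, x} ∨ Z = {b, c, y} := by
    intro Z hZ hZQ hZW hZV
    by_cases ha : a ∈ Z
    · left
      have hc : c ∉ Z := hdiag Z hZ _ hQT hZQ hac' hac (by simp) (by simp) ha
      have hy : y ∉ Z := hdiag Z hZ _ hWT hZW hay' hay (by simp) (by simp) ha
      have hb : b ∉ Z := by
        intro hb
        have he : e ∉ Z := hthree Z hZ _ hQT hZQ hab' hae' (Ne.symm heb') (by simp) (by simp)
          (by simp) ha hb
        have hx : x ∉ Z := hthree Z hZ _ hWT hZW hab' hax' (Ne.symm hxb') (by simp) (by simp)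
          (by simp) ha hb
        obtain ⟨p, q, r, hpq, hpr, hqr, hp, hq, hr⟩ := h.exists_three hZ
        have hmem : ∀ z ∈ Z, z = a ∨ z = b := by
          intro z hz
          rcases hD (h.subset hZ hz) with rfl | rfl | rfl | rfl | rfl | rfl <;> tauto
        rcases hmem p hp with rfl | rfl <;> rcases hmem q hq with rfl | rfl <;>
          rcases hmem r hr with rfl | rfl <;> contradiction
      refine h.eq_triple hZ fun z hz => ?_
      rcases hD (h.subset hZ hz) with rfl | rfl | rfl | rfl | rfl | rfl <;>
        first | contradiction | simp
    · right
      by_cases hb : b ∈ Z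
      · have he : e ∉ Z := hdiag Z hZ _ hQT hZQ (Ne.symm heb') hbe (by simp) (by simp) hb
        have hx : x ∉ Z := hdiag Z hZ _ hWT hZW (Ne.symm hxb') hbx (by simp) (by simp) hb
        refine h.eq_triple hZ fun z hz => ?_
        rcases hD (h.subset hZ hz) with rfl | rfl | rfl | rfl | rfl | rfl <;>
          first | contradiction | simp
      · refine absurd (h.eq_of_subset hZ hVT fun z hz => ?_) hZV
        rcases hD (h.subset hZ hz) with rfl | rfl | rfl | rfl | rfl | rfl <;>
          first | contradiction | simp
  have hbase₁ : ({a, e, x} : Set α) ∈ T := by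
    obtain ⟨Y, hY, hYQ, haY, heY, -⟩ := h.exists_next hQT (a := a) (b := e) (by simp) (by simp) hae
    have hYW : Y ≠ {a, y, b, x} := fun h' => by
      rw [h'] at heY
      simp only [Set.mem_insert_iff, Set.mem_singleton_iff] at heY
      grind
    have hYV : Y ≠ {c, x, e, y} := fun h' => by
      rw [h'] at haY
      simp only [Set.mem_insert_iff, Set.mem_singleton_iff] at haY
      tauto
    rcases hcl Y hY hYQ hYW hYV with h' | h'
    · rwa [← h']
    · rw [h'] at haY
      simp only [Set.mem_insert_iff, Set.mem_singleton_iff] at haY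
      tauto
  have hbase₂ : ({b, c, y} : Set α) ∈ T := by
    obtain ⟨Y, hY, hYQ, hbY, hcY, -⟩ := h.exists_next hQT (a := b) (b := c) (by simp) (by simp) hbc
    have hYW : Y ≠ {a, y, b, x} := fun h' => by
      rw [h'] at hcY
      simp only [Set.mem_insert_iff, Set.mem_singleton_iff] at hcY
      grind
    have hYV : Y ≠ {c, x, e, y} := fun h' => by
      rw [h'] at hbY
      simp only [Set.mem_insert_iff, Set.mem_singleton_iff] at hbY
      grind
    rcases hcl Y hY hYQ hYW hYV with h' | h'
    · rw [h'] at hbY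
      simp only [Set.mem_insert_iff, Set.mem_singleton_iff] at hbY
      grind
    · rwa [← h']
  have hQe : ({a, e, c, b} : Set α) = {a, c, b, e} := by ext; simp; tauto
  have hVe : ({e, x, y, c} : Set α) = {c, x, e, y} := by ext; simp; tauto
  have hWe : ({x, a, b, y} : Set α) = {a, y, b, x} := by ext; simp; tauto
  refine ⟨hnd, hD.antisymm ?_, Set.Subset.antisymm (fun Z hZ => ?_) ?_, ?_, ?_⟩
  · have h1 := h.subset hQT
    have h2 := h.subset hWT
    rintro z (rfl | rfl | rfl | rfl | rfl | rfl)
    · exact h1 (by simp)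
    · exact h1 (by simp)
    · exact h2 (by simp)
    · exact h1 (by simp)
    · exact h1 (by simp)
    · exact h2 (by simp)
  · rw [hQe, hVe, hWe]
    simp only [Set.mem_insert_iff, Set.mem_singleton_iff]
    by_cases h1 : Z = {a, c, b, e}
    · exact Or.inr (Or.inr (Or.inl h1))
    by_cases h2 : Z = {a, y, b, x}
    · exact Or.inr (Or.inr (Or.inr (Or.inr h2)))
    by_cases h3 : Z = {c, x, e, y}
    · exact Or.inr (Or.inr (Or.inr (Or.inl h3)))
    rcases hcl Z hZ h1 h2 h3 with h4 | h4
    · exact Or.inl h4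
    · exact Or.inr (Or.inl h4)
  · rw [hQe, hVe, hWe]
    rintro Z (rfl | rfl | rfl | rfl | rfl) <;> assumption
  · rw [sub_eq_sub_iff_add_eq_add, hQs, add_comm]
  · rw [sub_eq_sub_iff_add_eq_add, ← hVs, add_comm]

/-- Two parallelograms that share the side `a b` lie in a prism: the third lateral face is the
parallelogram through `x`, `y` and `e`. -/
theorem prism_of_two (h : IsThreeCell D T A) (hK : HasParallelograms D T A)
    {a b c e x y : α} (hP : IsParallelogram T A a c b e) (hW : IsParallelogram T A a y b x)
    (hnd : [a, e, x, b, c, y].Nodup) (hD : D ⊆ {a, e, x, b, c, y}) :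
    Prism D T a e x b c y := by
  have hnd' := hnd
  simp only [List.nodup_cons, List.mem_cons, List.not_mem_nil, or_false, not_or,
    not_false_eq_true, List.nodup_nil, and_true] at hnd'
  obtain ⟨⟨hae', hax', hab', hac', hay'⟩, ⟨hex', heb', hec', hey'⟩, ⟨hxb', hxc', hxy'⟩,
    ⟨hbc', hby'⟩, hcy'⟩ := hnd'
  have hx : x ∈ D := h.subset hW.2.1 (by simp)
  have hy : y ∈ D := h.subset hW.2.1 (by simp)
  have heD : e ∈ D := h.subset hP.2.1 (by simp)
  have hce := h.adj_of_parallelogram ((hP.swap h.symm).exchange.swap h.symm).exchange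
  obtain ⟨r, r', v, v', hV, hVs⟩ := h.exists_parallelogram_through hK hP hx hy heD hxy'
    (by simp only [Set.mem_insert_iff, Set.mem_singleton_iff]; grind)
    (by simp only [Set.mem_insert_iff, Set.mem_singleton_iff]; grind)
    (Ne.symm hae') hec' hex' hey'
  have hVc : ({r, r', v, v'} : Set α) = {c, e, x, y} := by
    rcases hVs with hVa | hVc
    · exfalso
      have := h.eq_of_three hV.2.1 hW.2.1 (a := x) (b := y) (c := a) hxy' (Ne.symm hax')
        (Ne.symm hay') (by rw [hVa]; simp) (by rw [hVa]; simp) (by rw [hVa]; simp) (by simp)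
        (by simp) (by simp)
      rw [hVa] at this
      have he : e ∈ ({a, y, b, x} : Set α) := by rw [← this]; simp
      simp only [Set.mem_insert_iff, Set.mem_singleton_iff] at he
      tauto
    · rw [hVc]
      ext; simp; tauto
  rcases hV.of_side h.symm hVc (by simp; grind) hce with hV' | hV'
  · -- the side `x y` would be traversed in opposite directions
    exfalso
    have h1 := hP.2.2.1
    have h2 := hW.2.2.1
    have h3 := hV'.2.2.1
    have h4 : (x - y) + (x - y) = 0 := by
      have h5 : a - b = x - y := by rw [sub_eq_sub_iff_add_eq_add, h2, add_comm]
      have h6 : a - b = e - c := by rw [sub_eq_sub_iff_add_eq_add, h1, add_comm]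
      have h7 : e - c = y - x := by rw [sub_eq_sub_iff_add_eq_add, ← h3, add_comm]
      have h8 : x - y = y - x := h5.symm.trans (h6.trans h7)
      nth_rewrite 2 [h8]
      abel
    exact hxy' (sub_eq_zero.1 (h.double_ne h4))
  · exact h.prism_of_three hP hW hV' hnd hD

/-- A dual 3-cell without central symmetry that has two vertices `x`, `y` besides those of a
parallelogram `a b c e` is a prism. -/
theorem prism_of_parallelogram (h : IsThreeCell D T A) (hK : HasParallelograms D T A)
    {a b c e x y : α} (hP : IsParallelogram T A a c b e) (hx : x ∈ D) (hy : y ∈ D) (hxy : x ≠ y)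
    (hxQ : x ∉ ({a, c, b, e} : Set α)) (hyQ : y ∉ ({a, c, b, e} : Set α)) :
    ∃ b c a' b' c', Prism D T a b c a' b' c' := by
  have hD : ∀ z ∈ D, z = a ∨ z = c ∨ z = b ∨ z = e ∨ z = x ∨ z = y := by
    intro z hz
    by_cases hzQ : z ∈ ({a, c, b, e} : Set α)
    · rcases hzQ with h | h | h | h <;> tauto
    · have := h.eq_or_eq_of_parallelogram hK hP hx hy hz hxy hxQ hyQ hzQ
      tauto
  have hnd := hP.1
  simp only [List.nodup_cons, List.mem_cons, List.not_mem_nil, or_false, not_or,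
    not_false_eq_true, List.nodup_nil, and_true] at hnd
  have hmx := hxQ
  have hmy := hyQ
  simp only [Set.mem_insert_iff, Set.mem_singleton_iff, not_or] at hmx hmy
  have hset : ({a, c, b, e} : Set α) = {b, e, a, c} := by ext; simp; tauto
  have haD : a ∈ D := h.subset hP.2.1 (by simp)
  obtain ⟨s, s', u, u', hW, hWs⟩ := h.exists_parallelogram_through hK hP.exchange hx hy haD hxy
    (by rwa [← hset]) (by rwa [← hset]) hnd.1.2.1 hnd.1.2.2 (Ne.symm hmx.1) (Ne.symm hmy.1)
  -- the parallelogram shares with `a b c e` the side `a b` or the side `a e`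
  have key : ∀ {b e : α}, IsParallelogram T A a c b e → [a, e, x, b, c, y].Nodup →
      (∀ z ∈ D, z = a ∨ z = c ∨ z = b ∨ z = e ∨ z = x ∨ z = y) →
      ({s, s', u, u'} : Set α) = {b, x, y, a} → ∃ b c a' b' c', Prism D T a b c a' b' c' := by
    intro b e hP hnd hD hWs
    have hWs' : ({s, s', u, u'} : Set α) = {a, b, x, y} := by
      rw [hWs]; ext; simp; tauto
    have hnd' := hnd
    simp only [List.nodup_cons, List.mem_cons, List.not_mem_nil, or_false, not_or,
      not_false_eq_true, List.nodup_nil, and_true] at hnd'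
    obtain ⟨⟨n₁, n₂, n₃, n₄, n₅⟩, ⟨n₆, n₇, n₈, n₉⟩, ⟨n₁₀, n₁₁, n₁₂⟩, ⟨n₁₃, n₁₄⟩, n₁₅⟩ := hnd'
    have hnd2 : [a, b, x, y].Nodup := by
      simp only [List.nodup_cons, List.mem_cons, List.not_mem_nil, or_false, not_or,
        not_false_eq_true, List.nodup_nil, and_true]
      exact ⟨⟨n₃, n₂, n₅⟩, ⟨Ne.symm n₁₀, n₁₄⟩, n₁₂⟩
    have hnd3 : [a, e, y, b, c, x].Nodup := by
      simp only [List.nodup_cons, List.mem_cons, List.not_mem_nil, or_false, not_or,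
        not_false_eq_true, List.nodup_nil, and_true]
      exact ⟨⟨n₁, n₅, n₃, n₄, n₂⟩, ⟨n₉, n₇, n₈, n₆⟩, ⟨Ne.symm n₁₄, Ne.symm n₁₅, Ne.symm n₁₂⟩,
        ⟨n₁₃, Ne.symm n₁₀⟩, Ne.symm n₁₁⟩
    rcases hW.of_side h.symm hWs' hnd2 (h.adj_of_parallelogram hP) with hW' | hW'
    · exact ⟨_, _, _, _, _, h.prism_of_two hK hP hW' hnd fun z hz => by
        rcases hD z hz with rfl | rfl | rfl | rfl | rfl | rfl <;> simp⟩
    · exact ⟨_, _, _, _, _, h.prism_of_two hK hP hW' hnd3 fun z hz => by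
        rcases hD z hz with rfl | rfl | rfl | rfl | rfl | rfl <;> simp⟩
  obtain ⟨⟨hac, hab, hae⟩, ⟨hcb, hce⟩, hbe⟩ := hnd
  obtain ⟨hxa, hxc, hxb, hxe⟩ := hmx
  obtain ⟨hya, hyc, hyb, hye⟩ := hmy
  rcases hWs with hWs | hWs
  · refine key hP ?_ hD hWs
    simp only [List.nodup_cons, List.mem_cons, List.not_mem_nil, or_false, not_or,
      not_false_eq_true, List.nodup_nil, and_true]
    exact ⟨⟨hae, Ne.symm hxa, hab, hac, Ne.symm hya⟩, ⟨Ne.symm hxe, Ne.symm hbe, Ne.symm hce,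
      Ne.symm hye⟩, ⟨hxb, hxc, hxy⟩, ⟨Ne.symm hcb, Ne.symm hyb⟩, Ne.symm hyc⟩
  · refine key (hP.exchange.swap h.symm).exchange ?_
      (fun z hz => by have := hD z hz; tauto) hWs
    simp only [List.nodup_cons, List.mem_cons, List.not_mem_nil, or_false, not_or,
      not_false_eq_true, List.nodup_nil, and_true]
    exact ⟨⟨hab, Ne.symm hxa, hae, hac, Ne.symm hya⟩, ⟨Ne.symm hxb, hbe, Ne.symm hcb,
      Ne.symm hyb⟩, ⟨hxe, hxc, hxy⟩, ⟨Ne.symm hce, Ne.symm hye⟩, Ne.symm hyc⟩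

/-- A 2-cell of a cell with vertices `p, q, r` and their opposites contains `p` or its opposite,
since it has three vertices no two of which are opposite. -/
theorem mem_or_sub_mem (h : IsThreeCell D T A) {k p q r : α}
    (hT : ∀ X ∈ T, ∀ s ∈ X, k - s ∉ X)
    (hD : ∀ e ∈ D, e = p ∨ e = q ∨ e = r ∨ e = k - p ∨ e = k - q ∨ e = k - r)
    {Z : Set α} (hZ : Z ∈ T) : p ∈ Z ∨ k - p ∈ Z := by
  by_contra hcon
  rw [not_or] at hcon
  obtain ⟨x, y, z, hxy, hxz, hyz, hx, hy, hz⟩ := h.exists_three hZ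
  have hmem : ∀ w ∈ Z, w = q ∨ w = r ∨ w = k - q ∨ w = k - r := by
    intro w hw
    rcases hD w (h.subset hZ hw) with rfl | rfl | rfl | rfl | rfl | rfl <;> tauto
  have hq : q ∈ Z → k - q ∉ Z := hT Z hZ q
  have hr : r ∈ Z → k - r ∉ Z := hT Z hZ r
  have hx' := hmem x hx
  have hy' := hmem y hy
  have hz' := hmem z hz
  grind

/-- In a centrally symmetric dual 3-cell the triangle `p q r` has the vertex opposite to `r` across
its edge `p q`. -/
theorem flip_mem (h : IsThreeCell D T A) {k p q r : α} (hT : ∀ X ∈ T, ∀ s ∈ X, k - s ∉ X)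
    (hD : ∀ e ∈ D, e = p ∨ e = q ∨ e = r ∨ e = k - p ∨ e = k - q ∨ e = k - r)
    (hpq : p ≠ q) (hpqr : {p, q, r} ∈ T) : ({p, q, k - r} : Set α) ∈ T := by
  have hA : A p q := by
    by_contra hA
    rcases h.cases hpqr with ⟨a', b', c', -, hs, h1, h2, h3⟩ | ⟨a', b', c', e', hnd, hs, -⟩
    · have hp : p ∈ ({a', b', c'} : Set α) := by rw [← hs]; simp
      have hq : q ∈ ({a', b', c'} : Set α) := by rw [← hs]; simp
      have := h.symm h1
      have := h.symm h2
      have := h.symm h3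
      rcases hp with rfl | rfl | rfl <;> rcases hq with rfl | rfl | rfl <;> contradiction
    · have hm : ∀ z ∈ ({a', b', c', e'} : Set α), z = p ∨ z = q ∨ z = r := fun z hz => by
        rw [← hs] at hz; exact hz
      have h1 := hm a' (by simp)
      have h2 := hm b' (by simp)
      have h3 := hm c' (by simp)
      have h4 := hm e' (by simp)
      simp at hnd
      grind
  obtain ⟨Y, hY, -, hpY, hqY, z, hzY, hz⟩ := h.exists_next hpqr (a := p) (b := q) (by simp)
    (by simp) hA
  have hp' := hT Y hY p hpY
  have hq' := hT Y hY q hqY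
  simp only [Set.mem_insert_iff, Set.mem_singleton_iff, not_or] at hz
  have hzr : z = k - r := by
    rcases hD z (h.subset hY hzY) with rfl | rfl | rfl | rfl | rfl | rfl <;> tauto
  rw [← hzr]
  convert hY using 1
  symm
  refine h.eq_triple hY fun w hw => ?_
  have hr' : r ∉ Y := fun hr => hT Y hY r hr (by rwa [← hzr])
  rw [hzr]
  rcases hD w (h.subset hY hw) with rfl | rfl | rfl | rfl | rfl | rfl <;>
    first | contradiction | simp

/-- A centrally symmetric dual 3-cell with a triangle `a b c` is an octahedron. -/
theorem octahedron_of_triangle (h : IsThreeCell D T A) {k a b c : α}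
    (hk : ∀ s ∈ D, k - s ∈ D ∧ k - s ≠ s) (hT : ∀ X ∈ T, ∀ s ∈ X, k - s ∉ X)
    (hX : {a, b, c} ∈ T) (hnd : [a, b, c].Nodup)
    (hD : ∀ e ∈ D, e = a ∨ e = b ∨ e = c ∨ e = k - a ∨ e = k - b ∨ e = k - c) :
    Octahedron D T a b c (k - a) (k - b) (k - c) := by
  simp only [List.nodup_cons, List.mem_cons, List.not_mem_nil, or_false, not_or,
    not_false_eq_true, List.nodup_nil, and_true] at hnd
  obtain ⟨⟨hab, hac⟩, hbc⟩ := hnd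
  have haD := h.subset hX (show a ∈ _ by simp)
  have hbD := h.subset hX (show b ∈ _ by simp)
  have hcD := h.subset hX (show c ∈ _ by simp)
  have hrot : ∀ p q r : α, ({p, q, r} : Set α) = {q, r, p} := fun p q r => by
    ext; simp; tauto
  -- replace one vertex of a triangle by the opposite one, keeping the order of the vertices
  have hflip₁ : ∀ {p q r : α},
      (∀ e ∈ D, e = p ∨ e = q ∨ e = r ∨ e = k - p ∨ e = k - q ∨ e = k - r) →
      q ≠ r → {p, q, r} ∈ T → ({k - p, q, r} : Set α) ∈ T := by
    intro p q r hD hqr hpqr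
    rw [hrot]
    exact h.flip_mem hT (fun e he => by have := hD e he; tauto) hqr (by rwa [← hrot])
  have hflip₂ : ∀ {p q r : α},
      (∀ e ∈ D, e = p ∨ e = q ∨ e = r ∨ e = k - p ∨ e = k - q ∨ e = k - r) →
      p ≠ r → {p, q, r} ∈ T → ({p, k - q, r} : Set α) ∈ T := by
    intro p q r hD hpr hpqr
    rw [← hrot]
    exact h.flip_mem hT (fun e he => by have := hD e he; tauto) hpr.symm (by rwa [hrot])
  have hab' : a ≠ k - b := fun h' => hT _ hX b (by simp) (by rw [← h']; simp)
  have hac' : a ≠ k - c := fun h' => hT _ hX c (by simp) (by rw [← h']; simp)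
  have hba' : b ≠ k - a := fun h' => hT _ hX a (by simp) (by rw [← h']; simp)
  have hbc' : b ≠ k - c := fun h' => hT _ hX c (by simp) (by rw [← h']; simp)
  have hca' : c ≠ k - a := fun h' => hT _ hX a (by simp) (by rw [← h']; simp)
  have hcb' : c ≠ k - b := fun h' => hT _ hX b (by simp) (by rw [← h']; simp)
  have haa' := (hk a haD).2.symm
  have hbb' := (hk b hbD).2.symm
  have hcc' := (hk c hcD).2.symm
  have hka : k - (k - a) = a := sub_sub_cancel k a
  have hkb : k - (k - b) = b := sub_sub_cancel k b
  have hkc : k - (k - c) = c := sub_sub_cancel k c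
  have h₁ : ({a, b, k - c} : Set α) ∈ T := h.flip_mem hT hD hab hX
  have hall : ∀ x y z : α, (x = a ∨ x = k - a) → (y = b ∨ y = k - b) → (z = c ∨ z = k - c) →
      ({x, y, z} : Set α) ∈ T := by
    have hD₁ : ∀ e ∈ D, e = a ∨ e = b ∨ e = k - c ∨ e = k - a ∨ e = k - b ∨ e = k - (k - c) := by
      intro e he; have := hD e he; rw [hkc]; tauto
    have h₂ : ∀ z : α, (z = c ∨ z = k - c) → ({a, b, z} : Set α) ∈ T := by
      rintro z (rfl | rfl)
      exacts [hX, h₁]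
    have h₃ : ∀ y z : α, (y = b ∨ y = k - b) → (z = c ∨ z = k - c) → ({a, y, z} : Set α) ∈ T := by
      rintro y z (rfl | rfl) hz
      · exact h₂ z hz
      · refine hflip₂ ?_ ?_ (h₂ z hz)
        · rcases hz with rfl | rfl <;> assumption
        · rcases hz with rfl | rfl <;> assumption
    rintro x y z (rfl | rfl) hy hz
    · exact h₃ y z hy hz
    · refine hflip₁ ?_ ?_ (h₃ y z hy hz)
      · intro e he
        have := hD e he
        rcases hy with rfl | rfl <;> rcases hz with rfl | rfl <;> (try rw [hkb]) <;>
          (try rw [hkc]) <;> tauto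
      · rcases hy with rfl | rfl <;> rcases hz with rfl | rfl
        · exact hbc
        · exact hbc'
        · exact hcb'.symm
        · exact fun h' => hbc (sub_right_injective h')
  refine ⟨?_, Set.Subset.antisymm (fun e he => hD e he) ?_,
    Set.Subset.antisymm (fun Z hZ => ?_) ?_, ?_, ?_⟩
  · have h1 : k - a ≠ k - b := fun h' => hab (sub_right_injective h')
    have h2 : k - a ≠ k - c := fun h' => hac (sub_right_injective h')
    have h3 : k - b ≠ k - c := fun h' => hbc (sub_right_injective h')
    simp only [List.nodup_cons, List.mem_cons, List.not_mem_nil, or_false, not_or,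
      not_false_eq_true, List.nodup_nil, and_true]
    exact ⟨⟨hab, hac, haa', hab', hac'⟩, ⟨hbc, hba', hbb', hbc'⟩, ⟨hca', hcb', hcc'⟩, ⟨h1, h2⟩, h3⟩
  · rintro e (rfl | rfl | rfl | rfl | rfl | rfl)
    exacts [haD, hbD, hcD, (hk _ haD).1, (hk _ hbD).1, (hk _ hcD).1]
  · have hmA := h.mem_or_sub_mem hT hD hZ
    have hmB := h.mem_or_sub_mem hT (p := b) (q := c) (r := a)
      (fun e he => by rcases hD e he with h | h | h | h | h | h <;> simp [h]) hZ
    have hmC := h.mem_or_sub_mem hT (p := c) (q := a) (r := b)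
      (fun e he => by rcases hD e he with h | h | h | h | h | h <;> simp [h]) hZ
    obtain ⟨x, hxZ, hx⟩ : ∃ x ∈ Z, x = a ∨ x = k - a := by
      rcases hmA with hm | hm
      exacts [⟨_, hm, Or.inl rfl⟩, ⟨_, hm, Or.inr rfl⟩]
    obtain ⟨y, hyZ, hy⟩ : ∃ y ∈ Z, y = b ∨ y = k - b := by
      rcases hmB with hm | hm
      exacts [⟨_, hm, Or.inl rfl⟩, ⟨_, hm, Or.inr rfl⟩]
    obtain ⟨z, hzZ, hz⟩ : ∃ z ∈ Z, z = c ∨ z = k - c := by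
      rcases hmC with hm | hm
      exacts [⟨_, hm, Or.inl rfl⟩, ⟨_, hm, Or.inr rfl⟩]
    have hZe : Z = {x, y, z} := (h.eq_of_subset (hall x y z hx hy hz) hZ (by
      rintro w (rfl | rfl | rfl) <;> assumption)).symm
    rw [hZe]
    rcases hx with rfl | rfl <;> rcases hy with rfl | rfl <;> rcases hz with rfl | rfl <;>
      simp only [Set.mem_insert_iff, Set.mem_singleton_iff, true_or, or_true]
  · rintro Z (rfl | rfl | rfl | rfl | rfl | rfl | rfl | rfl) <;> apply hall <;>
      simp only [true_or, or_true]
  · abel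
  · abel

/-- Classification of the dual 3-cells with a triangle `v p q`, with `v` as a distinguished
vertex. -/
theorem classification (h : IsThreeCell D T A) {v p q : α} (hX : {v, p, q} ∈ T)
    (hnd : [v, p, q].Nodup) (hvp : A v p) (hvq : A v q) (hpq : A p q)
    (hcen : (∃ k, (∀ s ∈ D, k - s ∈ D ∧ k - s ≠ s) ∧ (∀ X ∈ T, ∀ s ∈ X, k - s ∉ X) ∧
      ∀ e ∈ D, e = v ∨ e = p ∨ e = q ∨ e = k - v ∨ e = k - p ∨ e = k - q) ∨
        HasParallelograms D T A) :
    (∃ b c e, Tetra D T v b c e) ∨ (∃ a b c e, Pyramid D T v a b c e) ∨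
    (∃ s b c e, Pyramid D T s v b c e) ∨ (∃ b c a' b' c', Octahedron D T v b c a' b' c') ∨
    (∃ b c a' b' c', Prism D T v b c a' b' c') := by
  have hvD : v ∈ D := h.subset hX (by simp)
  rcases hcen with ⟨k, hk, hT, hD⟩ | hK
  · exact Or.inr (Or.inr (Or.inr (Or.inl
      ⟨_, _, _, _, _, h.octahedron_of_triangle hk hT hX hnd hD⟩)))
  by_cases hno : ∀ s s' u u', ¬ IsParallelogram T A s s' u u'
  · obtain ⟨e, he⟩ := h.tetra_of_triangle hK hno hnd hX hvp hvq hpq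
    exact Or.inl ⟨p, q, e, he⟩
  push Not at hno
  have hout : ∀ {a c b e}, IsParallelogram T A a c b e → ∃ s ∈ D, s ∉ ({a, c, b, e} : Set α) := by
    intro a c b e hP
    obtain ⟨Y, hY, -, -, -, s, hsY, hs⟩ := h.exists_next hP.2.1 (a := a) (b := b) (by simp)
      (by simp) (h.adj_of_parallelogram hP)
    exact ⟨s, h.subset hY hsY, hs⟩
  by_cases hv : ∃ s s' u u', IsParallelogram T A s s' u u' ∧ v ∈ ({s, s', u, u'} : Set α)
  · obtain ⟨s, s', u, u', hP, hvP⟩ := hv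
    obtain ⟨c, b, e, hP, -⟩ := hP.exists_eq h.symm hvP
    obtain ⟨x, hx, hxQ⟩ := hout hP
    by_cases hone : D ⊆ insert x {v, c, b, e}
    · exact Or.inr (Or.inr (Or.inl ⟨_, _, _, _, h.pyramid_of_parallelogram hP hxQ hone hx⟩))
    · obtain ⟨y, hy, hyx⟩ := Set.not_subset.1 hone
      rw [Set.mem_insert_iff, not_or] at hyx
      exact Or.inr (Or.inr (Or.inr (Or.inr
        (h.prism_of_parallelogram hK hP hx hy (Ne.symm hyx.1) hxQ hyx.2))))
  · push Not at hv
    obtain ⟨a, c, b, e, hP⟩ := hno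
    have hvQ := hv _ _ _ _ hP
    have hone : D ⊆ insert v {a, c, b, e} := by
      intro y hy
      by_contra hcon
      rw [Set.mem_insert_iff, not_or] at hcon
      have hset : ({a, c, b, e} : Set α) = {b, e, a, c} := by ext; simp; tauto
      have hnd := hP.1
      simp only [List.nodup_cons, List.mem_cons, List.not_mem_nil, or_false, not_or,
        not_false_eq_true, List.nodup_nil, and_true] at hnd
      have hvQ' := hvQ
      have hyQ' := hcon.2
      simp only [Set.mem_insert_iff, Set.mem_singleton_iff, not_or] at hvQ' hyQ'
      obtain ⟨s, s', u, u', hW, hWs⟩ := h.exists_parallelogram_through hK hP.exchange hvD hy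
        (h.subset hP.2.1 (show a ∈ _ by simp)) (Ne.symm hcon.1) (by rwa [← hset])
        (by rw [← hset]; exact hcon.2) hnd.1.2.1 hnd.1.2.2 (Ne.symm hvQ'.1) (Ne.symm hyQ'.1)
      refine hv _ _ _ _ hW ?_
      rcases hWs with hWs | hWs <;> rw [hWs] <;> simp
    exact Or.inr (Or.inl ⟨_, _, _, _, h.pyramid_of_parallelogram hP hvQ hone hvD⟩)

end IsThreeCell

end Combinatorics

end Venkov

/-! ### Cochains with real and rational coefficients -/

namespace Venkov

section Cochains

variable {A : Type*} {K : PreAbstractSimplicialComplex A} {R : Type*} [CommRing R]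

theorem IsEdge.isVertex_left {x y : A} (h : IsEdge K x y) : IsVertex K x := by
  classical
  exact (K.isRelLowerSet_faces h.2).2 (show ({x} : Finset A) ⊆ _ by simp) (by simp)

theorem cochain_self (c : C1 K R) (x : A) : c.1 x x = 0 :=
  c.2.2 x x fun h => h.1 rfl

theorem cochain_symm (c : C1 K R) (x y : A) : c.1 y x = -c.1 x y :=
  c.2.1 x y

/-- The vertices `x`, `y`, `z`, not necessarily distinct, lie in a common face of `K`. -/
def InFace (K : PreAbstractSimplicialComplex A) (x y z : A) : Prop :=
  ∃ S ∈ K.faces, x ∈ S ∧ y ∈ S ∧ z ∈ S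

theorem InFace.swap {x y z : A} (h : InFace K x y z) : InFace K x z y := by
  obtain ⟨S, hS, h1, h2, h3⟩ := h
  exact ⟨S, hS, h1, h3, h2⟩

theorem InFace.rotate {x y z : A} (h : InFace K x y z) : InFace K y z x := by
  obtain ⟨S, hS, h1, h2, h3⟩ := h
  exact ⟨S, hS, h2, h3, h1⟩

/-- The cocycle condition also holds on degenerate triangles. -/
theorem cocycle_triangle {c : C1 K R} (hc : c ∈ Z1 K R) {x y z : A} (h : InFace K x y z) :
    c.1 x y + c.1 y z + c.1 z x = 0 := by
  classical
  by_cases hxy : x = y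
  · subst hxy
    rw [cochain_self, cochain_symm c z x]
    ring
  by_cases hyz : y = z
  · subst hyz
    rw [cochain_self, cochain_symm c x y]
    ring
  by_cases hxz : x = z
  · subst hxz
    rw [cochain_self, cochain_symm c x y]
    ring
  obtain ⟨S, hS, h1, h2, h3⟩ := h
  have hface : ({x, y, z} : Finset A) ∈ K.faces :=
    (K.isRelLowerSet_faces hS).2 (by simp [Finset.insert_subset_iff, h1, h2, h3]) (by simp)
  exact congrFun (LinearMap.mem_ker.1 hc) ⟨(x, y, z), hxy, hyz, hxz, by convert hface⟩

/-- The rational cochain obtained from a real one by a `ℚ`-linear functional on `ℝ`. -/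
noncomputable def mapCochain (φ : ℝ →ₗ[ℚ] ℚ) (c : C1 K ℝ) : C1 K ℚ :=
  ⟨fun x y => φ (c.1 x y), fun x y => (congrArg φ (cochain_symm c x y)).trans (map_neg φ _),
    fun x y h => (congrArg φ (c.2.2 x y h)).trans (map_zero φ)⟩

theorem mapCochain_mem_Z1 (φ : ℝ →ₗ[ℚ] ℚ) {c : C1 K ℝ} (hc : c ∈ Z1 K ℝ) :
    mapCochain φ c ∈ Z1 K ℚ := by
  refine LinearMap.mem_ker.2 (funext fun p => ?_)
  have h := congrFun (LinearMap.mem_ker.1 hc) p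
  change φ _ + φ _ + φ _ = 0
  rw [← map_add, ← map_add]
  exact (congrArg φ h).trans (map_zero φ)

open scoped Classical in
theorem coboundary0_apply (u : C0 K R) (x y : A) :
    (coboundary0 K R u).1 x y = if IsEdge K x y then u.1 y - u.1 x else 0 := rfl

/-- A linear map that vanishes on the kernel of another one factors through it. -/
theorem exists_comp_eq_of_ker_le {k V W U : Type*} [Field k] [AddCommGroup V] [AddCommGroup W]
    [AddCommGroup U] [Module k V] [Module k W] [Module k U] (f : V →ₗ[k] W) (g : V →ₗ[k] U)
    (h : LinearMap.ker f ≤ LinearMap.ker g) : ∃ u : W →ₗ[k] U, u ∘ₗ f = g := by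
  obtain ⟨u, hu⟩ := LinearMap.exists_extend
    ((LinearMap.ker f).liftQ g h ∘ₗ f.quotKerEquivRange.symm.toLinearMap)
  refine ⟨u, LinearMap.ext fun v => ?_⟩
  have h1 := LinearMap.congr_fun hu (f.quotKerEquivRange (Submodule.Quotient.mk v))
  simpa using h1

open scoped Classical in
/-- The rational boundary operator, on all pairs of labels. -/
noncomputable def boundary (K : PreAbstractSimplicialComplex A) : (A × A →₀ ℚ) →ₗ[ℚ] (A →₀ ℚ) :=
  Finsupp.linearCombination ℚ fun p =>
    if IsEdge K p.1 p.2 then Finsupp.single p.2 1 - Finsupp.single p.1 1 else 0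

/-- A real cochain all of whose rational images are coboundaries is a coboundary: as a linear map on
rational chains it vanishes on the cycles, hence factors through the boundary operator. -/
theorem mem_B1_of_mapCochain_mem {c : C1 K ℝ}
    (h : ∀ φ : ℝ →ₗ[ℚ] ℚ, mapCochain φ c ∈ B1 K ℚ) : c ∈ B1 K ℝ := by
  classical
  have hker : LinearMap.ker (boundary K) ≤
      LinearMap.ker (Finsupp.linearCombination ℚ fun p : A × A => c.1 p.1 p.2) := by
    intro m hm
    rw [LinearMap.mem_ker] at hm ⊢
    rw [← Module.forall_dual_apply_eq_zero_iff ℚ]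
    intro φ
    obtain ⟨u, hu⟩ := h φ
    have hcomp : φ ∘ₗ (Finsupp.linearCombination ℚ fun p : A × A => c.1 p.1 p.2) =
        (Finsupp.linearCombination ℚ u.1) ∘ₗ boundary K := by
      refine Finsupp.lhom_ext fun p r => ?_
      have h1 : φ (c.1 p.1 p.2) = if IsEdge K p.1 p.2 then u.1 p.2 - u.1 p.1 else 0 := by
        rw [← coboundary0_apply, hu]
        rfl
      by_cases hp : IsEdge K p.1 p.2
      · simp [boundary, h1, hp]
      · simp [boundary, h1, hp]
    have h2 := LinearMap.congr_fun hcomp m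
    simpa [hm] using h2
  obtain ⟨g, hg⟩ := exists_comp_eq_of_ker_le _ _ hker
  refine ⟨⟨fun x => if IsVertex K x then g (Finsupp.single x 1) else 0, fun x hx => if_neg hx⟩, ?_⟩
  refine Subtype.ext (funext fun x => funext fun y => ?_)
  rw [coboundary0_apply]
  by_cases hxy : IsEdge K x y
  · have h1 := LinearMap.congr_fun hg (Finsupp.single (x, y) 1)
    simp only [LinearMap.comp_apply, boundary, Finsupp.linearCombination_single, one_smul] at h1
    rw [if_pos hxy, map_sub] at h1
    simp only [if_pos hxy, if_pos hxy.isVertex_left, if_pos hxy.symm.isVertex_left, h1]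
  · rw [if_neg hxy, c.2.2 x y hxy]

end Cochains

end Venkov

/-! ### Cones in the Venkov complex -/

namespace Venkov

section ThreeCells

variable {d : ℕ} {P : Parallelohedron d} {E F G : Set (EuclideanSpace ℝ (Fin d))}

theorem lattice_eq_zero_of_add_self {a : P.lattice} (h : a + a = 0) : a = 0 := by
  have h1 : (a : EuclideanSpace ℝ (Fin d)) + a = 0 := by exact_mod_cast congrArg Subtype.val h
  rw [← two_smul ℝ] at h1
  exact Subtype.ext ((smul_eq_zero.1 h1).resolve_left two_ne_zero)

theorem isThreeCell (hG : IsTilingFace P G) (hdim : dim G + 3 = d) :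
    IsThreeCell (dualCell P G) (dualTwoCells P G) (Adjacent P) where
  symm h := h.symm
  double_ne h := lattice_eq_zero_of_add_self h
  subset := by
    rintro X ⟨E, -, -, hGE, rfl⟩
    exact dualCell_mono hG hGE
  cases := by
    rintro X ⟨E, hE, hEd, -, rfl⟩
    have hnot : ∀ {s t : P.lattice}, tile P s ∩ tile P t = E → ¬ Adjacent P s t := by
      rintro s t rfl hst
      rw [Adjacent] at hst
      omega
    rcases dualTwoCell_cases hE hEd with h | ⟨a, b, c, e, hnd, hD, hs, h1, h2, h3, h4, h5, h6⟩
    · exact Or.inl h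
    · exact Or.inr ⟨a, b, c, e, hnd, hD, hs, h1, h2, h3, h4, hnot h5, hnot h6⟩
  two_cells hs ht hst := exists_two_dualTwoCells hdim hs ht hst
  eq_of_three := by
    rintro X Y ⟨E, -, hE, -, rfl⟩ ⟨E', -, hE', -, rfl⟩ a b c hab hac hbc ha hb hc ha' hb' hc'
    rw [eq_of_three_tiles hE hE' hab hac hbc ha hb hc ha' hb' hc']
  eq_of_not_adj := by
    rintro X Y ⟨E, -, hE, -, rfl⟩ ⟨E', -, hE', -, rfl⟩ a b hab ha hb ha' hb' h
    rw [eq_of_not_adjacent hE hE' hab ha hb ha' hb' h]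

/-- Dual 3-cells no two tiles of which meet in `G` only have a parallelogram among any five
vertices. -/
theorem hasParallelograms (hdim : dim G + 3 = d)
    (h : ∀ s ∈ dualCell P G, ∀ t ∈ dualCell P G, s ≠ t → tile P s ∩ tile P t ≠ G) :
    IsThreeCell.HasParallelograms (dualCell P G) (dualTwoCells P G) (Adjacent P) := by
  intro b hb hbG
  obtain ⟨i, j, k, l, hnd, h1, h2, h3, h4⟩ := exists_parallelogram hdim hb hbG
    fun i j hij => h _ (hbG i) _ (hbG j) (hb.ne hij)
  exact ⟨i, j, k, l, hnd, (List.nodup_map_iff hb).2 hnd, h1, h2, h3, h4⟩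

/-- The tiles around a primitive `(d-2)`-face are pairwise adjacent. -/
theorem adjacent_of_triangle (hE : IsTilingFace P E) (hdim : dim E + 2 = d) {v p q : P.lattice}
    (hD : dualCell P E = {v, p, q}) {a b : P.lattice} (ha : a ∈ dualCell P E)
    (hb : b ∈ dualCell P E) (hab : a ≠ b) : Adjacent P a b := by
  rcases dualTwoCell_cases hE hdim with ⟨x, y, z, -, h, h1, h2, h3⟩ | ⟨x, y, z, w, hnd, h, -⟩
  · rw [h] at ha hb
    rcases ha with rfl | rfl | rfl <;> rcases hb with rfl | rfl | rfl <;>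
      first | contradiction | assumption | (apply Adjacent.symm; assumption)
  · exfalso
    have h4 : ({x, y, z, w} : Set P.lattice) = {v, p, q} := h.symm.trans hD
    have hm : ∀ u ∈ ({x, y, z, w} : Set P.lattice), u = v ∨ u = p ∨ u = q := fun u hu => by
      rw [h4] at hu; exact hu
    have hx := hm x (by simp)
    have hy := hm y (by simp)
    have hz := hm z (by simp)
    have hw := hm w (by simp)
    simp only [List.nodup_cons, List.mem_cons, List.not_mem_nil, or_false, not_or,
      not_false_eq_true, List.nodup_nil, and_true] at hnd
    grind

/-- The combinatorial type of a dual 3-cell with a triangle, relative to a vertex `v` of the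
triangle: the cube has no triangles. -/
theorem dualThreeCell_cases (hG : IsTilingFace P G) (hdim : dim G + 3 = d) {v p q : P.lattice}
    (hnd : [v, p, q].Nodup) (hX : {v, p, q} ∈ dualTwoCells P G) :
    (∃ b c e, IsTetrahedron P G v b c e) ∨ (∃ a b c e, IsPyramid P G v a b c e) ∨
    (∃ s b c e, IsPyramid P G s v b c e) ∨ (∃ b c a' b' c', IsOctahedron P G v b c a' b' c') ∨
    (∃ b c a' b' c', IsPrism P G v b c a' b' c') := by
  have hnd' := hnd
  simp only [List.nodup_cons, List.mem_cons, List.not_mem_nil, or_false, not_or,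
    not_false_eq_true, List.nodup_nil, and_true] at hnd'
  obtain ⟨⟨hvp, hvq⟩, hpq⟩ := hnd'
  obtain ⟨E, hE, hEd, hGE, hD⟩ := id hX
  have hv : v ∈ dualCell P E := by rw [← hD]; simp
  have hp : p ∈ dualCell P E := by rw [← hD]; simp
  have hq : q ∈ dualCell P E := by rw [← hD]; simp
  have avp := adjacent_of_triangle hE hEd hD.symm hv hp hvp
  have avq := adjacent_of_triangle hE hEd hD.symm hv hq hvq
  have apq := adjacent_of_triangle hE hEd hD.symm hp hq hpq
  refine (isThreeCell hG hdim).classification hX hnd avp avq apq ?_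
  by_cases hc : ∃ s ∈ dualCell P G, ∃ t ∈ dualCell P G, s ≠ t ∧ tile P s ∩ tile P t = G
  · obtain ⟨s, -, t, -, hst, hsG⟩ := hc
    have hne : G.Nonempty := hG.choose_spec.nonempty
    have hsub := dualCell_mono hG hGE
    refine Or.inl ⟨s + t, fun u hu => ⟨reflect_mem_dualCell hsG hu, reflect_ne hne hsG hst hu⟩, ?_,
      fun e he => mem_of_central hdim hsG (hsub hv) (hsub hp) (hsub hq) he avp apq avq⟩
    rintro X ⟨E', hE', hEd', hGE', rfl⟩ u hu hku
    have h1 := inter_reflect_eq hsG hne (dualCell_mono hG hGE' hu)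
    have h2 := dim_mono (subset_inter_tile hku hu)
    rw [h1] at h2
    omega
  · push Not at hc
    exact Or.inr (hasParallelograms hdim hc)

end ThreeCells

section Labels

variable {d : ℕ} {P : Parallelohedron d} {G : Set (EuclideanSpace ℝ (Fin d))}

/-- Lattice vectors that differ by the double of a lattice vector have the same class. -/
theorem parity_eq {x y w : P.lattice} (h : y = x + (w + w)) : parity P x = parity P y := by
  rw [parity, parity, QuotientAddGroup.eq]
  exact ⟨w, by rw [h]; simp [two_nsmul]⟩

theorem exists_mem_octa {A : Type*} {a b c a' b' c' x y z : A} (hx : x = a ∨ x = a')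
    (hy : y = b ∨ y = b') (hz : z = c ∨ z = c') :
    ∃ T ∈ octa a b c a' b' c', x ∈ T ∧ y ∈ T ∧ z ∈ T := by
  classical
  refine ⟨{x, y, z}, ?_, by simp, by simp, by simp⟩
  rcases hx with rfl | rfl <;> rcases hy with rfl | rfl <;> rcases hz with rfl | rfl <;>
    simp [octa]

theorem inFace_of_octa {a b c a' b' c' x y z : Parity P} (h : octa a b c a' b' c' ⊆ triples P)
    (hx : x = a ∨ x = a') (hy : y = b ∨ y = b') (hz : z = c ∨ z = c') : InFace (Ven P) x y z := by
  obtain ⟨T, hT, h1, h2, h3⟩ := exists_mem_octa hx hy hz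
  exact ⟨T, ⟨⟨x, h1⟩, T, h hT, subset_rfl⟩, h1, h2, h3⟩

theorem pair_eq_of_triple_eq {α : Type*} {v t t' b c : α} (hnd : [v, t, t'].Nodup)
    (h : ({v, t, t'} : Set α) = {v, b, c}) :
    t = b ∧ t' = c ∨ t = c ∧ t' = b := by
  simp only [List.nodup_cons, List.mem_cons, List.not_mem_nil, or_false, not_or,
    not_false_eq_true, List.nodup_nil, and_true] at hnd
  have hm : ∀ u ∈ ({v, t, t'} : Set α), u = v ∨ u = b ∨ u = c := fun u hu => by
    rw [h] at hu; exact hu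
  have h1 := hm t (by simp)
  have h2 := hm t' (by simp)
  grind

theorem triple_ne_of_nodup {α : Type*} {v t t' a b c e : α} (hnd : [a, b, c, e].Nodup) :
    ({v, t, t'} : Set α) ≠ {a, b, c, e} := by
  intro h
  simp only [List.nodup_cons, List.mem_cons, List.not_mem_nil, or_false, not_or,
    not_false_eq_true, List.nodup_nil, and_true] at hnd
  have hm : ∀ u ∈ ({a, b, c, e} : Set α), u = v ∨ u = t ∨ u = t' := fun u hu => by
    rw [← h] at hu; exact hu
  have h1 := hm a (by simp)
  have h2 := hm b (by simp)
  have h3 := hm c (by simp)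
  have h4 := hm e (by simp)
  grind

/-- The values `v + t` of the labels around a vertex `v` of a dual 3-cell lie in a cone of `Ven P`:
there is `z` such that for each triangle `v t t'` of the cell the labels `v + t` and `v + t'` lie in
a common face with `z`, and in a common face with `t + t'`. -/
theorem exists_cone_point (hG : IsTilingFace P G) (hdim : dim G + 3 = d) {v p q : P.lattice}
    (hnd : [v, p, q].Nodup) (hX : {v, p, q} ∈ dualTwoCells P G) :
    ∃ z, ∀ t t', [v, t, t'].Nodup → {v, t, t'} ∈ dualTwoCells P G →
      InFace (Ven P) z (parity P (v + t)) (parity P (v + t')) ∧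
      InFace (Ven P) (parity P (v + t)) (parity P (v + t')) (parity P (t + t')) := by
  -- The cone points: `v + b` for a tetrahedron or prism with an edge `v b`, the common class of two
  -- opposite base edges for a pyramid with apex `v`, `v + s` for a pyramid with apex `s`,
  -- and `b + c` for an octahedron with a triangle `v b c`.
  -- The conditions are symmetric in `t` and `t'`.
  have hsym : ∀ {z t t' b c}, t = b ∧ t' = c ∨ t = c ∧ t' = b →
      (InFace (Ven P) z (parity P (v + b)) (parity P (v + c)) ∧
        InFace (Ven P) (parity P (v + b)) (parity P (v + c)) (parity P (b + c))) →
      (InFace (Ven P) z (parity P (v + t)) (parity P (v + t')) ∧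
        InFace (Ven P) (parity P (v + t)) (parity P (v + t')) (parity P (t + t'))) := by
    rintro z t t' b c (⟨rfl, rfl⟩ | ⟨rfl, rfl⟩) ⟨h1, h2⟩
    · exact ⟨h1, h2⟩
    · exact ⟨h1.swap, by rw [add_comm t]; exact h2.rotate.swap⟩
  have hout : ∀ {t t' : P.lattice} {X : Set P.lattice}, ({v, t, t'} : Set P.lattice) = X →
      v ∈ X := by
    rintro t t' X rfl
    simp
  rcases dualThreeCell_cases hG hdim hnd hX with ⟨b, c, e, h⟩ | ⟨a, b, c, e, h⟩ | ⟨s, b, c, e, h⟩ |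
    ⟨b, c, b', b₁, c₁, h⟩ | ⟨b, c, a', b', c', h⟩
  · have hO : octa _ _ _ _ _ _ ⊆ triples P :=
      fun T hT => ⟨G, hG, hdim, Or.inl ⟨v, b, c, e, h, hT⟩⟩
    obtain ⟨hn, -, hT⟩ := h
    simp only [List.nodup_cons, List.mem_cons, List.not_mem_nil, or_false, not_or,
      not_false_eq_true, List.nodup_nil, and_true] at hn
    refine ⟨parity P (v + b), fun t t' hn' ht => ?_⟩
    rw [hT] at ht
    rcases ht with ht | ht | ht | ht
    · refine hsym (pair_eq_of_triple_eq hn' ht) ⟨?_, ?_⟩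
      · obtain ⟨S, hS, h1, h2, h3⟩ :=
          inFace_of_octa hO (Or.inl rfl) (Or.inl rfl) (Or.inl rfl)
        exact ⟨S, hS, h1, h1, h2⟩
      · exact inFace_of_octa hO (Or.inl rfl) (Or.inl rfl) (Or.inr rfl)
    · refine hsym (pair_eq_of_triple_eq hn' ht) ⟨?_, ?_⟩
      · obtain ⟨S, hS, h1, h2, h3⟩ :=
          inFace_of_octa hO (Or.inl rfl) (Or.inl rfl) (Or.inl rfl)
        exact ⟨S, hS, h1, h1, h3⟩
      · exact (inFace_of_octa hO (Or.inl rfl) (Or.inr rfl) (Or.inl rfl)).swap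
    · refine hsym (pair_eq_of_triple_eq hn' ht) ⟨?_, ?_⟩
      · exact inFace_of_octa hO (Or.inl rfl) (Or.inl rfl) (Or.inl rfl)
      · exact (inFace_of_octa hO (Or.inr rfl) (Or.inl rfl) (Or.inl rfl)).rotate
    · have := hout ht
      simp only [Set.mem_insert_iff, Set.mem_singleton_iff] at this
      tauto
  · have hO : octa _ _ _ _ _ _ ⊆ triples P :=
      fun T hT => ⟨G, hG, hdim, Or.inr (Or.inl ⟨v, a, b, c, e, h, hT⟩)⟩
    obtain ⟨hn, -, hT, hs⟩ := h
    obtain rfl : c = b + e - a := eq_sub_of_add_eq' hs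
    have p1 : parity P (a + e) = parity P (b + (b + e - a)) :=
      parity_eq (w := b - a) (by abel)
    have p2 : parity P (a + b) = parity P ((b + e - a) + e) :=
      parity_eq (w := e - a) (by abel)
    refine ⟨parity P (a + e), fun t t' hn' ht => ?_⟩
    rw [hT] at ht
    rcases ht with ht | ht | ht | ht | ht
    · refine hsym (pair_eq_of_triple_eq hn' ht) ⟨?_, ?_⟩
      · exact (inFace_of_octa hO (Or.inl rfl) (Or.inl rfl) (Or.inl rfl)).rotate.rotate
      · exact inFace_of_octa hO (Or.inl rfl) (Or.inl rfl) (Or.inr rfl)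
    · refine hsym (pair_eq_of_triple_eq hn' ht) ⟨?_, ?_⟩
      · exact (inFace_of_octa hO (Or.inr rfl) (Or.inl rfl) (Or.inl rfl)).rotate.rotate.swap
      · exact (inFace_of_octa hO (Or.inr rfl) (Or.inl rfl) (Or.inl p1.symm)).rotate.swap
    · refine hsym (pair_eq_of_triple_eq hn' ht) ⟨?_, ?_⟩
      · exact (inFace_of_octa hO (Or.inr rfl) (Or.inr rfl) (Or.inl rfl)).rotate.rotate
      · exact inFace_of_octa hO (Or.inr rfl) (Or.inr rfl) (Or.inr p2.symm)
    · refine hsym (pair_eq_of_triple_eq hn' ht) ⟨?_, ?_⟩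
      · exact (inFace_of_octa hO (Or.inl rfl) (Or.inr rfl) (Or.inl rfl)).rotate.rotate.swap
      · exact (inFace_of_octa hO (Or.inl rfl) (Or.inr rfl)
          (Or.inl (congrArg _ (add_comm e a)))).rotate.swap
    · exact absurd ht (triple_ne_of_nodup (List.nodup_cons.1 hn).2)
  · have hO : octa _ _ _ _ _ _ ⊆ triples P :=
      fun T hT => ⟨G, hG, hdim, Or.inr (Or.inl ⟨s, v, b, c, e, h, hT⟩)⟩
    obtain ⟨hn, -, hT, -⟩ := h
    have hn₄ := (List.nodup_cons.1 hn).2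
    simp only [List.nodup_cons, List.mem_cons, List.not_mem_nil, or_false, not_or,
      not_false_eq_true, List.nodup_nil, and_true] at hn
    refine ⟨parity P (s + v), fun t t' hn' ht => ?_⟩
    rw [hT] at ht
    have hvs : parity P (v + s) = parity P (s + v) := congrArg _ (add_comm v s)
    rcases ht with ht | ht | ht | ht | ht
    · rw [Set.insert_comm s v] at ht
      refine hsym (pair_eq_of_triple_eq hn' ht) ?_
      obtain ⟨S, hS, h1, h2, h3⟩ :=
        inFace_of_octa hO (Or.inl rfl) (Or.inl rfl) (Or.inr rfl)
      rw [hvs]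
      exact ⟨⟨S, hS, h1, h1, h3⟩, ⟨S, hS, h1, h3, h2⟩⟩
    · have := hout ht
      simp only [Set.mem_insert_iff, Set.mem_singleton_iff] at this
      tauto
    · have := hout ht
      simp only [Set.mem_insert_iff, Set.mem_singleton_iff] at this
      tauto
    · have he : ({s, e, v} : Set P.lattice) = {v, s, e} := by ext; simp; tauto
      rw [he] at ht
      refine hsym (pair_eq_of_triple_eq hn' ht) ?_
      obtain ⟨S, hS, h1, h2, h3⟩ :=
        inFace_of_octa hO (Or.inl rfl) (Or.inr rfl) (Or.inl rfl)
      rw [hvs]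
      exact ⟨⟨S, hS, h1, h1, h3⟩, ⟨S, hS, h1, h3, h2⟩⟩
    · exact absurd ht (triple_ne_of_nodup hn₄)
  · have hO : octa _ _ _ _ _ _ ⊆ triples P :=
      fun T hT => ⟨G, hG, hdim, Or.inr (Or.inr (Or.inl ⟨v, b, c, b', b₁, c₁, h, hT⟩))⟩
    obtain ⟨hn, -, hT, -, hs⟩ := h
    simp only [List.nodup_cons, List.mem_cons, List.not_mem_nil, or_false, not_or,
      not_false_eq_true, List.nodup_nil, and_true] at hn
    obtain rfl : c₁ = b + b₁ - c := eq_sub_of_add_eq' hs.symm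
    have p1 : parity P (b + (b + b₁ - c)) = parity P (b₁ + c) :=
      parity_eq (w := c - b) (by abel)
    have p2 : parity P (b + c) = parity P (b₁ + (b + b₁ - c)) :=
      parity_eq (w := b₁ - c) (by abel)
    refine ⟨parity P (b + c), fun t t' hn' ht => ?_⟩
    rw [hT] at ht
    rcases ht with ht | ht | ht | ht | ht | ht | ht | ht
    · refine hsym (pair_eq_of_triple_eq hn' ht) ⟨?_, ?_⟩
      · exact (inFace_of_octa hO (Or.inl rfl) (Or.inl rfl) (Or.inl rfl)).rotate.rotate
      · exact inFace_of_octa hO (Or.inl rfl) (Or.inl rfl) (Or.inl rfl)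
    · refine hsym (pair_eq_of_triple_eq hn' ht) ⟨?_, ?_⟩
      · exact (inFace_of_octa hO (Or.inl rfl) (Or.inr rfl) (Or.inl rfl)).rotate.rotate
      · exact inFace_of_octa hO (Or.inl rfl) (Or.inr rfl) (Or.inr rfl)
    · refine hsym (pair_eq_of_triple_eq hn' ht) ⟨?_, ?_⟩
      · exact (inFace_of_octa hO (Or.inr rfl) (Or.inl rfl) (Or.inl rfl)).rotate.rotate
      · exact inFace_of_octa hO (Or.inr rfl) (Or.inl rfl) (Or.inr p1.symm)
    · refine hsym (pair_eq_of_triple_eq hn' ht) ⟨?_, ?_⟩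
      · exact (inFace_of_octa hO (Or.inr rfl) (Or.inr rfl) (Or.inl rfl)).rotate.rotate
      · exact inFace_of_octa hO (Or.inr rfl) (Or.inr rfl) (Or.inl p2.symm)
    all_goals
      have := hout ht
      simp only [Set.mem_insert_iff, Set.mem_singleton_iff] at this
      tauto
  · obtain ⟨S, hS, h1, h2, h3⟩ :
        InFace (Ven P) (parity P (v + b)) (parity P (v + c)) (parity P (b + c)) := by
      refine ⟨_, ⟨?_, _, ⟨G, hG, hdim, Or.inr (Or.inr (Or.inr ⟨v, b, c, a', b', c', h, rfl⟩))⟩,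
        subset_rfl⟩, ?_, ?_, ?_⟩ <;> simp
    obtain ⟨hn, -, hT, -⟩ := h
    simp only [List.nodup_cons, List.mem_cons, List.not_mem_nil, or_false, not_or,
      not_false_eq_true, List.nodup_nil, and_true] at hn
    refine ⟨parity P (v + b), fun t t' hn' ht => ?_⟩
    rw [hT] at ht
    rcases ht with ht | ht | ht | ht | ht
    · exact hsym (pair_eq_of_triple_eq hn' ht) ⟨⟨S, hS, h1, h1, h2⟩, ⟨S, hS, h1, h2, h3⟩⟩
    · have := hout ht
      simp only [Set.mem_insert_iff, Set.mem_singleton_iff] at this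
      tauto
    · exact absurd ht (triple_ne_of_nodup (by simp; grind))
    · have := hout ht
      simp only [Set.mem_insert_iff, Set.mem_singleton_iff] at this
      tauto
    · exact absurd ht (triple_ne_of_nodup (by simp; grind))

end Labels

end Venkov

/-! ### Half-belt and trivially contractible cycles -/

namespace Venkov

section ParallelFaces

variable {d : ℕ} {Q : Set (EuclideanSpace ℝ (Fin d))}

theorem IsFace.eq_of_vectorSpan_eq {E E' : Set (EuclideanSpace ℝ (Fin d))} (hE : IsFace Q E)
    (hE' : IsFace Q E') (hs : vectorSpan ℝ E = vectorSpan ℝ E')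
    {x : EuclideanSpace ℝ (Fin d)} (hx : x ∈ E) (hx' : x ∈ E') : E = E' := by
  refine Set.Subset.antisymm (fun y hy => ?_) fun y hy => ?_
  · exact hE'.mem_of_sub_mem (hE.subset hy) hx' (hs ▸ sub_mem_vectorSpan hy hx)
  · exact hE.mem_of_sub_mem (hE'.subset hy) hx (hs ▸ sub_mem_vectorSpan hy hx')

/-- A polytope has at most two facets with a given direction. -/
theorem facets_eq_of_parallel {E : Fin 3 → Set (EuclideanSpace ℝ (Fin d))}
    {W : Submodule ℝ (EuclideanSpace ℝ (Fin d))} (hE : ∀ i, IsFace Q (E i))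
    (hW : ∀ i, vectorSpan ℝ (E i) = W) (hdim : Module.finrank ℝ W + 1 = dim Q) :
    E 0 = E 1 ∨ E 0 = E 2 ∨ E 1 = E 2 := by
  choose l m hl hEl using fun i => (isFace_iff.1 (hE i)).2
  choose e he using fun i => (hE i).nonempty
  have heq : ∀ i j, ∀ x ∈ E i, x ∈ E j → E i = E j := fun i j x hx hx' =>
    (hE i).eq_of_vectorSpan_eq (hE j) ((hW i).trans (hW j).symm) hx hx'
  have heQ : ∀ i, e i ∈ Q := fun i => (hE i).subset (he i)
  have hle : ∀ i, l i (e i) = m i := fun i => by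
    have := he i
    rw [hEl] at this
    exact this.2
  have hlW : ∀ i, W ≤ LinearMap.ker (l i) := fun i => by
    rw [← hW i]
    refine vectorSpan_le_ker (m := m i) fun x hx => ?_
    rw [hEl] at hx
    exact hx.2
  have hmem : ∀ i, ∀ x ∈ Q, m i ≤ l i x → x ∈ E i := fun i x hx hm => by
    rw [hEl]
    exact ⟨hx, le_antisymm (hl i x hx) hm⟩
  obtain ⟨y, hy, hy0⟩ : ∃ y ∈ Q, l 0 y ≠ m 0 := by
    by_contra hcon
    push Not at hcon
    have : E 0 = Q := (hE 0).subset.antisymm fun x hx => hmem 0 x hx (hcon x hx).ge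
    rw [← this, dim, hW 0] at hdim
    omega
  set v := y - e 0 with hv
  have hv0 : l 0 v ≠ 0 := by
    rw [hv, map_sub, hle, sub_ne_zero]
    exact hy0
  have hvW : v ∉ W := fun h => hv0 (hlW 0 h)
  have hspan : vectorSpan ℝ Q = W ⊔ ℝ ∙ v := by
    have hle' : W ⊔ ℝ ∙ v ≤ vectorSpan ℝ Q := by
      refine sup_le ?_ ?_
      · rw [← hW 0]
        exact vectorSpan_mono ℝ (hE 0).subset
      · rw [Submodule.span_singleton_le_iff_mem]
        exact sub_mem_vectorSpan hy (heQ 0)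
    refine (Submodule.eq_of_le_of_finrank_le hle' ?_).symm
    have hlt : W < W ⊔ ℝ ∙ v := by
      refine lt_of_le_of_ne le_sup_left fun h => hvW ?_
      rw [h]
      exact Submodule.mem_sup_right (Submodule.mem_span_singleton_self v)
    have := Submodule.finrank_lt_finrank_of_lt hlt
    rw [dim] at hdim
    omega
  have hprop : ∀ i, ∀ x ∈ Q, ∀ z ∈ Q, l i x - l i z = l i v / l 0 v * (l 0 x - l 0 z) := by
    intro i x hx z hz
    have hxz := sub_mem_vectorSpan hx hz
    rw [hspan] at hxz
    obtain ⟨w, hw, u, hu, hwu⟩ := Submodule.mem_sup.1 hxz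
    obtain ⟨r, rfl⟩ := Submodule.mem_span_singleton.1 hu
    have h1 : ∀ j, l j x - l j z = r * l j v := fun j => by
      rw [← map_sub, ← hwu, map_add, map_smul, LinearMap.mem_ker.1 (hlW j hw), zero_add,
        smul_eq_mul]
    rw [h1, h1]
    field_simp
  -- a functional that is positively proportional to `l 0` is also maximal at `e 0`
  have hpos : ∀ i, 0 ≤ l i v / l 0 v → E 0 = E i := fun i hi => by
    refine heq 0 i (e 0) (he 0) (hmem i _ (heQ 0) ?_)
    have h1 := hprop i _ (heQ i) _ (heQ 0)
    have h2 := hl 0 _ (heQ i)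
    have h3 := mul_nonneg hi (sub_nonneg.2 h2)
    rw [← hle 0] at h3
    rw [← hle i]
    linarith
  rcases le_or_gt 0 (l 1 v / l 0 v) with h1 | h1
  · exact Or.inl (hpos 1 h1)
  rcases le_or_gt 0 (l 2 v / l 0 v) with h2 | h2
  · exact Or.inr (Or.inl (hpos 2 h2))
  refine Or.inr (Or.inr (heq 1 2 (e 1) (he 1) (hmem 2 _ (heQ 1) ?_)))
  have h3 := hprop 1 _ (heQ 2) _ (heQ 1)
  have h4 := hprop 2 _ (heQ 2) _ (heQ 1)
  have h5 := hl 1 _ (heQ 2)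
  rw [← hle 1] at h5
  have h6 : 0 ≤ l 0 (e 2) - l 0 (e 1) := by
    by_contra hcon
    have := mul_pos_of_neg_of_neg h1 (not_le.1 hcon)
    linarith
  have h7 := mul_nonpos_iff.2 (Or.inr ⟨h2.le, h6⟩)
  rw [← hle 2]
  linarith

/-- Two facets that meet in codimension two determine the direction of their intersection. -/
theorem vectorSpan_inter_eq {F F' : Set (EuclideanSpace ℝ (Fin d))} (hF : IsFace Q F)
    (hF' : IsFace Q F') (hne : (F ∩ F').Nonempty) (hd : dim F = dim F')
    (hdim : dim (F ∩ F') + 1 = dim F) {W : Submodule ℝ (EuclideanSpace ℝ (Fin d))}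
    (hW : Module.finrank ℝ W = dim (F ∩ F')) (hWF : W ≤ vectorSpan ℝ F)
    (hWF' : W ≤ vectorSpan ℝ F') : vectorSpan ℝ (F ∩ F') = W := by
  obtain ⟨x, hx, hx'⟩ := hne
  have hlt : vectorSpan ℝ F ⊓ vectorSpan ℝ F' < vectorSpan ℝ F := by
    refine lt_of_le_of_ne inf_le_left fun h => ?_
    have h1 : vectorSpan ℝ F = vectorSpan ℝ F' :=
      Submodule.eq_of_le_of_finrank_le (inf_eq_left.1 h) hd.ge
    rw [hF.eq_of_vectorSpan_eq hF' h1 hx hx', Set.inter_self] at hdim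
    omega
  have h1 := Submodule.finrank_lt_finrank_of_lt hlt
  have h2 : vectorSpan ℝ (F ∩ F') ≤ vectorSpan ℝ F ⊓ vectorSpan ℝ F' :=
    le_inf (vectorSpan_mono ℝ Set.inter_subset_left) (vectorSpan_mono ℝ Set.inter_subset_right)
  rw [dim, dim] at hdim
  rw [dim] at hW
  rw [Submodule.eq_of_le_of_finrank_le h2 (by omega),
    Submodule.eq_of_le_of_finrank_le (le_inf hWF hWF') (by omega)]

end ParallelFaces

section Cycles

variable {d : ℕ} {P : Parallelohedron d} {R : Type*} [CommRing R]

theorem IsFace.isTilingFace {G : Set (EuclideanSpace ℝ (Fin d))} (h : IsFace P.body G) :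
    IsTilingFace P G :=
  ⟨0, by rwa [tile_zero]⟩

theorem zero_mem_dualCell {G : Set (EuclideanSpace ℝ (Fin d))} (h : IsFace P.body G) :
    0 ∈ dualCell P G := by
  rwa [mem_dualCell, tile_zero]

theorem mem_dualCell_of_subset {G : Set (EuclideanSpace ℝ (Fin d))} {t : P.lattice}
    (hG : IsTilingFace P G) (h : G ⊆ tile P t) : t ∈ dualCell P G := by
  obtain ⟨g, hg⟩ := hG.exists_isRelInterior
  exact hG.choose_spec.of_relInterior_mem hg (h hg.1)

theorem neg_inter_tile (t : P.lattice) :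
    -(P.body ∩ tile P t) = P.body ∩ tile P (-t) := by
  ext x
  have h : -x - (t : EuclideanSpace ℝ (Fin d)) = -(x - ((-t : P.lattice) : _)) := by
    push_cast
    abel
  rw [Set.mem_neg, Set.mem_inter_iff, Set.mem_inter_iff, neg_mem_body, mem_tile, mem_tile, h,
    neg_mem_body]

theorem dim_body : dim P.body = d := by
  rw [← tile_zero, dim_tile]

/-- The dual cell of the primitive intersection of the facets between the tiles `0` and `s` and
between the tiles `0` and `t`. -/
theorem dualCell_of_primitive {s t : P.lattice}
    (hs : dim (P.body ∩ tile P s) + 1 = d) (ht : dim (P.body ∩ tile P t) + 1 = d)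
    (h : IsPrimitive P (P.body ∩ tile P s ∩ (P.body ∩ tile P t))) :
    [0, s, t].Nodup ∧ dualCell P (P.body ∩ tile P s ∩ (P.body ∩ tile P t)) = {0, s, t} := by
  obtain ⟨hE, hdim, hcard⟩ := h
  have h0 : ∀ {u : P.lattice}, dim (P.body ∩ tile P u) + 1 = d → 0 ≠ u := by
    rintro u hu rfl
    rw [tile_zero, Set.inter_self, dim_body] at hu
    omega
  have hst : s ≠ t := by
    rintro rfl
    rw [Set.inter_self] at hdim
    omega
  have hnd : [0, s, t].Nodup := by simp [h0 hs, h0 ht, hst]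
  refine ⟨hnd, (Set.eq_of_subset_of_ncard_le ?_ ?_ (Set.finite_of_ncard_pos (by omega))).symm⟩
  · rintro u (rfl | rfl | rfl)
    · exact zero_mem_dualCell hE
    · exact mem_dualCell_of_subset hE.isTilingFace fun x hx => hx.1.2
    · exact mem_dualCell_of_subset hE.isTilingFace fun x hx => hx.2.2
  · rw [hcard, Set.ncard_eq_three.2 ⟨0, s, t, h0 hs, h0 ht, hst, rfl⟩]

/-- On the labels of the facets around a face of codimension three, a cocycle is the coboundary of
its values on the edges from the cone point, so its sum over a closed path is zero. -/
theorem evalCycle_eq_zero_of_isTriviallyContractible {c : C1 (Ven P) R} (hc : c ∈ Z1 (Ven P) R)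
    {k : ℕ} {x : Fin (k + 1) → Parity P} (hx : IsTriviallyContractible P x) :
    evalCycle c x = 0 := by
  obtain ⟨F, G, hF, -, hG, hdim, hGF, hE⟩ := hx
  choose hfac t hFt hxt using hF
  have key : ∀ i, [0, t i, t (i + 1)].Nodup ∧ {0, t i, t (i + 1)} ∈ dualTwoCells P G := by
    intro i
    have hE' := hE i
    have h1 := (hfac i).2
    have h2 := (hfac (i + 1)).2
    have hsub : G ⊆ F i ∩ F (i + 1) := Set.subset_inter (hGF i) (hGF (i + 1))
    rw [hFt i] at h1 hE' hsub
    rw [hFt (i + 1)] at h2 hE' hsub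
    obtain ⟨h3, h4⟩ := dualCell_of_primitive h1 h2 hE'
    exact ⟨h3, _, hE'.1.isTilingFace, hE'.2.1, hsub, h4.symm⟩
  obtain ⟨z, hz⟩ := exists_cone_point hG.isTilingFace hdim (key 0).1 (key 0).2
  have hterm : ∀ i, c.1 (x i) (x (i + 1)) = c.1 z (x (i + 1)) - c.1 z (x i) := by
    intro i
    have h1 := (hz _ _ (key i).1 (key i).2).1
    rw [zero_add, zero_add, ← hxt, ← hxt] at h1
    have h2 := cocycle_triangle hc h1
    rw [cochain_symm c z (x (i + 1))] at h2
    linear_combination h2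
  rw [evalCycle, Finset.sum_congr rfl fun i _ => hterm i, Finset.sum_sub_distrib]
  exact sub_eq_zero.2 (Equiv.sum_comp (Equiv.addRight (1 : Fin (k + 1))) fun i => c.1 z (x i))

/-- Three consecutive facets of a belt of six: the lattice vectors satisfy `t₃ = t₂ - t₁`. The facet
`-F₁` has only two facets parallel to `E₁ = F₁ ∩ F₂`, namely `-E₁` and `E₁ - t₁`, whose dual cells
are known, and `F₃ ∩ -F₁` is one of them. -/
theorem eq_sub_of_halfBelt {t₁ t₂ t₃ : P.lattice} {G : Set (EuclideanSpace ℝ (Fin d))}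
    (h₁ : IsFacet P (P.body ∩ tile P t₁)) (h₂ : IsFacet P (P.body ∩ tile P t₂))
    (h₃ : IsFacet P (P.body ∩ tile P t₃))
    (hE₁ : IsPrimitive P (P.body ∩ tile P t₁ ∩ (P.body ∩ tile P t₂)))
    (hE₂ : (P.body ∩ tile P t₂ ∩ (P.body ∩ tile P t₃)).Nonempty)
    (hE₃ : IsPrimitive P (P.body ∩ tile P t₃ ∩ (P.body ∩ tile P (-t₁))))
    (hG : dim G + 2 = d) (hG₁ : vectorSpan ℝ G ≤ vectorSpan ℝ (P.body ∩ tile P t₁))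
    (hG₂ : vectorSpan ℝ G ≤ vectorSpan ℝ (P.body ∩ tile P t₂))
    (hG₃ : vectorSpan ℝ G ≤ vectorSpan ℝ (P.body ∩ tile P t₃)) : t₃ = t₂ - t₁ := by
  have hopp : reflect (0 : P.lattice) (P.body ∩ tile P t₁) = P.body ∩ tile P (-t₁) := by
    rw [← neg_inter_tile]
    ext x
    simp [mem_reflect]
  have hspan : vectorSpan ℝ (P.body ∩ tile P (-t₁)) = vectorSpan ℝ (P.body ∩ tile P t₁) := by
    rw [← hopp, vectorSpan_reflect]
  have hdim₄ : dim (P.body ∩ tile P (-t₁)) + 1 = d := by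
    rw [dim, hspan]
    exact h₁.2
  obtain ⟨hnd₁, hD₁⟩ := dualCell_of_primitive h₁.2 h₂.2 hE₁
  obtain ⟨hnd₃, hD₃⟩ := dualCell_of_primitive h₃.2 hdim₄ hE₃
  have hface₄ : IsFace P.body (P.body ∩ tile P (-t₁)) := by
    obtain ⟨x, hx⟩ := hE₃.1.nonempty
    have := isFace_inter (P := P) (s := 0) (t := -t₁) ⟨x, by rw [tile_zero]; exact hx.2⟩
    rwa [tile_zero] at this
  set E₁ := P.body ∩ tile P t₁ ∩ (P.body ∩ tile P t₂) with hE₁def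
  set E₃ := P.body ∩ tile P t₃ ∩ (P.body ∩ tile P (-t₁)) with hE₃def
  have hW₁ : vectorSpan ℝ E₁ = vectorSpan ℝ G := by
    have e1 := h₁.2
    have e2 := h₂.2
    have e3 := hE₁.2.1
    refine vectorSpan_inter_eq h₁.1 h₂.1 hE₁.1.nonempty (by omega) ?_ ?_ hG₁ hG₂
    · rw [hE₁def] at e3
      omega
    · rw [← dim]
      rw [hE₁def] at e3
      omega
  have hW₃ : vectorSpan ℝ E₃ = vectorSpan ℝ G := by
    have e1 := h₃.2
    have e3 := hE₃.2.1
    refine vectorSpan_inter_eq h₃.1 hface₄ hE₃.1.nonempty (by omega) ?_ ?_ hG₃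
      (hspan ▸ hG₁)
    · rw [hE₃def] at e3
      omega
    · rw [← dim]
      rw [hE₃def] at e3
      omega
  simp only [List.nodup_cons, List.mem_cons, List.not_mem_nil, or_false, not_or,
    not_false_eq_true, List.nodup_nil, and_true] at hnd₁ hnd₃
  obtain ⟨⟨h01, h02⟩, h12⟩ := hnd₁
  obtain ⟨⟨h03, -⟩, h31⟩ := hnd₃
  -- the two facets of the opposite facet that are parallel to `E₁`
  have hA : ∀ u, u ∈ dualCell P (reflect (0 : P.lattice) E₁) ↔ u = 0 ∨ u = -t₁ ∨ u = -t₂ := by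
    intro u
    rw [mem_dualCell_reflect, hD₁, zero_sub]
    simp only [Set.mem_insert_iff, Set.mem_singleton_iff, neg_eq_iff_eq_neg, neg_zero]
  have hB : ∀ u, u ∈ dualCell P (reflect (-t₁) (reflect (0 : P.lattice) E₁)) ↔
      u = -t₁ ∨ u = 0 ∨ u = t₂ - t₁ := by
    intro u
    rw [mem_dualCell_reflect, hA]
    refine or_congr ?_ (or_congr ?_ ?_)
    · rw [sub_eq_zero, eq_comm]
    · rw [sub_eq_self]
    · rw [sub_eq_iff_eq_add, eq_comm, ← eq_sub_iff_add_eq', sub_neg_eq_add, neg_add_eq_sub]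
  have h₃mem : t₃ ∈ dualCell P E₃ := by rw [hD₃]; simp
  have hsubA : reflect (0 : P.lattice) E₁ ⊆ P.body ∩ tile P (-t₁) := by
    have := subset_inter_tile ((hA 0).2 (Or.inl rfl)) ((hA (-t₁)).2 (Or.inr (Or.inl rfl)))
    rwa [tile_zero] at this
  have hsubB : reflect (-t₁) (reflect (0 : P.lattice) E₁) ⊆ P.body ∩ tile P (-t₁) := by
    have := subset_inter_tile ((hB 0).2 (Or.inr (Or.inl rfl))) ((hB (-t₁)).2 (Or.inl rfl))
    rwa [tile_zero] at this
  have hfaceA : IsFace P.body (reflect (0 : P.lattice) E₁) := by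
    have := (hA 0).2 (Or.inl rfl)
    rwa [mem_dualCell, tile_zero] at this
  have hfaceB : IsFace P.body (reflect (-t₁) (reflect (0 : P.lattice) E₁)) := by
    have := (hB 0).2 (Or.inr (Or.inl rfl))
    rwa [mem_dualCell, tile_zero] at this
  have h3 := facets_eq_of_parallel (Q := P.body ∩ tile P (-t₁)) (W := vectorSpan ℝ G)
    (E := ![reflect (0 : P.lattice) E₁, reflect (-t₁) (reflect (0 : P.lattice) E₁), E₃])
    (by
      intro i
      fin_cases i
      · exact hfaceA.of_subset hsubA Set.inter_subset_left
      · exact hfaceB.of_subset hsubB Set.inter_subset_left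
      · exact hE₃.1.of_subset Set.inter_subset_right Set.inter_subset_left)
    (by
      intro i
      fin_cases i
      · exact (vectorSpan_reflect 0).trans hW₁
      · exact (vectorSpan_reflect _).trans ((vectorSpan_reflect 0).trans hW₁)
      · exact hW₃)
    (by rw [← dim]; omega)
  -- the centre of a tile lies in no other tile
  have hmid : ∀ {u s t : P.lattice}, (tile P s ∩ tile P t).Nonempty → s + t = u + u → s = u := by
    intro u s t hne hu
    have h1 := (middle_mem hne).1
    have h2 : middle s t = u := by
      have h3 : (s : EuclideanSpace ℝ (Fin d)) + t = u + u := by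
        exact_mod_cast congrArg Subtype.val hu
      rw [middle, h3, ← two_smul ℝ, smul_smul]
      norm_num
    rw [h2] at h1
    exact (eq_of_mem_interior (center_mem_interior u) h1).symm
  rcases h3 with h3 | h3 | h3
  · -- the two parallel faces are distinct: otherwise `t₂` would be the midpoint of `0` and `t₁`
    exfalso
    change reflect (0 : P.lattice) E₁ = reflect (-t₁) (reflect (0 : P.lattice) E₁) at h3
    have h4 := (hA (t₂ - t₁)).1 (by rw [h3]; exact (hB _).2 (Or.inr (Or.inr rfl)))
    rcases h4 with h4 | h4 | h4
    · exact h12 (sub_eq_zero.1 h4).symm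
    · exact h02 (sub_eq_neg_self.1 h4).symm
    · have h5 : (0 : P.lattice) + t₁ = t₂ + t₂ := by
        rw [zero_add, ← sub_eq_zero]
        rw [← sub_eq_zero] at h4
        rw [← neg_eq_zero, ← h4]
        abel
      refine h02 (hmid ?_ h5)
      obtain ⟨x, hx⟩ := h₁.1.nonempty
      exact ⟨x, by rw [tile_zero]; exact hx⟩
  · -- if `E₃ = -E₁`, then `t₃ = -t₂`, but opposite facets do not meet
    exfalso
    change reflect (0 : P.lattice) E₁ = E₃ at h3
    rw [← h3, hA] at h₃mem
    rcases h₃mem with h4 | h4 | h4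
    · exact h03 h4.symm
    · exact h31 h4
    · obtain ⟨x, hx⟩ := hE₂
      exact h02 (hmid (s := t₂) (t := t₃) (u := 0) ⟨x, hx.1.2, hx.2.2⟩ (by rw [h4]; abel)).symm
  · change reflect (-t₁) (reflect (0 : P.lattice) E₁) = E₃ at h3
    rw [← h3, hB] at h₃mem
    rcases h₃mem with h4 | h4 | h4
    · exact absurd h4 h31
    · exact absurd h4.symm h03
    · exact h4

/-- The labels of a half-belt are `x₁`, `x₂` and `x₁ + x₂`, the labels of the sides of a
triangle. -/
theorem evalCycle_eq_zero_of_isHalfBelt (hd : 3 ≤ d) {c : C1 (Ven P) R} (hc : c ∈ Z1 (Ven P) R)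
    {x : Fin 3 → Parity P} (hx : IsHalfBelt P x) : evalCycle c x = 0 := by
  obtain ⟨F₁, F₂, F₃, G, ⟨h₁, t₁, rfl, hx₁⟩, ⟨h₂, t₂, rfl, hx₂⟩, ⟨h₃, t₃, rfl, hx₃⟩, hE₁, hE₂, hE₃,
    hG, hG₁, hG₂, hG₃⟩ := hx
  rw [neg_inter_tile] at hE₃
  have ht₃ := eq_sub_of_halfBelt h₁ h₂ h₃ hE₁ hE₂.1.nonempty hE₃ hG.2.1 hG₁ hG₂ hG₃
  obtain ⟨hnd, hD⟩ := dualCell_of_primitive h₁.2 h₂.2 hE₁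
  -- any face of codimension three in `F₁ ∩ F₂` has the triangle `0 t₁ t₂` in its dual cell
  obtain ⟨G', hG', hdim⟩ := exists_facet hE₁.1.isTilingFace.isPolytope hE₁.1.nonempty
    (by have := hE₁.2.1; omega)
  have hpoly : IsPolytope P.body := by rw [← tile_zero]; exact isPolytope_tile 0
  have hGf : IsFace P.body G' := hE₁.1.trans hpoly hG'
  have hX : {0, t₁, t₂} ∈ dualTwoCells P G' :=
    ⟨_, hE₁.1.isTilingFace, hE₁.2.1, hG'.subset, hD.symm⟩
  obtain ⟨z, hz⟩ := exists_cone_point hGf.isTilingFace (by have := hE₁.2.1; omega) hnd hX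
  have h1 := (hz _ _ hnd hX).2
  have h2 : parity P t₃ = parity P (t₁ + t₂) := parity_eq (w := t₁) (by rw [ht₃]; abel)
  rw [zero_add, zero_add, ← hx₁, ← hx₂, ← h2, ← hx₃] at h1
  have h3 := cocycle_triangle hc h1
  rw [evalCycle, Fin.sum_univ_three]
  -- the last index `2 + 1` is `0` in `Fin 3`
  exact h3

end Cycles

end Venkov

theorem lemma6p4 (d : ℕ) (hd : 4 ≤ d) (P : Venkov.Parallelohedron d)
    (h : Venkov.GGMCochainCondition P) : Subsingleton (Venkov.H1 (Venkov.Ven P) ℝ) := by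
  refine Submodule.Quotient.subsingleton_iff.2 (eq_top_iff.2 ?_)
  rintro ⟨c, hc⟩ -
  change c ∈ Venkov.B1 (Venkov.Ven P) ℝ
  refine Venkov.mem_B1_of_mapCochain_mem fun φ => ?_
  have hφ := Venkov.mapCochain_mem_Z1 φ hc
  exact h _ (fun x hx => Venkov.evalCycle_eq_zero_of_isHalfBelt (by omega) hφ hx)
    fun k x hx => Venkov.evalCycle_eq_zero_of_isTriviallyContractible hφ hx
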